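/- A $\theta$-curve is an embedding in $S^3$ of the graph with two vertices joined by three edges; diagrams are taken on $S^2$. A crossing change at a crossing of a diagram makes the other strand pass over. The planar (trivial) $\theta$-curve is the one with the crossingless diagram. The extended Reidemeister moves are the usual moves I, II, III, the move IV in which a strand slides past a vertex (over it or behind it), and the move V in which two edges switch places next to a vertex, making or removing a crossing there. The Litherland–Moriuchi table consists, up to mirror image, of $90$ prime $\theta$-curves: $1, 1, 7, 16, 65$ of them with $n = 3, 4, 5, 6, 7$ crossings. It is presented here as an explicit list of $90$ entries. Each entry consists of $n$, a number $u \in \{1,2,3\}$, a nonempty list of diagrams with exactly $n$ crossings (planar diagram codes), and for each of these diagrams a nonempty list of sets of $u$ of its crossings. For every $\theta$-curve of the table, the list contains all its diagrams with the minimal number of crossings, up to isotopy of $S^2$ and mirror images; altogether there are $355$ diagrams and $1701$ sets of crossings. **Proposition.** Each of the listed codes is the code of a diagram of a $\theta$-curve on $S^2$ with the stated number of crossings. For each listed diagram $D$ and each set $S$ of crossings listed with it, the diagram obtained from $D$ by changing exactly the crossings in $S$ is joined by a finite sequence of extended Reidemeister moves, through diagrams of $\theta$-curves on $S^2$, to the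 crossingless diagram of the planar $\theta$-curve. In particular, every $\theta$-curve of the table is turned into the trivial $\theta$-curve by $u$ crossing changes in a diagram with $n$ crossings. -/

import Mathlib

namespace ThetaCurve

/-- A node of a diagram on the oriented sphere; the numbers are the labels of the incident arcs,
in counterclockwise order. `X a b c d` is a crossing at which the strand from `a` to `c` passes
under the strand from `b` to `d`; `V a b c` is a vertex of degree three; `P a b` is a marked point
in the interior of an edge, joining the arcs `a` and `b`. -/
inductive Node where
  | X (a b c d : ℕ)
  | V (a b c : ℕ)
  | P (a b : ℕ)
  deriving DecidableEq

/-- A planar diagram code: the list of the nodes. -/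
abbrev Diagram := List Node

namespace Node

def labels : Node → List ℕ
  | X a b c d => [a, b, c, d]
  | V a b c => [a, b, c]
  | P a b => [a, b]

def map (f : ℕ → ℕ) : Node → Node
  | X a b c d => X (f a) (f b) (f c) (f d)
  | V a b c => V (f a) (f b) (f c)
  | P a b => P (f a) (f b)

/-- Pairs of arcs that meet at the node in the spatial graph itself: the two arcs of one strand
of a crossing, the arcs at a vertex, the arcs at a marked point. -/
def links : Node → List (ℕ × ℕ)
  | X a b c d => [(a, c), (b, d)]
  | V a b c => [(a, b), (b, c)]
  | P a b => [(a, b)]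

def isVertex : Node → Bool
  | V _ _ _ => true
  | _ => false

def isCrossing : Node → Bool
  | X _ _ _ _ => true
  | _ => false

/-- The colour does not change along a strand, and the three colours at a vertex differ. -/
def Coloured (c : ℕ → Fin 3) : Node → Prop
  | X x y z w => c x = c z ∧ c y = c w
  | V x y z => c x ≠ c y ∧ c y ≠ c z ∧ c z ≠ c x
  | P x y => c x = c y

/-- The crossing change: the other strand now passes over. -/
def change : Node → Node
  | X a b c d => X b c d a
  | v => v

end Node

def labels (D : Diagram) : List ℕ := D.flatMap Node.labels

/-- The positions of the list `labels D` are the half-arcs of the diagram. The half-arc that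
forms one arc with the half-arc at position `i`: the other position with the same label. -/
def partner (D : Diagram) (i : ℕ) : ℕ :=
  let L := labels D
  ((List.range L.length).find? fun j => j != i && L[j]? == L[i]?).getD i

/-- The half-arc that precedes the half-arc `i` in the counterclockwise order at its node. -/
def clockwiseNext : Diagram → ℕ → ℕ
  | [], i => i
  | v :: D, i =>
    if i < v.labels.length then (i + (v.labels.length - 1)) % v.labels.length
    else v.labels.length + clockwiseNext D (i - v.labels.length)

/-- Going once around the boundaries of the faces, each face being on the left hand side. -/
def faceNext (D : Diagram) (i : ℕ) : ℕ := clockwiseNext D (partner D i)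

/-- The number of faces, i.e. of cycles of `faceNext`; each is counted at its least element.
The list `next` tabulates the values of `faceNext`. -/
def faceCount (D : Diagram) : ℕ :=
  let next := (List.range (labels D).length).map (faceNext D)
  (List.range next.length).countP fun i =>
    (List.iterate (fun j => next.getD j 0) i next.length).all fun j => decide (i ≤ j)

/-- `D` is the code of a diagram of a θ-curve on the sphere: every label names one arc, the
underlying graph is connected with two vertices of degree three and a proper 3-edge-colouring
(so that it has three edges, each of which joins one vertex to the other), and the surface on
which the code lives has Euler characteristic two. -/
structure IsThetaDiagram (D : Diagram) : Prop where
  twice : ∀ l ∈ labels D, (labels D).count l = 2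
  vertices : D.countP Node.isVertex = 2
  connected : ∀ l ∈ labels D, ∀ m ∈ labels D,
    Relation.EqvGen (fun x y => ∃ v ∈ D, (x, y) ∈ v.links) l m
  coloured : ∃ c : ℕ → Fin 3, ∀ v ∈ D, v.Coloured c
  planar : 2 * (D.length + faceCount D) = (labels D).length + 4

open Node in
/-- Local pictures that may replace each other. The labels that occur once are the ends of the
picture, and those that occur twice are interior to it. -/
inductive Move : List Node → List Node → Prop
  /-- The same node, read from another arc. -/
  | turnX (a b c d : ℕ) : Move [X a b c d] [X c d a b]
  | turnV (a b c : ℕ) : Move [V a b c] [V b c a]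
  | turnP (a b : ℕ) : Move [P a b] [P b a]
  /-- Move I: a kink is removed. -/
  | I (a b x : ℕ) : Move [X x x a b] [P a b]
  | I' (a b x : ℕ) : Move [X a x x b] [P a b]
  /-- Move II: the strand from `c` to `d` is pulled off the strand from `a` to `b`
  below it. -/
  | II (a b c d x y : ℕ) : Move [X a c y x, X y d b x] [P a b, P c d]
  /-- Move III: a bottom strand from `b` to `b'`, a middle strand from `m` to `m'` and a top strand
  from `t` to `t'`; the two forms are mirror images. -/
  | III (b b' m m' t t' x y z u v w : ℕ) :
      Move [X b m x y, X x t b' z, X y z m' t'] [X b w u t', X u v b' m', X m t v w]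
  | III' (b b' m m' t t' x y z u v w : ℕ) :
      Move [X b y x m, X x z b' t, X y t' m' z] [X b t' u w, X u m' b' v, X m w v t]
  /-- Move IV: a strand from `s` to `s'` moves past a vertex, over it or behind it. -/
  | IVover (a b c s s' x y z w : ℕ) :
      Move [V x b c, X x s a s'] [V a y z, X y s' b w, X z w c s]
  | IVbehind (a b c s s' x y z w : ℕ) :
      Move [V x b c, X s a s' x] [V a y z, X s' b w y, X w c s z]
  /-- Move V: two edges switch places next to their vertex, in one of two ways. -/
  | V (a b c x y : ℕ) : Move [V a b c] [V a x y, X y x b c]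
  | V' (a b c x y : ℕ) : Move [V a b c] [V a x y, X x b c y]

/-- One change of the code of a diagram: reordering and relabelling, erasing a marked point
(which fuses the arcs `a` and `b`), or replacing one local picture by another. -/
inductive Step : Diagram → Diagram → Prop
  | reorder {D E : Diagram} : D.Perm E → Step D E
  | relabel (D : Diagram) (f : ℕ → ℕ) : Function.Injective f → Step D (D.map (Node.map f))
  | erase (D : Diagram) (a b : ℕ) : a ≠ b →
      Step (Node.P a b :: D) (D.map (Node.map fun l => if l = b then a else l))
  | move {L R : List Node} (D : Diagram) : Move L R → Step (L ++ D) (R ++ D)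

/-- Two diagrams are joined by a finite sequence of extended Reidemeister moves (in both
directions) through diagrams of θ-curves on the sphere. -/
def ReidemeisterEquiv : Diagram → Diagram → Prop :=
  Relation.EqvGen fun D E => IsThetaDiagram D ∧ IsThetaDiagram E ∧ Step D E

/-- The planar θ-curve: two vertices and three edges without crossings. -/
def trivialTheta : Diagram := [.V 1 2 3, .V 1 3 2]

/-- The crossing changes at the crossings whose numbers are in `S`. Nodes are numbered from one. -/
def changeCrossings (S : List ℕ) (D : Diagram) : Diagram :=
  D.mapIdx fun i v => if i + 1 ∈ S then v.change else v

/-- Reads a code: four labels for each crossing, then three labels for each of two vertices. -/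
def ofCode : List ℕ → Diagram
  | [a, b, c, d, e, f] => [.V a b c, .V d e f]
  | a :: b :: c :: d :: l => .X a b c d :: ofCode l
  | _ => []

/-- An entry of the table: a θ-curve up to mirror image. A pair in `codes` is the code of a
diagram with a list of sets of crossings, each given by the decimal digits of a number
(`135` is the set of the first, the third and the fifth crossing). -/
structure ThetaEntry where
  /-- The number of crossings of the diagrams. -/
  crossings : ℕ
  /-- The number of crossings that are changed. -/
  changes : ℕ
  codes : List (List ℕ × List ℕ)

/- The Litherland-Moriuchi table of the prime θ-curves with up to seven crossings, up to mirror
image. For each θ-curve all its diagrams with the least number of crossings are listed (up to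
isotopy of the sphere and mirror images), and for each diagram all sets of `changes` crossings
that unknot it. The comments give the usual names; curves with the same constituent knots follow
each other. -/

def table3 : List ThetaEntry := [
  -- 3_1: constituent knots 0_1, 0_1, 3_1
  ⟨3, 1, [
  ([1,2,3,4, 4,5,6,7, 8,6,5,3, 9,1,7, 9,8,2], [1,2,3]),
  ([1,2,3,4, 5,6,7,8, 6,5,4,3, 9,1,8, 9,7,2], [1,2,3])]⟩]

def table4 : List ThetaEntry := [
  -- 4_1: constituent knots 0_1, 0_1, 4_1
  ⟨4, 1, [
  ([1,2,3,4, 4,5,6,7, 8,6,9,10, 10,9,5,3, 11,1,7, 11,8,2], [1,2,3,4]),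
  ([1,2,3,4, 5,6,7,8, 6,9,10,3, 4,10,9,5, 11,1,8, 11,7,2], [1,2,3,4]),
  ([1,2,3,4, 5,6,7,8, 9,7,6,10, 10,5,4,3, 11,1,8, 11,9,2], [1,2,3,4])]⟩]

def table5 : List ThetaEntry := [
  -- 5_1: constituent knots 0_1, 0_1, 0_1
  ⟨5, 1, [
  ([1,2,3,4, 4,5,6,7, 8,9,10,11, 2,10,9,12, 12,13,5,3, 1,7,11, 6,13,8], [1,3,4,5])]⟩,
  -- 5_2: constituent knots 0_1, 0_1, 3_1
  ⟨5, 1, [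
  ([1,2,3,4, 4,5,6,7, 8,6,9,10, 11,12,5,3, 12,13,10,9, 1,7,8, 2,13,11], [2,4]),
  ([1,2,3,4, 4,5,6,7, 8,9,10,11, 2,10,9,12, 5,13,8,6, 1,7,11, 3,12,13], [2,3,4,5]),
  ([1,2,3,4, 4,5,6,7, 8,9,10,11, 11,10,12,2, 12,13,5,3, 1,7,8, 6,13,9], [2,3,4])]⟩,
  -- 5_3: constituent knots 0_1, 0_1, 5_1
  ⟨5, 2, [
  ([1,2,3,4, 4,5,6,7, 8,9,10,3, 5,11,12,6, 9,12,11,10, 13,1,7, 13,8,2], [12,13,14,15,23,24,25,34,35,45]),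
  ([1,2,3,4, 5,6,7,8, 9,10,4,3, 11,12,6,5, 12,11,10,9, 13,1,8, 13,7,2], [12,13,14,15,23,24,25,34,35,45])]⟩,
  -- 5_4: constituent knots 0_1, 3_1, 5_1
  ⟨5, 2, [
  ([1,2,3,4, 4,5,6,7, 8,6,5,9, 9,10,11,12, 2,11,10,3, 13,1,7, 13,8,12], [12,13,14,15,24,25,34,35,45])]⟩,
  -- 5_5, 5_6: constituent knots 0_1, 0_1, 5_2
  ⟨5, 1, [
  ([1,2,3,4, 4,5,6,7, 8,6,9,10, 11,12,5,3, 12,11,10,9, 13,1,7, 13,8,2], [1,2]),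
  ([1,2,3,4, 5,6,7,8, 6,9,10,3, 4,11,12,5, 9,12,11,10, 13,1,8, 13,7,2], [1,2]),
  ([1,2,3,4, 5,6,7,8, 9,10,11,12, 12,5,4,3, 6,11,10,7, 13,1,8, 13,9,2], [1,4])]⟩,
  ⟨5, 1, [
  ([1,2,3,4, 4,5,6,7, 8,9,10,3, 5,10,11,12, 12,11,9,6, 13,1,7, 13,8,2], [4,5]),
  ([1,2,3,4, 4,5,6,7, 8,9,10,11, 11,10,12,3, 5,12,9,6, 13,1,7, 13,8,2], [3,4]),
  ([1,2,3,4, 5,6,7,8, 9,10,4,3, 10,11,12,5, 6,12,11,9, 13,1,8, 13,7,2], [4,5]),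
  ([1,2,3,4, 5,6,7,8, 9,7,6,10, 11,12,4,3, 12,11,10,5, 13,1,8, 13,9,2], [2,3])]⟩,
  -- 5_7: constituent knots 0_1, 3_1, 5_2
  ⟨5, 1, [
  ([1,2,3,4, 4,5,6,7, 8,6,5,9, 10,11,2,12, 11,10,9,3, 13,1,7, 13,8,12], [4,5])]⟩]

def table6 : List ThetaEntry := [
  -- 6_1: constituent knots 0_1, 0_1, 0_1
  ⟨6, 1, [
  ([1,2,3,4, 4,5,6,7, 8,6,9,10, 11,12,5,3, 12,13,14,9, 10,14,13,15, 1,7,8, 2,15,11], [2,4,5,6]),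
  ([1,2,3,4, 4,5,6,7, 8,6,9,10, 11,12,13,3, 5,13,14,9, 10,14,12,15, 1,7,8, 2,15,11], [2,4,5]),
  ([1,2,3,4, 4,5,6,7, 8,9,10,11, 11,10,12,2, 13,14,5,3, 14,15,9,6, 1,7,8, 12,15,13], [2,3,4,5]),
  ([1,2,3,4, 4,5,6,7, 8,9,10,11, 11,10,12,2, 13,14,5,3, 12,15,14,13, 1,7,8, 6,15,9], [2,3,4,5,6]),
  ([1,2,3,4, 5,6,7,8, 9,10,11,12, 2,11,10,13, 14,6,4,3, 15,9,8,7, 1,5,12, 13,15,14], [1,2,3,4,5,6])]⟩,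
  -- 6_2: constituent knots 0_1, 0_1, 3_1
  ⟨6, 1, [
  ([1,2,3,4, 4,5,6,7, 8,9,10,11, 2,10,9,12, 13,14,5,3, 12,15,14,13, 1,7,11, 6,15,8], [1,3,4]),
  ([1,2,3,4, 4,5,6,7, 8,9,10,11, 12,13,5,3, 14,15,9,6, 15,14,13,10, 1,7,8, 2,11,12], [2,4]),
  ([1,2,3,4, 4,5,6,7, 8,9,10,11, 2,10,12,13, 13,14,5,3, 15,12,9,8, 1,7,11, 6,14,15], [1,5])]⟩,
  -- 6_3, 6_4: constituent knots 0_1, 3_1, 4_1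
  ⟨6, 1, [
  ([1,2,3,4, 4,5,6,7, 8,6,9,10, 11,12,5,3, 13,14,10,9, 15,13,12,11, 1,7,8, 2,14,15], [2]),
  ([1,2,3,4, 4,5,6,7, 8,9,10,11, 2,10,9,12, 5,13,14,6, 8,14,13,15, 1,7,11, 3,12,15], [3,4]),
  ([1,2,3,4, 4,5,6,7, 8,9,10,11, 11,10,12,2, 12,13,14,3, 5,14,15,6, 1,7,8, 9,15,13], [3,4]),
  ([1,2,3,4, 4,5,6,7, 8,9,10,11, 12,13,5,3, 6,14,15,8, 9,15,14,13, 1,7,11, 2,10,12], [1]),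
  ([1,2,3,4, 4,5,6,7, 8,9,10,11, 11,12,13,2, 13,14,5,3, 9,15,12,10, 1,7,8, 6,14,15], [2])]⟩,
  ⟨6, 1, [
  ([1,2,3,4, 4,5,6,7, 8,9,10,11, 2,10,9,12, 12,13,14,3, 5,14,15,6, 1,7,11, 8,15,13], [3,4])]⟩,
  -- 6_5, 6_6, 6_7: constituent knots 0_1, 0_1, 6_1
  ⟨6, 1, [
  ([1,2,3,4, 4,5,6,7, 8,6,9,10, 11,12,5,3, 13,14,10,9, 14,13,12,11, 15,1,7, 15,8,2], [1,2]),
  ([1,2,3,4, 5,6,7,8, 6,9,10,3, 4,11,12,5, 9,13,14,10, 11,14,13,12, 15,1,8, 15,7,2], [1,2]),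
  ([1,2,3,4, 5,6,7,8, 9,10,11,12, 12,5,4,3, 6,13,14,7, 10,14,13,11, 15,1,8, 15,9,2], [1,4])]⟩,
  ⟨6, 1, [
  ([1,2,3,4, 4,5,6,7, 8,9,10,3, 5,11,12,6, 9,12,13,14, 14,13,11,10, 15,1,7, 15,8,2], [5,6]),
  ([1,2,3,4, 4,5,6,7, 8,9,10,11, 11,10,12,3, 5,13,14,6, 9,14,13,12, 15,1,7, 15,8,2], [3,4]),
  ([1,2,3,4, 5,6,7,8, 9,10,4,3, 11,12,6,5, 12,13,14,9, 10,14,13,11, 15,1,8, 15,7,2], [5,6]),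
  ([1,2,3,4, 5,6,7,8, 9,10,4,3, 11,12,13,5, 6,13,12,14, 14,11,10,9, 15,1,8, 15,7,2], [4,5]),
  ([1,2,3,4, 5,6,7,8, 9,7,6,10, 11,12,4,3, 13,14,10,5, 14,13,12,11, 15,1,8, 15,9,2], [2,3])]⟩,
  ⟨6, 1, [
  ([1,2,3,4, 4,5,6,7, 8,6,9,10, 11,12,13,14, 2,13,12,3, 5,11,10,9, 15,1,7, 15,8,14], [3,6])]⟩,
  -- 6_8: constituent knots 0_1, 4_1, 6_1
  ⟨6, 1, [
  ([1,2,3,4, 4,5,6,7, 8,6,5,9, 9,10,11,12, 2,11,13,14, 14,13,10,3, 15,1,7, 15,8,12], [5,6]),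
  ([1,2,3,4, 4,5,6,7, 8,6,5,9, 10,11,12,13, 2,12,14,3, 9,14,11,10, 15,1,7, 15,8,13], [4,6])]⟩,
  -- 6_9, 6_10, 6_11: constituent knots 0_1, 0_1, 6_2
  ⟨6, 1, [
  ([1,2,3,4, 4,5,6,7, 8,6,9,10, 10,11,12,3, 5,13,14,9, 11,14,13,12, 15,1,7, 15,8,2], [3]),
  ([1,2,3,4, 4,5,6,7, 8,9,10,11, 11,12,5,3, 12,13,14,6, 9,14,13,10, 15,1,7, 15,8,2], [4]),
  ([1,2,3,4, 5,6,7,8, 6,9,10,3, 4,10,11,12, 13,14,9,5, 14,13,12,11, 15,1,8, 15,7,2], [3]),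
  ([1,2,3,4, 5,6,7,8, 9,7,10,11, 11,12,4,3, 13,14,6,5, 14,13,12,10, 15,1,8, 15,9,2], [3])]⟩,
  ⟨6, 1, [
  ([1,2,3,4, 4,5,6,7, 8,9,10,3, 5,10,11,12, 12,13,14,6, 9,14,13,11, 15,1,7, 15,8,2], [4]),
  ([1,2,3,4, 4,5,6,7, 8,9,10,3, 5,11,12,13, 13,14,9,6, 14,12,11,10, 15,1,7, 15,8,2], [5]),
  ([1,2,3,4, 4,5,6,7, 8,9,10,11, 11,12,13,3, 5,13,14,6, 9,14,12,10, 15,1,7, 15,8,2], [4]),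
  ([1,2,3,4, 4,5,6,7, 8,9,10,11, 11,12,13,3, 5,14,9,6, 14,13,12,10, 15,1,7, 15,8,2], [3]),
  ([1,2,3,4, 5,6,7,8, 9,10,4,3, 10,11,12,5, 6,12,13,14, 14,13,11,9, 15,1,8, 15,7,2], [4]),
  ([1,2,3,4, 5,6,7,8, 9,7,10,11, 12,13,4,3, 13,12,14,5, 6,14,11,10, 15,1,8, 15,9,2], [2])]⟩,
  ⟨6, 1, [
  ([1,2,3,4, 4,5,6,7, 8,6,9,10, 10,11,12,13, 2,12,11,14, 14,9,5,3, 15,1,7, 15,8,13], [6])]⟩,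
  -- 6_12: constituent knots 0_1, 3_1, 6_2
  ⟨6, 2, [
  ([1,2,3,4, 5,6,7,8, 9,7,6,10, 10,11,12,3, 4,13,14,5, 11,14,13,12, 15,1,8, 15,9,2], [14,15,16,24,25,26,34,35,36,45,46,56]),
  ([1,2,3,4, 5,6,7,8, 9,7,10,11, 11,10,12,3, 4,12,13,14, 14,13,6,5, 15,1,8, 15,9,2], [12,15,16,23,24,25,26,35,36,45,46,56]),
  ([1,2,3,4, 5,6,7,8, 9,10,11,12, 12,13,14,3, 4,14,13,5, 6,11,10,7, 15,1,8, 15,9,2], [12,13,16,23,24,25,26,34,35,36,46,56]),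
  ([1,2,3,4, 5,6,7,8, 9,7,6,10, 11,12,13,14, 2,13,12,3, 4,11,10,5, 15,1,8, 15,9,14], [12,13,14,15,16,24,25,34,35,45,46,56])]⟩,
  -- 6_13: constituent knots 0_1, 4_1, 6_2
  ⟨6, 1, [
  ([1,2,3,4, 4,5,6,7, 8,6,5,9, 10,11,2,12, 11,13,14,3, 9,14,13,10, 15,1,7, 15,8,12], [4]),
  ([1,2,3,4, 4,5,6,7, 8,6,5,9, 10,11,12,13, 2,12,11,14, 14,10,9,3, 15,1,7, 15,8,13], [6])]⟩,
  -- 6_14, 6_15: constituent knots 0_1, 0_1, 6_3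
  ⟨6, 1, [
  ([1,2,3,4, 4,5,6,7, 8,6,9,10, 10,11,12,3, 5,12,13,14, 14,13,11,9, 15,1,7, 15,8,2], [3,4]),
  ([1,2,3,4, 4,5,6,7, 8,6,9,10, 11,12,13,3, 5,13,14,9, 10,14,12,11, 15,1,7, 15,8,2], [3,5]),
  ([1,2,3,4, 4,5,6,7, 8,9,10,11, 11,12,5,3, 13,14,9,6, 14,13,12,10, 15,1,7, 15,8,2], [3,4]),
  ([1,2,3,4, 4,5,6,7, 8,9,10,11, 12,13,5,3, 13,14,9,6, 14,12,11,10, 15,1,7, 15,8,2], [4,5]),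
  ([1,2,3,4, 5,6,7,8, 6,9,10,3, 4,10,11,12, 12,13,14,5, 9,14,13,11, 15,1,8, 15,7,2], [3,4]),
  ([1,2,3,4, 5,6,7,8, 9,7,10,11, 11,12,4,3, 12,13,14,5, 6,14,13,10, 15,1,8, 15,9,2], [2,3]),
  ([1,2,3,4, 5,6,7,8, 9,10,11,12, 12,13,4,3, 13,11,14,5, 6,14,10,7, 15,1,8, 15,9,2], [3,5])]⟩,
  ⟨6, 1, [
  ([1,2,3,4, 4,5,6,7, 8,6,9,10, 11,12,2,13, 12,14,5,3, 14,11,10,9, 15,1,7, 15,8,13], [4,5])]⟩,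
  -- 6_16: constituent knots 0_1, 3_1, 6_3
  ⟨6, 1, [
  ([1,2,3,4, 5,6,7,8, 9,7,6,10, 10,11,12,3, 4,12,13,14, 14,13,11,5, 15,1,8, 15,9,2], [4]),
  ([1,2,3,4, 5,6,7,8, 9,7,10,11, 11,10,12,3, 4,13,14,5, 6,14,13,12, 15,1,8, 15,9,2], [2]),
  ([1,2,3,4, 5,6,7,8, 9,7,10,11, 11,12,13,3, 4,13,12,14, 14,10,6,5, 15,1,8, 15,9,2], [3]),
  ([1,2,3,4, 5,6,7,8, 9,10,11,12, 12,11,13,3, 4,13,14,5, 6,14,10,7, 15,1,8, 15,9,2], [5]),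
  ([1,2,3,4, 5,6,7,8, 9,7,6,10, 11,12,2,13, 12,11,14,3, 4,14,10,5, 15,1,8, 15,9,13], [1])]⟩]

def table7a : List ThetaEntry := [
  -- 7_1, ..., 7_4: constituent knots 0_1, 0_1, 0_1
  ⟨7, 1, [
  ([1,2,3,4, 4,5,6,7, 8,6,9,10, 11,12,5,3, 12,13,14,9, 10,14,15,16, 17,15,13,11, 1,7,8, 2,16,17], [2,5]),
  ([1,2,3,4, 4,5,6,7, 8,9,10,11, 2,10,9,12, 13,14,5,3, 14,15,16,6, 8,16,15,17, 1,7,11, 12,17,13], [3,4,5]),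
  ([1,2,3,4, 4,5,6,7, 8,9,10,11, 11,10,12,2, 13,14,5,3, 14,15,16,6, 12,17,15,13, 1,7,8, 9,16,17], [3,4,5])]⟩,
  ⟨7, 1, [
  ([1,2,3,4, 4,5,6,7, 8,9,10,11, 2,10,9,12, 13,14,5,3, 14,15,16,6, 12,17,15,13, 1,7,11, 8,16,17], [3,4,5])]⟩,
  ⟨7, 1, [
  ([1,2,3,4, 4,5,6,7, 8,9,10,11, 2,10,9,12, 13,14,5,3, 12,15,16,17, 17,16,14,13, 1,7,11, 6,15,8], [1,3,4]),
  ([1,2,3,4, 4,5,6,7, 8,9,10,11, 12,13,5,3, 14,15,9,6, 16,17,13,10, 17,16,15,14, 1,7,8, 2,11,12], [2,4]),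
  ([1,2,3,4, 4,5,6,7, 8,9,10,11, 2,10,12,13, 13,14,5,3, 15,16,9,8, 16,15,17,12, 1,7,11, 6,14,17], [1,5])]⟩,
  ⟨7, 1, [
  ([1,2,3,4, 4,5,6,7, 8,9,10,11, 12,13,5,3, 13,14,9,6, 15,16,17,10, 16,15,14,12, 1,7,8, 2,11,17], [4,5]),
  ([1,2,3,4, 5,6,7,8, 9,10,11,12, 2,11,10,13, 13,14,15,3, 4,15,16,17, 17,16,6,5, 1,8,12, 7,14,9], [1,5])]⟩,
  -- 7_5, 7_6, 7_7: constituent knots 0_1, 0_1, 3_1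
  ⟨7, 2, [
  ([1,2,3,4, 4,5,6,7, 8,9,10,11, 2,10,9,12, 12,13,14,3, 5,15,16,17, 13,16,15,14, 1,7,11, 6,17,8], [15,16,17,35,36,37,45,46,47,56,57,67]),
  ([1,2,3,4, 4,5,6,7, 8,9,10,11, 12,13,5,3, 13,14,15,6, 9,16,17,10, 14,17,16,15, 1,7,8, 2,11,12], [23,25,26,27,34,35,36,37,45,46,47,56,57,67])]⟩,
  ⟨7, 1, [
  ([1,2,3,4, 4,5,6,7, 8,6,9,10, 11,12,5,3, 12,13,14,9, 10,15,16,17, 13,16,15,14, 1,7,8, 2,17,11], [2,4]),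
  ([1,2,3,4, 4,5,6,7, 8,6,9,10, 11,12,13,3, 5,14,15,9, 10,16,12,17, 16,15,14,13, 1,7,8, 2,17,11], [2,4]),
  ([1,2,3,4, 4,5,6,7, 8,9,10,11, 11,10,12,2, 13,14,5,3, 12,15,16,17, 17,16,14,13, 1,7,8, 6,15,9], [2,3,4]),
  ([1,2,3,4, 4,5,6,7, 8,9,10,11, 2,10,9,12, 13,14,5,3, 15,16,8,6, 17,15,14,13, 1,7,11, 12,16,17], [2,3,4]),
  ([1,2,3,4, 5,6,7,8, 9,10,11,12, 12,11,13,2, 14,5,4,3, 6,15,16,7, 10,16,15,17, 1,8,9, 13,17,14], [1,3,4,5])]⟩,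
  ⟨7, 1, [
  ([1,2,3,4, 4,5,6,7, 8,6,9,10, 11,12,5,3, 13,14,10,9, 14,15,16,17, 12,16,15,13, 1,7,8, 2,17,11], [6,7]),
  ([1,2,3,4, 4,5,6,7, 8,6,9,10, 11,12,5,3, 13,14,15,9, 10,15,14,16, 16,13,12,17, 1,7,8, 2,17,11], [5,6]),
  ([1,2,3,4, 4,5,6,7, 8,9,10,11, 11,10,12,2, 12,13,14,3, 5,14,15,16, 13,17,16,15, 1,7,8, 6,17,9], [6,7]),
  ([1,2,3,4, 4,5,6,7, 8,9,10,11, 11,10,12,2, 13,14,15,3, 5,15,16,17, 12,16,14,13, 1,7,8, 6,17,9], [5,7]),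
  ([1,2,3,4, 4,5,6,7, 8,9,10,11, 12,13,5,3, 6,13,14,8, 9,14,15,16, 16,15,12,17, 1,7,11, 2,10,17], [6,7]),
  ([1,2,3,4, 4,5,6,7, 8,9,10,11, 2,11,12,3, 5,13,14,15, 15,14,16,6, 9,16,17,10, 1,7,8, 12,17,13], [5,6])]⟩,
  -- 7_8, 7_9, 7_10: constituent knots 0_1, 3_1, 3_1
  ⟨7, 2, [
  ([1,2,3,4, 4,5,6,7, 8,6,9,10, 11,12,5,3, 13,14,10,9, 15,16,12,17, 16,15,14,13, 1,7,8, 2,17,11], [23,25,26,27,34,45,46,47]),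
  ([1,2,3,4, 4,5,6,7, 8,9,10,11, 11,10,12,2, 12,13,14,3, 5,15,16,17, 13,16,15,14, 1,7,8, 6,17,9], [25,26,27,35,36,37,45,46,47]),
  ([1,2,3,4, 4,5,6,7, 8,9,10,11, 12,13,5,3, 6,13,14,8, 9,15,16,17, 12,16,15,14, 1,7,11, 2,10,17], [12,16,17,23,25,36,37,56,57]),
  ([1,2,3,4, 4,5,6,7, 8,9,10,11, 2,11,12,3, 5,13,14,6, 9,15,16,10, 13,17,15,14, 1,7,8, 12,16,17], [12,15,17,23,24,26,35,37,45,47,56,67])]⟩,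
  ⟨7, 1, [
  ([1,2,3,4, 4,5,6,7, 8,6,9,10, 11,12,13,3, 5,13,14,9, 10,15,16,17, 12,16,15,14, 1,7,8, 2,17,11], [2]),
  ([1,2,3,4, 4,5,6,7, 8,9,10,11, 11,10,12,2, 13,14,5,3, 14,15,16,6, 9,16,15,17, 1,7,8, 12,17,13], [3,4]),
  ([1,2,3,4, 5,6,7,8, 9,10,11,12, 2,11,10,13, 13,14,15,3, 6,16,9,7, 14,16,17,15, 1,8,12, 4,17,5], [2,6])]⟩,
  ⟨7, 2, [
  ([1,2,3,4, 4,5,6,7, 8,9,10,11, 2,10,9,12, 12,13,14,3, 5,14,15,16, 13,17,16,15, 1,7,11, 6,17,8], [15,16,17,35,36,37,45,46,47]),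
  ([1,2,3,4, 4,5,6,7, 8,9,10,11, 2,10,9,12, 13,14,15,3, 5,15,16,17, 12,16,14,13, 1,7,11, 6,17,8], [15,16,17,35,36,37,45,46,47]),
  ([1,2,3,4, 4,5,6,7, 8,9,10,11, 12,13,5,3, 13,14,15,6, 9,15,16,17, 17,16,14,10, 1,7,8, 2,11,12], [16,17,23,25,26,27,34,45,46,47]),
  ([1,2,3,4, 4,5,6,7, 8,9,10,11, 12,13,5,3, 14,15,16,6, 9,16,17,10, 13,17,15,14, 1,7,8, 2,11,12], [15,17,23,25,26,27,34,45,46,47]),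
  ([1,2,3,4, 4,5,6,7, 8,9,10,11, 12,13,5,3, 13,14,15,6, 9,15,14,16, 16,17,11,10, 1,7,8, 2,17,12], [13,17,23,25,26,27,34,45,46,47])]⟩,
  -- 7_11, 7_12, 7_13: constituent knots 0_1, 0_1, 4_1
  ⟨7, 1, [
  ([1,2,3,4, 4,5,6,7, 8,6,9,10, 11,12,5,3, 13,14,15,9, 10,15,14,16, 17,13,12,11, 1,7,8, 2,16,17], [2,5,6]),
  ([1,2,3,4, 4,5,6,7, 8,6,9,10, 11,12,13,3, 5,13,14,9, 10,14,15,16, 17,15,12,11, 1,7,8, 2,16,17], [2,5]),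
  ([1,2,3,4, 4,5,6,7, 8,9,10,11, 2,10,9,12, 13,14,5,3, 15,16,12,8, 16,17,14,13, 1,7,11, 6,17,15], [1,3,4]),
  ([1,2,3,4, 4,5,6,7, 8,9,10,11, 11,10,12,2, 13,14,5,3, 15,16,9,6, 17,15,14,13, 1,7,8, 12,16,17], [2,3,4]),
  ([1,2,3,4, 4,5,6,7, 8,9,10,11, 11,10,12,2, 13,14,15,3, 5,15,16,6, 12,17,14,13, 1,7,8, 9,16,17], [3,4,5,7]),
  ([1,2,3,4, 4,5,6,7, 8,9,10,11, 12,13,5,3, 6,14,15,8, 9,15,14,16, 17,16,13,12, 1,7,11, 2,10,17], [1,4,7]),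
  ([1,2,3,4, 4,5,6,7, 8,9,10,11, 2,11,12,13, 13,14,5,3, 15,16,17,6, 9,17,16,10, 1,7,8, 12,15,14], [1,5]),
  ([1,2,3,4, 4,5,6,7, 8,9,10,11, 11,12,13,2, 14,15,5,3, 9,16,12,10, 13,17,15,14, 1,7,8, 6,17,16], [2,5,7]),
  ([1,2,3,4, 5,6,7,8, 9,10,11,12, 2,11,10,13, 14,6,4,3, 15,16,8,7, 16,15,17,9, 1,5,12, 13,17,14], [1,3,4,5])]⟩,
  ⟨7, 1, [
  ([1,2,3,4, 4,5,6,7, 8,9,10,11, 2,10,9,12, 12,13,14,3, 5,15,16,6, 17,16,15,14, 1,7,11, 8,17,13], [3,4])]⟩,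
  ⟨7, 1, [
  ([1,2,3,4, 4,5,6,7, 8,9,10,11, 12,13,5,3, 13,14,9,6, 14,15,16,10, 17,16,15,12, 1,7,8, 2,11,17], [4,5]),
  ([1,2,3,4, 5,6,7,8, 9,10,11,12, 2,11,10,13, 13,14,15,3, 4,15,16,5, 6,16,17,7, 1,8,12, 9,17,14], [1,5]),
  ([1,2,3,4, 5,6,7,8, 9,10,11,12, 2,11,10,13, 13,14,15,3, 4,16,17,5, 6,17,16,15, 1,8,12, 7,14,9], [1,5])]⟩,
  -- 7_14: constituent knots 0_1, 4_1, 4_1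
  ⟨7, 1, [
  ([1,2,3,4, 4,5,6,7, 8,9,10,11, 12,13,5,3, 14,15,9,6, 15,14,16,10, 17,16,13,12, 1,7,8, 2,11,17], [2]),
  ([1,2,3,4, 4,5,6,7, 8,9,10,11, 2,10,12,13, 14,15,5,3, 16,12,9,8, 13,17,15,14, 1,7,11, 6,17,16], [1]),
  ([1,2,3,4, 5,6,7,8, 9,10,11,12, 2,11,10,13, 13,14,15,3, 16,9,8,7, 14,16,17,15, 1,5,12, 4,17,6], [2,6])]⟩,
  -- 7_15, 7_16, 7_17: constituent knots 0_1, 0_1, 5_1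
  ⟨7, 2, [
  ([1,2,3,4, 4,5,6,7, 8,6,9,10, 11,12,13,14, 14,13,15,2, 15,16,5,3, 16,12,10,9, 17,1,7, 17,8,11], [12,13,14,15,17,23,24,25,27,36,67]),
  ([1,2,3,4, 5,6,7,8, 8,9,10,11, 12,13,2,14, 13,15,16,3, 16,7,6,4, 9,15,12,10, 17,1,5, 17,11,14], [13,15,17,23,24,25,27,35,36,45,46,56,57,67]),
  ([1,2,3,4, 4,5,6,7, 8,6,9,10, 2,11,12,3, 5,12,13,14, 10,15,16,17, 17,16,13,11, 1,7,8, 9,14,15], [12,15,16,17,24,25,26,27,45,46,47]),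
  ([1,2,3,4, 4,5,6,7, 8,6,9,10, 2,11,12,3, 5,12,13,14, 15,16,10,9, 14,17,16,15, 1,7,8, 11,17,13], [23,25,26,27,35,56,57]),
  ([1,2,3,4, 4,5,6,7, 8,6,9,10, 2,11,12,3, 5,13,14,9, 14,15,16,10, 11,16,15,17, 1,7,8, 12,17,13], [12,16,17,24,26,27,46,47]),
  ([1,2,3,4, 4,5,6,7, 8,6,9,10, 2,11,12,13, 5,14,15,9, 15,16,11,10, 16,14,17,12, 1,7,8, 3,13,17], [23,24,26,27,34,36,45,47,57]),
  ([1,2,3,4, 4,5,6,7, 8,9,10,11, 11,10,12,2, 12,13,14,3, 6,15,16,9, 13,16,15,17, 1,7,8, 5,14,17], [15,16,17,35,36,37,45,46,47,56,57]),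
  ([1,2,3,4, 4,5,6,7, 8,9,10,11, 11,10,12,2, 13,14,15,5, 6,15,16,9, 12,16,14,17, 1,7,8, 3,17,13], [25,27,35,36,37,45,46,47,57]),
  ([1,2,3,4, 4,5,6,7, 8,9,10,11, 2,10,9,12, 3,13,14,15, 16,17,8,6, 17,14,13,12, 1,7,11, 5,15,16], [15,17,35,36,37,45,46,47]),
  ([1,2,3,4, 4,5,6,7, 8,9,10,11, 2,11,12,3, 5,13,14,15, 9,16,17,10, 17,14,13,12, 1,7,8, 6,15,16], [12,15,17,24,25,27,45,47])]⟩,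
  ⟨7, 2, [
  ([1,2,3,4, 4,5,6,7, 8,6,9,10, 11,12,13,3, 5,14,15,16, 16,17,10,9, 12,15,14,13, 1,7,8, 2,17,11], [24,25,27,45,47,57]),
  ([1,2,3,4, 4,5,6,7, 8,9,10,11, 2,10,9,12, 5,13,14,15, 16,17,8,6, 17,16,15,14, 1,7,11, 3,12,13], [25,26,27,35,36,37,45,46,47,56,57,67]),
  ([1,2,3,4, 4,5,6,7, 8,9,10,11, 12,13,5,3, 6,13,14,15, 16,17,9,8, 17,16,15,14, 1,7,11, 2,10,12], [13,15,16,17,35,36,37,56,57,67]),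
  ([1,2,3,4, 4,5,6,7, 8,9,10,11, 2,11,12,3, 13,14,9,6, 15,16,17,10, 16,15,14,13, 1,7,8, 5,12,17], [15,16,17,35,36,37,45,46,47,56,57,67]),
  ([1,2,3,4, 5,6,7,8, 9,10,11,12, 12,11,13,2, 13,14,15,3, 4,15,16,17, 17,16,6,5, 1,8,9, 7,14,10], [23,24,26,27,36,37,46,47,67])]⟩,
  ⟨7, 2, [
  ([1,2,3,4, 4,5,6,7, 8,9,10,11, 2,10,12,3, 5,13,14,15, 16,17,9,8, 17,14,13,12, 1,7,11, 6,15,16], [12,15,17,24,25,27,45,47]),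
  ([1,2,3,4, 4,5,6,7, 8,9,10,11, 2,11,12,13, 13,12,14,3, 15,16,9,6, 16,15,17,10, 1,7,8, 5,14,17], [16,17,34,35,46,47,56,57]),
  ([1,2,3,4, 4,5,6,7, 8,9,10,11, 2,10,12,13, 5,14,15,16, 16,15,17,6, 17,12,9,8, 1,7,11, 3,13,14], [23,27,35,36,45,46,57,67]),
  ([1,2,3,4, 5,6,7,8, 9,10,11,12, 2,11,10,13, 13,14,15,3, 15,16,17,4, 6,17,16,7, 1,5,12, 8,14,9], [23,24,36,37,46,47]),
  ([1,2,3,4, 5,6,7,8, 9,10,11,12, 2,11,10,13, 4,14,15,5, 6,15,14,16, 7,17,13,9, 1,8,12, 3,17,16], [23,24,35,36,45,46,57,67])]⟩,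
  -- 7_18: constituent knots 0_1, 5_1, 5_2
  ⟨7, 2, [
  ([1,2,3,4, 5,6,7,8, 8,7,9,10, 11,12,2,13, 14,6,4,3, 9,14,15,16, 16,15,12,11, 17,1,5, 17,10,13], [14,16,17,45,56,57]),
  ([1,2,3,4, 5,6,7,8, 8,7,9,10, 11,12,2,13, 14,6,4,3, 9,15,16,11, 12,16,15,14, 17,1,5, 17,10,13], [14,16,17,26,27,36,37,45,56,57]),
  ([1,2,3,4, 5,6,7,8, 8,7,9,10, 11,12,13,14, 2,13,12,15, 16,6,4,3, 9,16,15,11, 17,1,5, 17,10,14], [14,15,17,24,25,34,35,46,56,67]),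
  ([1,2,3,4, 4,5,6,7, 8,6,9,10, 2,11,12,3, 5,12,13,14, 15,16,10,9, 17,15,14,13, 1,7,8, 11,16,17], [25,27,35,37,56,67]),
  ([1,2,3,4, 4,5,6,7, 8,6,9,10, 2,11,12,13, 5,14,15,9, 15,16,17,10, 11,17,16,12, 1,7,8, 3,13,14], [14,16,17,24,26,27]),
  ([1,2,3,4, 4,5,6,7, 8,6,9,10, 2,11,12,13, 5,14,15,9, 16,17,11,10, 17,16,15,12, 1,7,8, 3,13,14], [24,26,27,36,37,56,57]),
  ([1,2,3,4, 4,5,6,7, 8,6,9,10, 11,12,13,2, 13,14,5,3, 10,15,16,11, 12,16,15,17, 1,7,8, 9,14,17], [16,17,24,26,27,56,57]),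
  ([1,2,3,4, 4,5,6,7, 8,9,10,11, 11,10,12,2, 6,13,14,9, 12,14,15,16, 16,15,13,17, 1,7,8, 3,17,5], [26,27,35,36,37,45,46,47]),
  ([1,2,3,4, 4,5,6,7, 8,9,10,11, 2,10,9,12, 13,14,8,6, 14,15,16,12, 17,16,15,13, 1,7,11, 3,17,5], [16,17,35,36,37,45,46,47]),
  ([1,2,3,4, 4,5,6,7, 8,9,10,11, 11,10,12,2, 6,13,14,9, 12,15,16,17, 13,16,15,14, 1,7,8, 3,17,5], [15,16,17,35,36,37,45,46,47]),
  ([1,2,3,4, 4,5,6,7, 8,9,10,11, 2,10,9,12, 13,14,8,6, 15,16,17,12, 16,15,14,13, 1,7,11, 3,17,5], [25,26,27,35,36,37,45,46,47]),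
  ([1,2,3,4, 4,5,6,7, 8,9,10,11, 11,10,12,2, 6,13,14,15, 15,14,16,9, 12,16,13,17, 1,7,8, 3,17,5], [25,26,35,36,37,45,46,47]),
  ([1,2,3,4, 4,5,6,7, 8,9,10,11, 2,10,9,12, 13,14,15,6, 8,15,14,16, 16,13,17,12, 1,7,11, 3,17,5], [15,16,35,36,37,45,46,47]),
  ([1,2,3,4, 4,5,6,7, 8,9,10,11, 2,10,12,3, 5,12,13,14, 6,14,15,16, 16,15,17,8, 1,7,11, 9,17,13], [12,15,16,17,24,45,46,47]),
  ([1,2,3,4, 4,5,6,7, 8,9,10,11, 2,11,12,3, 13,14,15,6, 9,15,14,16, 16,17,12,10, 1,7,8, 5,17,13], [15,16,25,26,45,46])]⟩]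

def table7b : List ThetaEntry := [
  -- 7_19, 7_20, 7_21: constituent knots 0_1, 0_1, 5_2
  ⟨7, 1, [
  ([1,2,3,4, 4,5,6,7, 8,6,9,10, 11,12,5,3, 13,14,10,9, 15,13,16,17, 17,16,12,11, 1,7,8, 2,14,15], [2]),
  ([1,2,3,4, 4,5,6,7, 8,9,10,11, 2,10,9,12, 5,13,14,6, 8,15,16,17, 13,16,15,14, 1,7,11, 3,12,17], [3,4]),
  ([1,2,3,4, 4,5,6,7, 8,9,10,11, 11,10,12,2, 12,13,14,3, 5,15,16,6, 17,16,15,14, 1,7,8, 9,17,13], [3,4]),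
  ([1,2,3,4, 4,5,6,7, 8,9,10,11, 12,13,5,3, 6,14,15,8, 9,16,17,13, 14,17,16,15, 1,7,11, 2,10,12], [1]),
  ([1,2,3,4, 4,5,6,7, 8,9,10,11, 11,12,13,2, 13,14,5,3, 9,15,16,10, 12,16,15,17, 1,7,8, 6,14,17], [2])]⟩,
  ⟨7, 1, [
  ([1,2,3,4, 4,5,6,7, 8,6,9,10, 2,11,12,3, 5,12,13,14, 14,15,16,9, 10,16,15,17, 1,7,8, 11,17,13], [6,7]),
  ([1,2,3,4, 4,5,6,7, 8,9,10,11, 2,10,9,12, 12,13,14,3, 15,16,17,6, 8,17,16,13, 1,7,11, 5,14,15], [3,4]),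
  ([1,2,3,4, 4,5,6,7, 8,9,10,11, 2,10,9,12, 5,13,14,15, 15,16,8,6, 16,14,17,12, 1,7,11, 3,17,13], [5]),
  ([1,2,3,4, 4,5,6,7, 8,9,10,11, 2,10,9,12, 13,14,5,3, 6,14,15,16, 16,15,17,8, 1,7,11, 12,17,13], [3,4])]⟩,
  ⟨7, 1, [
  ([1,2,3,4, 4,5,6,7, 8,9,10,11, 2,10,9,12, 13,14,15,3, 5,15,16,6, 12,17,14,13, 1,7,11, 8,16,17], [3,4])]⟩,
  -- 7_22: constituent knots 0_1, 3_1, 5_2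
  ⟨7, 2, [
  ([1,2,3,4, 4,5,6,7, 8,6,9,10, 11,12,13,3, 5,13,14,15, 16,17,10,9, 12,16,15,14, 1,7,8, 2,17,11], [24,25,27,35,37,56,67]),
  ([1,2,3,4, 4,5,6,7, 8,6,9,10, 11,12,13,3, 5,13,14,15, 15,16,10,9, 17,14,12,11, 1,7,8, 2,16,17], [24,25,27,34,37,46,67]),
  ([1,2,3,4, 4,5,6,7, 8,9,10,11, 2,10,9,12, 5,13,14,15, 15,16,17,6, 8,17,16,14, 1,7,11, 3,12,13], [16,17,35,36,37,45,46,47]),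
  ([1,2,3,4, 4,5,6,7, 8,9,10,11, 2,10,9,12, 5,13,14,15, 15,16,8,6, 16,14,13,17, 1,7,11, 3,12,17], [15,17,35,36,37,45,46,47]),
  ([1,2,3,4, 4,5,6,7, 8,9,10,11, 12,13,5,3, 6,13,14,15, 15,16,17,8, 9,17,16,14, 1,7,11, 2,10,12], [13,15,16,17,26,27,46,47]),
  ([1,2,3,4, 4,5,6,7, 8,9,10,11, 12,13,5,3, 6,14,15,16, 16,17,9,8, 17,15,14,13, 1,7,11, 2,10,12], [13,15,16,17,25,27,45,47]),
  ([1,2,3,4, 4,5,6,7, 8,9,10,11, 2,11,12,3, 13,14,9,6, 14,15,16,10, 17,16,15,13, 1,7,8, 5,12,17], [15,16,17,26,27,45,46,47]),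
  ([1,2,3,4, 4,5,6,7, 8,9,10,11, 2,11,12,3, 13,14,15,6, 9,15,14,16, 16,13,17,10, 1,7,8, 5,12,17], [15,16,17,25,26,45,46,47]),
  ([1,2,3,4, 4,5,6,7, 8,9,10,11, 12,13,5,3, 6,13,14,15, 15,14,16,8, 9,16,17,10, 1,7,11, 2,17,12], [13,15,16,17,23,27,34,47]),
  ([1,2,3,4, 5,6,7,8, 9,10,11,12, 12,11,13,2, 13,14,15,3, 4,15,16,5, 6,16,17,7, 1,8,9, 10,17,14], [12,17,23,24,25,36,37,46,47,57]),
  ([1,2,3,4, 5,6,7,8, 9,10,11,12, 12,11,13,2, 13,14,15,3, 4,16,17,5, 6,17,16,15, 1,8,9, 7,14,10], [16,17,23,24,36,37,46,47,56,57])]⟩,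
  -- 7_23, 7_24: constituent knots 0_1, 4_1, 5_2
  ⟨7, 2, [
  ([1,2,3,4, 4,5,6,7, 8,9,10,11, 2,10,12,3, 5,12,13,14, 15,16,9,8, 16,17,14,13, 1,7,11, 6,17,15], [12,15,17,24,35,37,45,47,56,67]),
  ([1,2,3,4, 4,5,6,7, 8,9,10,11, 2,11,12,13, 13,12,14,3, 15,16,17,6, 9,17,16,10, 1,7,8, 5,14,15], [23,26,27,34,35,46,47,56,57]),
  ([1,2,3,4, 4,5,6,7, 8,9,10,11, 2,10,12,13, 5,14,15,6, 8,15,14,16, 9,17,13,12, 1,7,11, 3,17,16], [12,15,16,24,27,45,46,57,67]),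
  ([1,2,3,4, 4,5,6,7, 8,9,10,11, 2,12,13,3, 5,13,14,15, 6,15,16,17, 17,16,9,8, 1,7,11, 10,14,12], [12,13,15,16,17,24,34,45,46,47]),
  ([1,2,3,4, 5,6,7,8, 9,10,11,12, 2,11,10,13, 13,14,15,3, 15,16,6,4, 16,17,8,7, 1,5,12, 9,17,14], [12,17,23,24,25,36,37,46,47,57]),
  ([1,2,3,4, 5,6,7,8, 9,10,11,12, 2,11,10,13, 13,14,15,3, 16,17,6,4, 17,16,15,7, 1,5,12, 8,14,9], [16,17,23,24,36,37,46,47,56,57])]⟩,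
  ⟨7, 2, [
  ([1,2,3,4, 4,5,6,7, 8,9,10,11, 2,12,13,3, 5,13,14,15, 15,16,17,6, 9,17,16,10, 1,7,8, 11,14,12], [12,15,23,24,26,27,35,45,56,57])]⟩,
  -- 7_25: constituent knots 0_1, 0_1, 7_1
  ⟨7, 3, [
  ([1,2,3,4, 4,5,6,7, 8,9,10,3, 5,11,12,6, 9,13,14,10, 11,15,16,12, 13,16,15,14, 17,1,7, 17,8,2], [123,124,125,126,127,134,135,136,137,145,146,147,156,157,167,234,235,236,237,245,246,247,256,257,267,345,346,347,356,357,367,456,457,467,567]),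
  ([1,2,3,4, 5,6,7,8, 9,10,4,3, 11,12,6,5, 13,14,10,9, 15,16,12,11, 16,15,14,13, 17,1,8, 17,7,2], [123,124,125,126,127,134,135,136,137,145,146,147,156,157,167,234,235,236,237,245,246,247,256,257,267,345,346,347,356,357,367,456,457,467,567])]⟩,
  -- 7_26: constituent knots 0_1, 3_1, 7_1
  ⟨7, 3, [
  ([1,2,3,4, 4,5,6,7, 8,9,10,11, 11,12,13,14, 2,13,12,3, 5,15,16,6, 9,16,15,10, 17,1,7, 17,8,14], [123,124,125,126,127,134,135,136,137,146,147,156,157,167,234,235,245,246,247,256,257,345,346,347,356,357,456,457,467,567])]⟩,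
  -- 7_27: constituent knots 0_1, 5_1, 7_1
  ⟨7, 3, [
  ([1,2,3,4, 4,5,6,7, 8,6,5,9, 9,10,11,12, 2,13,14,3, 10,15,16,11, 13,16,15,14, 17,1,7, 17,8,12], [124,125,126,127,134,135,136,137,145,146,147,156,157,167,245,246,247,256,257,267,345,346,347,356,357,367,456,457,467,567])]⟩,
  -- 7_28, 7_29, 7_30: constituent knots 0_1, 0_1, 7_2
  ⟨7, 1, [
  ([1,2,3,4, 4,5,6,7, 8,6,9,10, 11,12,5,3, 13,14,10,9, 15,16,12,11, 16,15,14,13, 17,1,7, 17,8,2], [1,2]),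
  ([1,2,3,4, 5,6,7,8, 6,9,10,3, 4,11,12,5, 9,13,14,10, 11,15,16,12, 13,16,15,14, 17,1,8, 17,7,2], [1,2]),
  ([1,2,3,4, 5,6,7,8, 9,10,11,12, 12,5,4,3, 6,13,14,7, 10,15,16,11, 13,16,15,14, 17,1,8, 17,9,2], [1,4])]⟩,
  ⟨7, 1, [
  ([1,2,3,4, 4,5,6,7, 8,9,10,3, 5,11,12,6, 9,13,14,10, 11,14,15,16, 16,15,13,12, 17,1,7, 17,8,2], [6,7]),
  ([1,2,3,4, 4,5,6,7, 8,9,10,3, 5,11,12,6, 9,13,14,15, 15,14,16,10, 11,16,13,12, 17,1,7, 17,8,2], [5,6]),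
  ([1,2,3,4, 4,5,6,7, 8,9,10,11, 11,10,12,3, 5,13,14,6, 9,15,16,12, 13,16,15,14, 17,1,7, 17,8,2], [3,4]),
  ([1,2,3,4, 5,6,7,8, 9,10,4,3, 11,12,6,5, 13,14,10,9, 14,15,16,11, 12,16,15,13, 17,1,8, 17,7,2], [6,7]),
  ([1,2,3,4, 5,6,7,8, 9,10,4,3, 11,12,13,5, 6,13,12,14, 15,16,10,9, 16,15,14,11, 17,1,8, 17,7,2], [4,5]),
  ([1,2,3,4, 5,6,7,8, 9,7,6,10, 11,12,4,3, 13,14,10,5, 15,16,12,11, 16,15,14,13, 17,1,8, 17,9,2], [2,3])]⟩,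
  ⟨7, 1, [
  ([1,2,3,4, 4,5,6,7, 8,9,10,11, 11,12,13,14, 2,13,12,3, 5,10,15,16, 16,15,9,6, 17,1,7, 17,8,14], [6,7]),
  ([1,2,3,4, 4,5,6,7, 8,9,10,11, 12,13,14,15, 2,14,13,3, 5,16,9,6, 16,12,11,10, 17,1,7, 17,8,15], [3,7])]⟩,
  -- 7_31: constituent knots 0_1, 3_1, 7_2
  ⟨7, 1, [
  ([1,2,3,4, 4,5,6,7, 8,6,9,10, 11,12,13,14, 2,15,16,3, 5,11,10,9, 12,16,15,13, 17,1,7, 17,8,14], [3,6])]⟩,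
  -- 7_32: constituent knots 0_1, 5_2, 7_2
  ⟨7, 1, [
  ([1,2,3,4, 4,5,6,7, 8,6,5,9, 9,10,11,12, 2,13,14,3, 10,14,15,16, 16,15,13,11, 17,1,7, 17,8,12], [6,7]),
  ([1,2,3,4, 4,5,6,7, 8,6,5,9, 10,11,12,13, 2,14,15,3, 9,16,11,10, 16,15,14,12, 17,1,7, 17,8,13], [4,6])]⟩,
  -- 7_33, 7_34: constituent knots 0_1, 0_1, 7_3
  ⟨7, 2, [
  ([1,2,3,4, 4,5,6,7, 8,9,10,3, 5,10,11,12, 13,14,9,6, 15,16,12,11, 16,15,14,13, 17,1,7, 17,8,2], [45,46,47,56,57,67]),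
  ([1,2,3,4, 4,5,6,7, 8,9,10,11, 12,13,14,3, 5,14,9,6, 15,16,11,10, 16,15,13,12, 17,1,7, 17,8,2], [34,36,37,46,47,67]),
  ([1,2,3,4, 5,6,7,8, 9,10,4,3, 10,11,12,5, 6,13,14,9, 11,15,16,12, 13,16,15,14, 17,1,8, 17,7,2], [45,46,47,56,57,67]),
  ([1,2,3,4, 5,6,7,8, 9,10,11,12, 13,14,4,3, 14,13,12,5, 6,15,16,7, 10,16,15,11, 17,1,8, 17,9,2], [23,26,27,36,37,67])]⟩,
  ⟨7, 2, [
  ([1,2,3,4, 4,5,6,7, 8,9,10,3, 5,11,12,6, 9,12,13,14, 15,16,11,10, 16,15,14,13, 17,1,7, 17,8,2], [12,13,14,23,24,34]),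
  ([1,2,3,4, 4,5,6,7, 8,9,10,11, 12,13,14,3, 5,15,16,6, 9,16,15,14, 13,12,11,10, 17,1,7, 17,8,2], [12,15,16,25,26,56]),
  ([1,2,3,4, 5,6,7,8, 9,10,4,3, 11,12,6,5, 12,13,14,9, 10,15,16,11, 13,16,15,14, 17,1,8, 17,7,2], [12,13,14,23,24,34]),
  ([1,2,3,4, 5,6,7,8, 9,10,4,3, 11,12,13,5, 6,14,15,16, 16,11,10,9, 12,15,14,13, 17,1,8, 17,7,2], [12,13,16,23,26,36]),
  ([1,2,3,4, 5,6,7,8, 9,10,11,12, 13,14,4,3, 15,16,12,5, 6,11,10,7, 16,15,14,13, 17,1,8, 17,9,2], [14,15,17,45,47,57])]⟩,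
  -- 7_35: constituent knots 0_1, 3_1, 7_3
  ⟨7, 2, [
  ([1,2,3,4, 4,5,6,7, 8,6,9,10, 11,12,13,14, 2,13,12,3, 5,11,15,16, 16,15,10,9, 17,1,7, 17,8,14], [12,14,15,24,25,45])]⟩,
  -- 7_36: constituent knots 0_1, 5_1, 7_3
  ⟨7, 2, [
  ([1,2,3,4, 4,5,6,7, 8,6,5,9, 10,11,2,12, 13,14,9,3, 15,16,11,10, 16,15,14,13, 17,1,7, 17,8,12], [45,46,47,56,57,67])]⟩,
  -- 7_37: constituent knots 0_1, 5_2, 7_3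
  ⟨7, 2, [
  ([1,2,3,4, 4,5,6,7, 8,6,5,9, 9,10,11,12, 2,11,13,14, 15,16,10,3, 16,15,14,13, 17,1,7, 17,8,12], [12,13,24,34]),
  ([1,2,3,4, 4,5,6,7, 8,6,5,9, 10,11,12,13, 2,12,14,3, 9,14,15,16, 16,15,11,10, 17,1,7, 17,8,13], [12,13,25,35])]⟩]

def table7c : List ThetaEntry := [
  -- 7_38, 7_39: constituent knots 0_1, 0_1, 7_4
  ⟨7, 2, [
  ([1,2,3,4, 4,5,6,7, 8,9,10,3, 5,10,11,12, 12,13,14,6, 9,15,16,11, 13,16,15,14, 17,1,7, 17,8,2], [12,13,14,23,24,34,45,46,47,56,57,67]),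
  ([1,2,3,4, 4,5,6,7, 8,9,10,3, 5,11,12,13, 13,14,9,6, 14,15,16,10, 11,16,15,12, 17,1,7, 17,8,2], [12,13,15,23,25,35,45,46,47,56,57,67]),
  ([1,2,3,4, 4,5,6,7, 8,9,10,11, 11,12,13,3, 5,13,14,6, 9,15,16,10, 12,16,15,14, 17,1,7, 17,8,2], [12,14,15,24,25,34,36,37,45,46,47,67]),
  ([1,2,3,4, 4,5,6,7, 8,9,10,11, 11,12,13,3, 5,14,9,6, 14,15,16,10, 12,16,15,13, 17,1,7, 17,8,2], [12,13,15,23,25,34,35,36,37,46,47,67]),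
  ([1,2,3,4, 5,6,7,8, 9,10,4,3, 10,11,12,5, 6,12,13,14, 15,16,11,9, 16,15,14,13, 17,1,8, 17,7,2], [12,13,14,23,24,34,45,46,47,56,57,67]),
  ([1,2,3,4, 5,6,7,8, 9,7,10,11, 12,13,4,3, 13,12,14,5, 6,14,15,16, 16,15,11,10, 17,1,8, 17,9,2], [12,14,15,23,24,25,26,27,36,37,45,67])]⟩,
  ⟨7, 2, [
  ([1,2,3,4, 5,6,7,8, 9,7,10,11, 12,13,14,3, 4,14,15,16, 16,15,6,5, 13,12,11,10, 17,1,8, 17,9,2], [12,13,14,15,16,17,25,26,34,37,47,56]),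
  ([1,2,3,4, 5,6,7,8, 9,10,11,12, 12,13,14,3, 4,15,16,5, 6,11,10,7, 13,16,15,14, 17,1,8, 17,9,2], [12,13,14,15,16,17,23,26,36,45,47,57]),
  ([1,2,3,4, 5,6,7,8, 9,10,11,12, 13,14,15,16, 2,15,14,3, 4,13,12,5, 6,11,10,7, 17,1,8, 17,9,16], [14,15,16,23,26,27,36,37,45,46,56,67])]⟩,
  -- 7_40, 7_41: constituent knots 0_1, 3_1, 7_4
  ⟨7, 2, [
  ([1,2,3,4, 4,5,6,7, 8,6,9,10, 10,11,12,13, 2,14,15,3, 5,15,16,9, 11,16,14,12, 17,1,7, 17,8,13], [12,16,25,26,34,36,37,46,56,67])]⟩,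
  ⟨7, 2, [
  ([1,2,3,4, 4,5,6,7, 8,9,10,11, 11,12,13,14, 2,13,12,15, 15,10,16,3, 5,16,9,6, 17,1,7, 17,8,14], [12,17,26,34,35,46,56,67])]⟩,
  -- 7_42: constituent knots 0_1, 5_2, 7_4
  ⟨7, 2, [
  ([1,2,3,4, 4,5,6,7, 8,6,5,9, 10,11,2,12, 11,13,14,3, 9,15,16,10, 13,16,15,14, 17,1,7, 17,8,12], [12,13,24,34,45,46,47,56,57,67]),
  ([1,2,3,4, 4,5,6,7, 8,6,5,9, 10,11,12,13, 2,14,15,16, 16,10,9,3, 11,15,14,12, 17,1,7, 17,8,13], [12,13,26,36,45,46,47,56,57,67])]⟩,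
  -- 7_43, 7_44: constituent knots 0_1, 0_1, 7_5
  ⟨7, 2, [
  ([1,2,3,4, 4,5,6,7, 8,6,9,10, 11,12,5,3, 12,13,14,9, 10,15,16,11, 13,16,15,14, 17,1,7, 17,8,2], [15,16,17,25,26,27]),
  ([1,2,3,4, 4,5,6,7, 8,6,9,10, 11,12,13,3, 5,14,15,16, 16,11,10,9, 12,15,14,13, 17,1,7, 17,8,2], [14,15,17,24,25,27]),
  ([1,2,3,4, 4,5,6,7, 8,9,10,11, 12,13,5,3, 14,15,16,6, 9,16,15,10, 11,14,13,12, 17,1,7, 17,8,2], [13,15,16,23,25,26]),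
  ([1,2,3,4, 5,6,7,8, 6,9,10,3, 4,11,12,5, 9,12,13,14, 15,16,11,10, 16,15,14,13, 17,1,8, 17,7,2], [15,16,17,25,26,27]),
  ([1,2,3,4, 5,6,7,8, 6,9,10,3, 4,11,12,13, 14,15,16,5, 9,16,11,10, 15,14,13,12, 17,1,8, 17,7,2], [14,15,17,24,25,27]),
  ([1,2,3,4, 5,6,7,8, 9,10,11,12, 12,5,4,3, 6,11,13,14, 15,16,10,7, 16,15,14,13, 17,1,8, 17,9,2], [15,16,17,45,46,47]),
  ([1,2,3,4, 5,6,7,8, 9,10,11,12, 12,13,4,3, 14,15,6,5, 16,11,10,7, 13,16,15,14, 17,1,8, 17,9,2], [12,15,17,24,45,47])]⟩,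
  ⟨7, 2, [
  ([1,2,3,4, 4,5,6,7, 8,9,10,3, 5,10,11,12, 13,14,9,6, 14,15,16,11, 12,16,15,13, 17,1,7, 17,8,2], [16,17,26,27,36,37]),
  ([1,2,3,4, 4,5,6,7, 8,9,10,3, 5,10,11,12, 13,14,15,6, 9,15,14,16, 16,13,12,11, 17,1,7, 17,8,2], [15,16,25,26,35,36]),
  ([1,2,3,4, 4,5,6,7, 8,9,10,3, 5,11,12,13, 14,15,9,6, 16,12,11,10, 13,16,15,14, 17,1,7, 17,8,2], [14,16,24,26,34,36]),
  ([1,2,3,4, 4,5,6,7, 8,9,10,11, 12,13,14,3, 5,14,9,6, 13,15,16,10, 11,16,15,12, 17,1,7, 17,8,2], [16,17,26,27,56,57]),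
  ([1,2,3,4, 4,5,6,7, 8,9,10,11, 12,13,14,3, 5,14,15,6, 9,15,16,10, 11,16,13,12, 17,1,7, 17,8,2], [13,16,23,26,35,56]),
  ([1,2,3,4, 4,5,6,7, 8,9,10,11, 12,13,14,3, 5,15,9,6, 16,12,11,10, 13,16,15,14, 17,1,7, 17,8,2], [14,17,24,27,45,57]),
  ([1,2,3,4, 5,6,7,8, 9,10,4,3, 10,11,12,5, 6,13,14,9, 11,14,15,16, 16,15,13,12, 17,1,8, 17,7,2], [16,17,26,27,36,37]),
  ([1,2,3,4, 5,6,7,8, 9,10,4,3, 10,11,12,5, 6,13,14,15, 15,14,16,9, 11,16,13,12, 17,1,8, 17,7,2], [15,16,25,26,35,36]),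
  ([1,2,3,4, 5,6,7,8, 9,10,11,12, 13,14,4,3, 14,13,12,5, 6,11,15,16, 16,15,10,7, 17,1,8, 17,9,2], [16,17,46,47,56,57]),
  ([1,2,3,4, 5,6,7,8, 9,10,11,12, 13,14,4,3, 14,13,15,5, 6,16,10,7, 16,15,12,11, 17,1,8, 17,9,2], [13,17,34,35,47,57])]⟩,
  -- 7_45, 7_46, 7_47: constituent knots 0_1, 3_1, 7_5
  ⟨7, 2, [
  ([1,2,3,4, 4,5,6,7, 8,9,10,11, 11,10,12,3, 5,12,13,14, 15,16,9,6, 16,15,14,13, 17,1,7, 17,8,2], [35,36,37,45,46,47]),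
  ([1,2,3,4, 4,5,6,7, 8,9,10,11, 12,13,14,3, 5,14,15,16, 16,15,9,6, 13,12,11,10, 17,1,7, 17,8,2], [35,36,45,46,57,67]),
  ([1,2,3,4, 5,6,7,8, 9,10,11,3, 4,11,10,12, 12,13,14,5, 6,15,16,9, 13,16,15,14, 17,1,8, 17,7,2], [35,36,37,45,46,47]),
  ([1,2,3,4, 5,6,7,8, 9,7,6,10, 11,12,4,3, 12,13,14,5, 10,15,16,11, 13,16,15,14, 17,1,8, 17,9,2], [25,26,27,35,36,37]),
  ([1,2,3,4, 5,6,7,8, 9,7,6,10, 11,12,13,3, 4,14,15,16, 16,11,10,5, 12,15,14,13, 17,1,8, 17,9,2], [24,25,27,34,35,37]),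
  ([1,2,3,4, 5,6,7,8, 9,10,11,12, 12,11,13,3, 4,14,15,16, 16,15,6,5, 14,13,10,7, 17,1,8, 17,9,2], [23,24,35,36,45,46]),
  ([1,2,3,4, 5,6,7,8, 9,10,11,12, 13,14,4,3, 14,15,16,5, 6,11,10,7, 12,16,15,13, 17,1,8, 17,9,2], [25,27,35,37,56,67]),
  ([1,2,3,4, 5,6,7,8, 9,10,11,12, 13,14,15,3, 4,15,14,16, 16,13,12,5, 6,11,10,7, 17,1,8, 17,9,2], [24,25,34,35,47,57]),
  ([1,2,3,4, 5,6,7,8, 9,7,6,10, 11,12,13,14, 2,13,12,3, 4,11,15,16, 16,15,10,5, 17,1,8, 17,9,14], [12,13,24,25,34,35])]⟩,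
  ⟨7, 2, [
  ([1,2,3,4, 4,5,6,7, 8,6,9,10, 10,11,12,13, 2,12,11,14, 15,16,5,3, 16,15,14,9, 17,1,7, 17,8,13], [13,14,15,24,25])]⟩,
  ⟨7, 2, [
  ([1,2,3,4, 4,5,6,7, 8,6,9,10, 11,12,2,13, 12,11,14,3, 5,14,15,16, 16,15,10,9, 17,1,7, 17,8,13], [34,35,46,47,56,57]),
  ([1,2,3,4, 5,6,7,8, 9,7,10,11, 12,13,2,14, 13,5,4,3, 6,12,15,16, 16,15,11,10, 17,1,8, 17,9,14], [13,16,17,35,56,57])]⟩,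
  -- 7_48: constituent knots 0_1, 5_1, 7_5
  ⟨7, 2, [
  ([1,2,3,4, 5,6,7,8, 9,7,6,10, 11,12,2,13, 14,5,4,3, 10,14,15,16, 16,15,12,11, 17,1,8, 17,9,13], [14,16,17,45,56,57])]⟩,
  -- 7_49: constituent knots 0_1, 5_2, 7_5
  ⟨7, 2, [
  ([1,2,3,4, 4,5,6,7, 8,6,5,9, 10,11,2,12, 13,14,9,3, 14,15,16,10, 11,16,15,13, 17,1,7, 17,8,12], [16,17,26,27,36,37]),
  ([1,2,3,4, 4,5,6,7, 8,6,5,9, 10,11,2,12, 13,14,15,3, 9,15,14,16, 16,13,11,10, 17,1,7, 17,8,12], [15,16,25,26,35,36]),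
  ([1,2,3,4, 4,5,6,7, 8,6,5,9, 10,11,12,13, 2,12,11,14, 15,16,9,3, 16,15,14,10, 17,1,7, 17,8,13], [14,15,24,25,34,35])]⟩]

def table7d : List ThetaEntry := [
  -- 7_50, ..., 7_54: constituent knots 0_1, 0_1, 7_6
  ⟨7, 1, [
  ([1,2,3,4, 4,5,6,7, 8,6,9,10, 10,11,12,3, 5,13,14,9, 11,14,15,16, 16,15,13,12, 17,1,7, 17,8,2], [3]),
  ([1,2,3,4, 4,5,6,7, 8,6,9,10, 10,11,12,3, 5,13,14,15, 15,14,16,9, 11,16,13,12, 17,1,7, 17,8,2], [3]),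
  ([1,2,3,4, 4,5,6,7, 8,6,9,10, 11,12,13,3, 5,14,15,9, 10,16,12,11, 16,15,14,13, 17,1,7, 17,8,2], [3]),
  ([1,2,3,4, 4,5,6,7, 8,9,10,11, 11,12,5,3, 12,13,14,6, 9,14,15,16, 16,15,13,10, 17,1,7, 17,8,2], [4]),
  ([1,2,3,4, 4,5,6,7, 8,9,10,11, 11,12,5,3, 13,14,15,6, 9,15,16,10, 12,16,14,13, 17,1,7, 17,8,2], [4]),
  ([1,2,3,4, 4,5,6,7, 8,9,10,11, 12,13,5,3, 13,14,15,6, 9,15,14,16, 16,12,11,10, 17,1,7, 17,8,2], [4]),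
  ([1,2,3,4, 5,6,7,8, 6,9,10,3, 4,10,11,12, 13,14,9,5, 14,15,16,11, 12,16,15,13, 17,1,8, 17,7,2], [3]),
  ([1,2,3,4, 5,6,7,8, 6,9,10,3, 4,10,11,12, 13,14,15,5, 9,15,14,16, 16,13,12,11, 17,1,8, 17,7,2], [3]),
  ([1,2,3,4, 5,6,7,8, 9,7,10,11, 11,12,4,3, 13,14,6,5, 14,15,16,10, 12,16,15,13, 17,1,8, 17,9,2], [3]),
  ([1,2,3,4, 5,6,7,8, 9,7,10,11, 11,12,4,3, 13,14,15,5, 6,15,14,16, 16,13,12,10, 17,1,8, 17,9,2], [3]),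
  ([1,2,3,4, 5,6,7,8, 9,10,11,12, 12,13,4,3, 14,15,16,5, 6,16,10,7, 15,14,13,11, 17,1,8, 17,9,2], [3])]⟩,
  ⟨7, 1, [
  ([1,2,3,4, 4,5,6,7, 8,6,9,10, 11,12,5,3, 12,13,14,9, 10,14,15,16, 16,15,13,11, 17,1,7, 17,8,2], [5]),
  ([1,2,3,4, 4,5,6,7, 8,6,9,10, 11,12,5,3, 13,14,15,9, 10,15,16,11, 12,16,14,13, 17,1,7, 17,8,2], [6]),
  ([1,2,3,4, 4,5,6,7, 8,6,9,10, 11,12,13,3, 5,13,14,15, 15,16,10,9, 16,14,12,11, 17,1,7, 17,8,2], [5]),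
  ([1,2,3,4, 4,5,6,7, 8,6,9,10, 11,12,13,3, 5,13,14,15, 16,11,10,9, 12,16,15,14, 17,1,7, 17,8,2], [4]),
  ([1,2,3,4, 4,5,6,7, 8,9,10,11, 12,13,5,3, 14,15,9,6, 15,14,16,10, 11,16,13,12, 17,1,7, 17,8,2], [3]),
  ([1,2,3,4, 4,5,6,7, 8,9,10,11, 12,13,5,3, 14,15,9,6, 15,16,11,10, 16,14,13,12, 17,1,7, 17,8,2], [5]),
  ([1,2,3,4, 5,6,7,8, 6,9,10,3, 4,11,12,5, 9,12,13,14, 14,15,16,10, 11,16,15,13, 17,1,8, 17,7,2], [5]),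
  ([1,2,3,4, 5,6,7,8, 6,9,10,3, 4,11,12,13, 13,14,15,5, 9,15,16,10, 11,16,14,12, 17,1,8, 17,7,2], [5]),
  ([1,2,3,4, 5,6,7,8, 9,10,11,12, 12,5,4,3, 6,11,13,14, 14,15,16,7, 10,16,15,13, 17,1,8, 17,9,2], [5]),
  ([1,2,3,4, 5,6,7,8, 9,10,11,12, 12,5,4,3, 6,13,14,15, 15,16,10,7, 16,14,13,11, 17,1,8, 17,9,2], [6]),
  ([1,2,3,4, 5,6,7,8, 9,10,11,12, 12,13,4,3, 13,14,15,5, 6,15,14,16, 16,11,10,7, 17,1,8, 17,9,2], [2]),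
  ([1,2,3,4, 5,6,7,8, 9,10,11,12, 12,13,4,3, 13,14,15,5, 6,15,16,7, 10,16,14,11, 17,1,8, 17,9,2], [5])]⟩,
  ⟨7, 1, [
  ([1,2,3,4, 4,5,6,7, 8,6,9,10, 10,11,12,13, 2,12,14,15, 15,14,16,3, 5,16,11,9, 17,1,7, 17,8,13], [7]),
  ([1,2,3,4, 4,5,6,7, 8,6,9,10, 11,12,13,14, 2,13,15,16, 16,9,5,3, 10,15,12,11, 17,1,7, 17,8,14], [6])]⟩,
  ⟨7, 1, [
  ([1,2,3,4, 4,5,6,7, 8,6,9,10, 11,12,2,13, 12,11,14,3, 5,15,16,9, 10,16,15,14, 17,1,7, 17,8,13], [3]),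
  ([1,2,3,4, 4,5,6,7, 8,6,9,10, 11,12,13,14, 2,13,12,15, 15,11,16,3, 5,16,10,9, 17,1,7, 17,8,14], [6]),
  ([1,2,3,4, 5,6,7,8, 9,7,10,11, 12,13,2,14, 13,5,4,3, 6,15,16,10, 11,16,15,12, 17,1,8, 17,9,14], [3]),
  ([1,2,3,4, 5,6,7,8, 9,7,10,11, 12,13,14,15, 2,14,13,16, 16,12,11,3, 4,10,6,5, 17,1,8, 17,9,15], [6])]⟩,
  ⟨7, 1, [
  ([1,2,3,4, 4,5,6,7, 8,6,9,10, 11,12,13,14, 2,13,12,15, 15,16,5,3, 16,11,10,9, 17,1,7, 17,8,14], [6])]⟩,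
  -- 7_55, 7_56: constituent knots 0_1, 3_1, 7_6
  ⟨7, 2, [
  ([1,2,3,4, 4,5,6,7, 8,6,9,10, 11,12,2,13, 14,15,5,3, 15,14,16,9, 10,16,12,11, 17,1,7, 17,8,13], [13,14,17,24,27,45,46,57,67])]⟩,
  ⟨7, 1, [
  ([1,2,3,4, 4,5,6,7, 8,9,10,11, 11,10,12,3, 5,12,13,14, 14,15,16,6, 9,16,15,13, 17,1,7, 17,8,2], [5]),
  ([1,2,3,4, 4,5,6,7, 8,9,10,11, 11,10,12,3, 5,13,14,15, 15,16,9,6, 16,14,13,12, 17,1,7, 17,8,2], [6]),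
  ([1,2,3,4, 4,5,6,7, 8,9,10,11, 11,12,13,3, 5,13,14,15, 15,14,16,6, 9,16,12,10, 17,1,7, 17,8,2], [4]),
  ([1,2,3,4, 4,5,6,7, 8,9,10,11, 11,12,13,3, 5,14,15,16, 16,15,9,6, 14,13,12,10, 17,1,7, 17,8,2], [3]),
  ([1,2,3,4, 5,6,7,8, 9,10,11,3, 4,11,10,12, 12,13,14,5, 6,14,15,16, 16,15,13,9, 17,1,8, 17,7,2], [5]),
  ([1,2,3,4, 5,6,7,8, 9,7,6,10, 11,12,4,3, 12,13,14,5, 10,14,15,16, 16,15,13,11, 17,1,8, 17,9,2], [5]),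
  ([1,2,3,4, 5,6,7,8, 9,7,6,10, 11,12,13,3, 4,13,14,15, 15,16,10,5, 16,14,12,11, 17,1,8, 17,9,2], [5]),
  ([1,2,3,4, 5,6,7,8, 9,7,10,11, 12,13,4,3, 13,14,15,5, 6,16,11,10, 16,15,14,12, 17,1,8, 17,9,2], [2]),
  ([1,2,3,4, 5,6,7,8, 9,7,10,11, 12,13,14,3, 4,14,13,15, 15,12,16,5, 6,16,11,10, 17,1,8, 17,9,2], [2]),
  ([1,2,3,4, 5,6,7,8, 9,10,11,12, 12,11,13,3, 4,14,15,5, 6,15,14,16, 16,13,10,7, 17,1,8, 17,9,2], [2]),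
  ([1,2,3,4, 5,6,7,8, 9,10,11,12, 12,11,13,3, 4,14,15,5, 6,15,16,7, 10,16,14,13, 17,1,8, 17,9,2], [5]),
  ([1,2,3,4, 5,6,7,8, 9,7,6,10, 11,12,2,13, 12,11,14,3, 4,14,15,16, 16,15,10,5, 17,1,8, 17,9,13], [1])]⟩,
  -- 7_57: constituent knots 0_1, 4_1, 7_6
  ⟨7, 2, [
  ([1,2,3,4, 5,6,7,8, 9,7,6,10, 10,11,12,3, 4,13,14,5, 11,14,15,16, 16,15,13,12, 17,1,8, 17,9,2], [16,17,24,25,26,27,34,35,36,37]),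
  ([1,2,3,4, 5,6,7,8, 9,7,6,10, 10,11,12,3, 4,13,14,15, 15,14,16,5, 11,16,13,12, 17,1,8, 17,9,2], [15,16,24,25,26,27,34,35,36,37]),
  ([1,2,3,4, 5,6,7,8, 9,7,10,11, 11,10,12,3, 4,12,13,14, 14,15,16,5, 6,16,15,13, 17,1,8, 17,9,2], [16,17,23,24,35,36,37,45,46,47]),
  ([1,2,3,4, 5,6,7,8, 9,7,10,11, 11,10,12,3, 4,13,14,15, 15,16,6,5, 16,14,13,12, 17,1,8, 17,9,2], [15,17,23,24,35,36,37,45,46,47]),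
  ([1,2,3,4, 5,6,7,8, 9,10,11,12, 12,11,13,3, 4,13,14,15, 15,14,16,5, 6,16,10,7, 17,1,8, 17,9,2], [12,17,23,24,35,36,37,45,46,47]),
  ([1,2,3,4, 5,6,7,8, 9,10,11,12, 12,13,14,3, 4,14,13,5, 6,11,15,16, 16,15,10,7, 17,1,8, 17,9,2], [16,17,24,25,34,35,46,47,56,57]),
  ([1,2,3,4, 5,6,7,8, 9,10,11,12, 12,13,14,3, 4,14,13,15, 15,16,6,5, 16,11,10,7, 17,1,8, 17,9,2], [12,16,24,25,34,35,46,47,56,57]),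
  ([1,2,3,4, 5,6,7,8, 9,7,6,10, 11,12,13,14, 2,13,12,15, 15,16,4,3, 16,11,10,5, 17,1,8, 17,9,14], [12,13,17,24,25,26,34,35,36,67]),
  ([1,2,3,4, 5,6,7,8, 9,7,6,10, 11,12,13,14, 2,13,15,16, 16,15,12,3, 4,11,10,5, 17,1,8, 17,9,14], [12,13,24,25,26,34,35,36,57,67])]⟩,
  -- 7_58: constituent knots 0_1, 5_2, 7_6
  ⟨7, 2, [
  ([1,2,3,4, 5,6,7,8, 9,7,6,10, 11,12,2,13, 14,5,4,3, 10,15,16,11, 12,16,15,14, 17,1,8, 17,9,13], [14,16,17,26,27,36,37,45,56,57]),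
  ([1,2,3,4, 5,6,7,8, 9,7,6,10, 11,12,13,14, 2,13,12,15, 16,5,4,3, 10,16,15,11, 17,1,8, 17,9,14], [14,15,17,24,25,34,35,46,56,67])]⟩,
  -- 7_59, ..., 7_63: constituent knots 0_1, 0_1, 7_7
  ⟨7, 1, [
  ([1,2,3,4, 4,5,6,7, 8,6,9,10, 10,11,12,3, 5,12,13,14, 14,15,16,9, 11,16,15,13, 17,1,7, 17,8,2], [3,5]),
  ([1,2,3,4, 4,5,6,7, 8,6,9,10, 10,11,12,3, 5,13,14,15, 15,16,11,9, 16,14,13,12, 17,1,7, 17,8,2], [3,6]),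
  ([1,2,3,4, 4,5,6,7, 8,6,9,10, 11,12,13,3, 5,13,14,9, 10,15,16,11, 12,16,15,14, 17,1,7, 17,8,2], [3,4]),
  ([1,2,3,4, 4,5,6,7, 8,6,9,10, 11,12,13,3, 5,14,15,9, 10,15,16,11, 12,16,14,13, 17,1,7, 17,8,2], [3,6]),
  ([1,2,3,4, 4,5,6,7, 8,9,10,11, 11,12,5,3, 13,14,9,6, 14,15,16,10, 12,16,15,13, 17,1,7, 17,8,2], [4,5]),
  ([1,2,3,4, 4,5,6,7, 8,9,10,11, 11,12,5,3, 13,14,15,6, 9,15,14,16, 16,13,12,10, 17,1,7, 17,8,2], [4,7]),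
  ([1,2,3,4, 4,5,6,7, 8,9,10,11, 12,13,5,3, 13,14,9,6, 14,15,16,10, 11,16,15,12, 17,1,7, 17,8,2], [3,4]),
  ([1,2,3,4, 4,5,6,7, 8,9,10,11, 12,13,5,3, 13,14,15,6, 9,15,16,10, 11,16,14,12, 17,1,7, 17,8,2], [4,7]),
  ([1,2,3,4, 5,6,7,8, 6,9,10,3, 4,10,11,12, 12,13,14,5, 9,14,15,16, 16,15,13,11, 17,1,8, 17,7,2], [3,5]),
  ([1,2,3,4, 5,6,7,8, 6,9,10,3, 4,10,11,12, 13,14,15,5, 9,15,16,11, 12,16,14,13, 17,1,8, 17,7,2], [3,6]),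
  ([1,2,3,4, 5,6,7,8, 9,7,10,11, 11,12,4,3, 12,13,14,5, 6,14,15,16, 16,15,13,10, 17,1,8, 17,9,2], [3,5]),
  ([1,2,3,4, 5,6,7,8, 9,7,10,11, 11,12,4,3, 13,14,15,5, 6,15,16,10, 12,16,14,13, 17,1,8, 17,9,2], [3,6]),
  ([1,2,3,4, 5,6,7,8, 9,10,11,12, 12,13,4,3, 13,11,14,5, 6,14,15,16, 16,15,10,7, 17,1,8, 17,9,2], [2,3]),
  ([1,2,3,4, 5,6,7,8, 9,10,11,12, 12,13,4,3, 14,15,6,5, 15,16,10,7, 16,14,13,11, 17,1,8, 17,9,2], [3,6])]⟩,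
  ⟨7, 1, [
  ([1,2,3,4, 5,6,7,8, 9,7,10,11, 11,12,13,3, 4,13,14,15, 16,10,6,5, 12,16,15,14, 17,1,8, 17,9,2], [3,4]),
  ([1,2,3,4, 5,6,7,8, 9,7,10,11, 11,12,13,3, 4,14,15,5, 6,15,14,16, 16,13,12,10, 17,1,8, 17,9,2], [2,3]),
  ([1,2,3,4, 5,6,7,8, 9,7,10,11, 12,13,14,3, 4,14,15,16, 16,10,6,5, 11,15,13,12, 17,1,8, 17,9,2], [3,5]),
  ([1,2,3,4, 5,6,7,8, 9,10,11,12, 12,13,14,3, 4,14,15,5, 6,15,16,7, 10,16,13,11, 17,1,8, 17,9,2], [4,5]),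
  ([1,2,3,4, 5,6,7,8, 9,10,11,12, 12,13,14,3, 4,15,16,5, 6,16,10,7, 15,14,13,11, 17,1,8, 17,9,2], [3,5]),
  ([1,2,3,4, 5,6,7,8, 9,7,10,11, 12,13,2,14, 13,12,15,3, 4,15,11,16, 16,10,6,5, 17,1,8, 17,9,14], [1,3]),
  ([1,2,3,4, 5,6,7,8, 9,7,10,11, 12,13,2,14, 13,12,15,3, 4,15,16,5, 6,16,11,10, 17,1,8, 17,9,14], [1,2])]⟩,
  ⟨7, 1, [
  ([1,2,3,4, 4,5,6,7, 8,6,9,10, 10,11,12,13, 2,12,14,15, 15,16,5,3, 16,14,11,9, 17,1,7, 17,8,13], [6,7])]⟩,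
  ⟨7, 1, [
  ([1,2,3,4, 4,5,6,7, 8,6,9,10, 11,12,2,13, 12,14,5,3, 14,15,16,9, 10,16,15,11, 17,1,7, 17,8,13], [5]),
  ([1,2,3,4, 4,5,6,7, 8,6,9,10, 11,12,13,14, 2,13,12,15, 16,9,5,3, 10,16,15,11, 17,1,7, 17,8,14], [6])]⟩,
  ⟨7, 1, [
  ([1,2,3,4, 5,6,7,8, 9,7,10,11, 12,13,2,14, 13,15,16,3, 4,16,6,5, 15,12,11,10, 17,1,8, 17,9,14], [1,4])]⟩,
  -- 7_64: constituent knots 0_1, 3_1, 7_7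
  ⟨7, 2, [
  ([1,2,3,4, 5,6,7,8, 9,7,10,11, 12,13,2,14, 15,5,4,3, 6,15,13,16, 16,12,11,10, 17,1,8, 17,9,14], [13,14,16,17,23,27,35,36,45,56,57,67])]⟩,
  -- 7_65: constituent knots 0_1, 4_1, 7_7
  ⟨7, 1, [
  ([1,2,3,4, 5,6,7,8, 9,7,6,10, 10,11,12,3, 4,12,13,14, 14,15,16,5, 11,16,15,13, 17,1,8, 17,9,2], [5]),
  ([1,2,3,4, 5,6,7,8, 9,7,6,10, 10,11,12,3, 4,13,14,15, 15,16,11,5, 16,14,13,12, 17,1,8, 17,9,2], [6]),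
  ([1,2,3,4, 5,6,7,8, 9,7,10,11, 11,10,12,3, 4,13,14,5, 6,14,15,16, 16,15,13,12, 17,1,8, 17,9,2], [5]),
  ([1,2,3,4, 5,6,7,8, 9,7,10,11, 11,10,12,3, 4,13,14,15, 15,14,16,5, 6,16,13,12, 17,1,8, 17,9,2], [7]),
  ([1,2,3,4, 5,6,7,8, 9,7,10,11, 11,12,13,3, 4,13,12,14, 14,15,16,5, 6,16,15,10, 17,1,8, 17,9,2], [2]),
  ([1,2,3,4, 5,6,7,8, 9,10,11,12, 12,11,13,3, 4,13,14,5, 6,14,15,16, 16,15,10,7, 17,1,8, 17,9,2], [2]),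
  ([1,2,3,4, 5,6,7,8, 9,10,11,12, 12,11,13,3, 4,13,14,15, 15,16,6,5, 16,14,10,7, 17,1,8, 17,9,2], [7]),
  ([1,2,3,4, 5,6,7,8, 9,10,11,12, 12,13,14,3, 4,14,13,15, 15,11,16,5, 6,16,10,7, 17,1,8, 17,9,2], [6]),
  ([1,2,3,4, 5,6,7,8, 9,7,6,10, 11,12,2,13, 12,14,15,3, 4,15,14,16, 16,11,10,5, 17,1,8, 17,9,13], [1]),
  ([1,2,3,4, 5,6,7,8, 9,7,6,10, 11,12,13,14, 2,13,12,15, 15,11,16,3, 4,16,10,5, 17,1,8, 17,9,14], [6])]⟩]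

def table : List ThetaEntry :=
  table3 ++ table4 ++ table5 ++ table6 ++ table7a ++ table7b ++ table7c ++ table7d

end ThetaCurve

/-! The statement is a finite computation: for every diagram and every set of crossings a sequence
of moves to the crossingless diagram is recorded, and it remains to carry it out. The difficulty is
that every intermediate code has to be a diagram of a θ-curve on the sphere. This is not tested
along the way. Instead, each kind of move is shown once and for all to preserve these diagrams, so
that only the initial codes are tested.

Most of the conditions in `IsThetaDiagram` are local in nature, but the number of faces is not: it
depends on the cycles of a permutation of all half-arcs. It is replaced by `Jordan`, the vanishing
of the first homology modulo two: every set of arcs that is even at each node bounds a set of faces.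
For a connected map with N nodes, A arcs and F faces, the space of cycles has dimension A - N + 1
and the space of boundaries has dimension F - 1. If they coincide, then N - A + F = 2; this is
`euler_formula`, and `planar_of_jordan` transfers it to codes.

`Jordan` speaks of a list of cyclic words, one for each node, and is easy to follow through local
changes. It survives the rotation of a word, the contraction of an arc between two nodes and its
inverse, the cancellation of a loop with neighbouring ends and its inverse, and the splitting of a
node. For moves III, IV and V both local pictures contract to the same cyclic word of outer arcs; in
moves I and II a cancellation or a splitting is enough. Together with the counting, connectedness
and colouring conditions (`Theta.replace`) this gives the invariance of `Theta`. Erasing a marked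
point is treated in `Theta.erase`.

For an initial code, `joined` follows the three edges from one vertex to the other, and `collapses`
contracts all nodes to one word and cancels it like a string of brackets. A crossing change only
rotates the word of a node, so it preserves `Theta` as well. By `leads_step` each recorded move is a
Reidemeister equivalence that preserves `Theta`, and `equiv_of_unknots` composes them. -/

namespace ThetaCurve

/-! ### Euler's formula -/

section Euler

variable {H N A : Type*}

/-- The functions that are constant along a permutation. -/
def invariants (φ : Equiv.Perm H) : Submodule (ZMod 2) (H → ZMod 2) where
  carrier := {f | ∀ i, f (φ i) = f i}
  add_mem' := fun ha hb i => by simp [ha i, hb i]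
  zero_mem' := fun i => rfl
  smul_mem' := fun c f hf i => by simp [hf i]

theorem eq_of_sameCycle [Finite H] {φ : Equiv.Perm H} {f : H → ZMod 2} (hf : f ∈ invariants φ)
    {i j : H}
    (h : φ.SameCycle i j) : f i = f j := by
  obtain ⟨n, -, rfl⟩ := h.exists_pow_eq'
  clear h
  induction n with
  | zero => simp
  | succ n ih => rw [pow_succ', Equiv.Perm.mul_apply, hf, ih]

/-- Connectedness enters Euler's formula twice in this form: once for functions on the half-arcs,
once for functions on the nodes. -/
theorem finrank_constants {X : Type*} [Nonempty X] (S : Submodule (ZMod 2) (X → ZMod 2))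
    (hS : ∀ f, f ∈ S ↔ ∀ x y, f x = f y) : Module.finrank (ZMod 2) S = 1 := by
  have x0 : X := Classical.arbitrary X
  refine finrank_eq_one_iff'.2 ⟨⟨fun _ => 1, (hS _).2 fun _ _ => rfl⟩, ?_, ?_⟩
  · intro h
    have := congrFun (congrArg Subtype.val h) x0
    simp at this
  · rintro ⟨w, hw⟩
    refine ⟨w x0, ?_⟩
    ext x
    simpa using (hS _).1 hw x0 x

/-- The number of half-arcs that an arc and a node have in common, modulo two. -/
def incidence [Fintype H] [DecidableEq N] [DecidableEq A] (node : H → N) (arc : H → A) :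
    Matrix N A (ZMod 2) :=
  fun v l => ∑ i, if node i = v ∧ arc i = l then 1 else 0

theorem incidence_mulVec [Fintype H] [Fintype A] [DecidableEq N] [DecidableEq A] (node : H → N)
    (arc : H → A) (g : A → ZMod 2) (v : N) :
    (incidence node arc).mulVec g v = ∑ i, if node i = v then g (arc i) else 0 := by
  simp only [Matrix.mulVec, dotProduct, incidence, Finset.sum_mul]
  rw [Finset.sum_comm]
  refine Finset.sum_congr rfl fun i _ => ?_
  by_cases h : node i = v <;> simp [h]

theorem incidence_transpose_mulVec [Fintype H] [Fintype N] [DecidableEq N] [DecidableEq A]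
    (node : H → N) (arc : H → A) (h : N → ZMod 2) (l : A) :
    (incidence node arc).transpose.mulVec h l = ∑ i, if arc i = l then h (node i) else 0 := by
  simp only [Matrix.mulVec, dotProduct, incidence, Matrix.transpose_apply, Finset.sum_mul]
  rw [Finset.sum_comm]
  refine Finset.sum_congr rfl fun i _ => ?_
  by_cases h : arc i = l <;> simp [h]

/-- An arc consists of the half-arcs `i` and `σ i`; as these are different, neither is counted
twice. -/
theorem sum_arc [Fintype H] [DecidableEq H] [DecidableEq A] {σ : Equiv.Perm H} {arc : H → A}
    (hσ : ∀ i, σ i ≠ i)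
    (harc : ∀ i j, arc j = arc i ↔ j = i ∨ j = σ i) (f : H → ZMod 2) (i : H) :
    (∑ j, if arc j = arc i then f j else 0) = f i + f (σ i) := by
  have : ∀ j, (if arc j = arc i then f j else 0) =
      (if j = i then f j else 0) + (if j = σ i then f j else 0) := by
    intro j
    have := hσ i
    by_cases h1 : j = i
    · subst h1; simp [this.symm]
    · simp [harc, h1]
  simp [this, Finset.sum_add_distrib]

/-- Euler's formula for a connected map on a surface in which every cycle of arcs bounds a set of
faces. -/
theorem euler_formula [Fintype H] [Fintype N] [Fintype A] [DecidableEq H] [DecidableEq N]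
    [DecidableEq A] (σ cw : Equiv.Perm H) (node : H → N) (arc : H → A)
    (hσ : ∀ i, σ i ≠ i) (hσσ : ∀ i, σ (σ i) = i)
    (harc : ∀ i j, arc j = arc i ↔ j = i ∨ j = σ i) (hA : Function.Surjective arc)
    (hcw : ∀ i j, node i = node j ↔ cw.SameCycle i j) (hN : Function.Surjective node)
    [Nonempty N]
    (conn : ∀ h : N → ZMod 2, (∀ i, h (node (σ i)) = h (node i)) → ∀ v w, h v = h w)
    (jordan : ∀ g : A → ZMod 2, (∀ v, (∑ i, if node i = v then g (arc i) else 0) = 0) →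
      ∃ f : H → ZMod 2, (∀ i, f (cw (σ i)) = f i) ∧ ∀ i, f i + f (σ i) = g (arc i)) :
    Module.finrank (ZMod 2) (invariants (cw * σ)) + Fintype.card N = Fintype.card A + 2 := by
  have two : ∀ a b : ZMod 2, a + b = 0 ↔ a = b := by decide
  -- The boundary map modulo two: a set of faces, given on the half-arcs that run along it, is sent
  -- to the arcs that have exactly one side in it.
  let bd : (H → ZMod 2) →ₗ[ZMod 2] (A → ZMod 2) :=
    { toFun := fun f l => ∑ i, if arc i = l then f i else 0
      map_add' := fun f g => by
        ext l; simp only [Pi.add_apply, ← Finset.sum_add_distrib]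
        exact Finset.sum_congr rfl fun i _ => by split_ifs <;> simp
      map_smul' := fun c f => by
        ext l; simp only [Pi.smul_apply, smul_eq_mul, RingHom.id_apply, Finset.mul_sum]
        exact Finset.sum_congr rfl fun i _ => by split_ifs <;> simp }
  have hbd : ∀ f i, bd f (arc i) = f i + f (σ i) := fun f i => sum_arc hσ harc f i
  -- A function constant along the rotation descends to the nodes, where connectedness applies.
  have nodeconst : ∀ f : H → ZMod 2, (∀ i, f (σ i) = f i) → (∀ i, f (cw i) = f i) →
      ∀ i j, f i = f j := by
    intro f h1 h2 i j
    obtain ⟨s, hs⟩ := hN.hasRightInverse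
    have e : ∀ i, f (s (node i)) = f i := fun i =>
      eq_of_sameCycle (φ := cw) h2 ((hcw _ _).1 (hs _))
    have := conn (fun v => f (s v)) (fun i => by simp only [e, h1]) (node i) (node j)
    simpa only [e] using this
  have : Nonempty H := ⟨(hN (Classical.arbitrary N)).choose⟩
  let S := invariants (cw * σ)
  let bd' : S →ₗ[ZMod 2] (A → ZMod 2) := bd.comp S.subtype
  -- A set of faces without boundary is constant across arcs (`σ`), hence, being constant along `cw
  -- * σ`, also around nodes (`cw`). So it is empty or everything.
  have hker : Module.finrank (ZMod 2) (LinearMap.ker bd') = 1 := by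
    rw [(Submodule.equivSubtypeMap S (LinearMap.ker bd')).finrank_eq]
    have e : (LinearMap.ker bd').map S.subtype = LinearMap.ker bd ⊓ S := by
      ext f; simp [bd', and_comm]
    rw [e]
    refine finrank_constants _ fun f => ?_
    rw [Submodule.mem_inf, LinearMap.mem_ker]
    constructor
    · rintro ⟨h1, h2⟩
      have h3 : ∀ i, f (σ i) = f i := fun i => by
        have := congrFun h1 (arc i)
        rw [hbd] at this
        exact ((two _ _).1 this).symm
      refine nodeconst f h3 fun i => ?_
      have := h2 (σ i)
      rw [Equiv.Perm.mul_apply, hσσ, h3] at this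
      exact this
    · intro h
      refine ⟨?_, fun i => h _ _⟩
      ext l
      obtain ⟨i, rfl⟩ := hA l
      rw [hbd, h (σ i) i]
      exact (two _ _).2 rfl
  let M := incidence node arc
  -- Boundaries are cycles: for a function on faces, `f (σ i) = f (cw i)`, so at each node the sum
  -- of `f i + f (cw i)` runs twice over the same values. That cycles are boundaries is the
  -- hypothesis `jordan`.
  have hrange : LinearMap.range bd' = LinearMap.ker M.mulVecLin := by
    ext g
    simp only [LinearMap.mem_range, LinearMap.mem_ker, Matrix.mulVecLin_apply]
    constructor
    · rintro ⟨⟨f, hf⟩, rfl⟩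
      ext v
      have hf' : ∀ i, f (σ i) = f (cw i) := fun i => by
        have := hf (σ i)
        rwa [Equiv.Perm.mul_apply, hσσ, eq_comm] at this
      simp only [M, incidence_mulVec, bd', LinearMap.comp_apply, Submodule.subtype_apply, hbd, hf',
        Pi.zero_apply]
      have : ∀ i, (if node i = v then f i + f (cw i) else 0) =
          (if node i = v then f i else 0) + (if node (cw i) = v then f (cw i) else 0) := by
        intro i
        have : node (cw i) = node i := (hcw _ _).2 (Equiv.Perm.sameCycle_apply_left.2 (.refl _ _))
        rw [this]
        split_ifs <;> simp
      simp only [this, Finset.sum_add_distrib]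
      rw [Equiv.sum_comp cw fun i => if node i = v then f i else 0]
      exact (two _ _).2 rfl
    · intro hg
      obtain ⟨f, hf, hfg⟩ := jordan g fun v => by
        rw [← incidence_mulVec]; exact congrFun hg v
      refine ⟨⟨f, hf⟩, ?_⟩
      ext l
      obtain ⟨i, rfl⟩ := hA l
      exact (hbd f i).trans (hfg i)
  -- The transpose is the coboundary of functions on the nodes; its kernel consists of the functions
  -- that agree at both ends of every arc.
  have hkerT : Module.finrank (ZMod 2) (LinearMap.ker M.transpose.mulVecLin) = 1 := by
    refine finrank_constants _ fun h => ?_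
    rw [LinearMap.mem_ker, Matrix.mulVecLin_apply]
    have key : ∀ i, M.transpose.mulVec h (arc i) = h (node i) + h (node (σ i)) := fun i => by
      rw [incidence_transpose_mulVec]
      exact sum_arc hσ harc (fun i => h (node i)) i
    constructor
    · intro hh
      refine conn h fun i => ?_
      have := congrFun hh (arc i)
      rw [key] at this
      exact ((two _ _).1 this).symm
    · intro hh
      ext l
      obtain ⟨i, rfl⟩ := hA l
      rw [key]
      exact (two _ _).2 (hh _ _)
  -- Counting dimensions: F - 1 = dim ker M = A - rank M, and rank M = rank of the transpose = N -
  -- 1.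
  have r1 := LinearMap.finrank_range_add_finrank_ker bd'
  have r2 := LinearMap.finrank_range_add_finrank_ker M.mulVecLin
  have r3 := LinearMap.finrank_range_add_finrank_ker M.transpose.mulVecLin
  have r4 : Module.finrank (ZMod 2) (LinearMap.range M.transpose.mulVecLin) =
      Module.finrank (ZMod 2) (LinearMap.range M.mulVecLin) := Matrix.rank_transpose M
  rw [hker, hrange] at r1
  rw [Module.finrank_fintype_fun_eq_card] at r2 r3
  change _ = Module.finrank (ZMod 2) (invariants (cw * σ)) at r1
  omega

/-- Every cycle of a permutation has a least element. -/
theorem finrank_invariants {n : ℕ} (φ : Equiv.Perm (Fin n)) :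
    Module.finrank (ZMod 2) (invariants φ) =
      (Finset.univ.filter fun i : Fin n => ∀ k < n, i ≤ (φ ^ k) i).card := by
  classical
  -- Exponents may be reduced modulo the minimal period, which is at most `n`. So the `n` iterates
  -- inspected by `faceCount` exhaust a cycle.
  have pow_lt : ∀ i j : Fin n, φ.SameCycle i j → ∃ k < n, (φ ^ k) i = j := by
    intro i j h
    obtain ⟨k, -, hk⟩ := h.exists_pow_eq'
    have hp : 0 < Function.minimalPeriod φ i :=
      Function.minimalPeriod_pos_of_mem_periodicPts
        (Function.Injective.mem_periodicPts φ.injective i)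
    refine ⟨k % Function.minimalPeriod φ i, (Nat.mod_lt _ hp).trans_le ?_, ?_⟩
    · simpa using Function.minimalPeriod_le_card (f := φ) (x := i)
    · rw [← Equiv.Perm.iterate_eq_pow, Function.iterate_mod_minimalPeriod_eq,
        Equiv.Perm.iterate_eq_pow, hk]
  let R := Finset.univ.filter fun i : Fin n => ∀ k < n, i ≤ (φ ^ k) i
  have hR : ∀ i, i ∈ R ↔ ∀ j, φ.SameCycle i j → i ≤ j := by
    intro i
    simp only [R, Finset.mem_filter, Finset.mem_univ, true_and]
    constructor
    · intro h j hj
      obtain ⟨k, hk, rfl⟩ := pow_lt i j hj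
      exact h k hk
    · exact fun h k _ => h _ ⟨k, by simp⟩
  have hrep : ∀ i, ∃ j ∈ R, φ.SameCycle i j := by
    intro i
    obtain ⟨j, hj, hmin⟩ := Finset.exists_min_image
      (Finset.univ.filter fun j => φ.SameCycle i j) id
      ⟨i, by simp [Equiv.Perm.SameCycle.refl]⟩
    simp only [Finset.mem_filter, Finset.mem_univ, true_and, id] at hj hmin
    exact ⟨j, (hR j).2 fun k hk => hmin k (hj.trans hk), hj⟩
  choose rep repR repS using hrep
  have rep_eq : ∀ i j, φ.SameCycle i j → rep i = rep j := by
    intro i j h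
    have h1 : φ.SameCycle (rep i) (rep j) := (repS i).symm.trans (h.trans (repS j))
    exact le_antisymm ((hR _).1 (repR i) _ h1) ((hR _).1 (repR j) _ h1.symm)
  have rep_self : ∀ i ∈ R, rep i = i := fun i hi =>
    le_antisymm ((hR _).1 (repR i) _ (repS i).symm) ((hR _).1 hi _ (repS i))
  -- The least elements form a transversal of the cycles, so an invariant function is the same as an
  -- arbitrary function on them.
  let res : invariants φ →ₗ[ZMod 2] (R → ZMod 2) :=
    (LinearMap.funLeft (ZMod 2) (ZMod 2) (Subtype.val : R → Fin n)).comp (invariants φ).subtype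
  have hbij : Function.Bijective res := by
    constructor
    · rintro ⟨f, hf⟩ ⟨g, hg⟩ h
      ext i
      have : f (rep i) = g (rep i) := congrFun h ⟨rep i, repR i⟩
      change f i = g i
      rw [eq_of_sameCycle hf (repS i), eq_of_sameCycle hg (repS i), this]
    · intro h
      refine ⟨⟨fun i => h ⟨rep i, repR i⟩, fun i => ?_⟩, ?_⟩
      · simp only [rep_eq (φ i) i (Equiv.Perm.sameCycle_apply_left.2 (.refl _ _))]
      · ext i
        exact congrArg h (Subtype.ext (rep_self i i.2))
  rw [(LinearEquiv.ofBijective res hbij).finrank_eq, Module.finrank_fintype_fun_eq_card,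
    Fintype.card_coe]

end Euler

/-! ### The Jordan curve theorem implies genus zero -/

/-- Going counterclockwise around a node with the incident arcs `w`, and adding the value of `g`
at each arc that is passed, one visits each half-arc with some value, the first of them with the
value `q`. This is the sum of these values over the half-arcs of the arc `l`. -/
def sideSum (g : ℕ → ZMod 2) (l : ℕ) : List ℕ → ZMod 2 → ZMod 2
  | [], _ => 0
  | m :: w, q => (if m = l then q else 0) + sideSum g l w (q + g m)

/-- The Jordan curve theorem for the surface with the nodes `W`, each given by the cyclic list of
its arcs: a set of arcs (with the indicator function `g`) that meets every node in an even number
of half-arcs is the boundary of a set of faces. A set of faces is given by the corners that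
belong to it; it is determined by one corner of each node. -/
def Jordan (W : List (List ℕ)) : Prop :=
  ∀ g : ℕ → ZMod 2, (∀ w ∈ W, (w.map g).sum = 0) →
    ∃ Q : List (List ℕ × ZMod 2), Q.map Prod.fst = W ∧
      ∀ l ∈ W.flatten, (Q.map fun p => sideSum g l p.1 p.2).sum = g l

/-- The value at the `i`-th half-arc. -/
def sideValue (g : ℕ → ZMod 2) : List (List ℕ × ZMod 2) → ℕ → ZMod 2
  | [], _ => 0
  | (w, q) :: Q, i =>
    if i < w.length then q + ((w.take i).map g).sum else sideValue g Q (i - w.length)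

/-- The number of the node to which the `i`-th half-arc belongs. -/
def nodeIndex : List (List ℕ) → ℕ → ℕ
  | [], _ => 0
  | w :: W, i => if i < w.length then 0 else nodeIndex W (i - w.length) + 1

theorem count_eq_sum (l : ℕ) (L : List ℕ) :
    L.count l = ∑ i ∈ Finset.range L.length, if L.getD i 0 = l then 1 else 0 := by
  induction L with
  | nil => simp
  | cons a L ih => rw [List.count_cons, ih, List.length_cons, Finset.sum_range_succ']; simp

theorem countP_range (n : ℕ) (p : ℕ → Bool) :
    (List.range n).countP p = ∑ i ∈ Finset.range n, if p i then 1 else 0 := by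
  induction n with
  | zero => simp
  | succ n ih =>
    rw [List.range_succ, List.countP_append, ih, Finset.sum_range_succ]; simp [List.countP_cons]

/-- The running value in `sideSum` is the initial value plus a partial sum, which is `sideValue`;
the recursion over words becomes a sum over half-arcs. -/
theorem sum_sideSum (g : ℕ → ZMod 2) (l : ℕ) (Q : List (List ℕ × ZMod 2)) :
    (Q.map fun p => sideSum g l p.1 p.2).sum =
      ∑ i ∈ Finset.range (Q.map Prod.fst).flatten.length,
        if (Q.map Prod.fst).flatten.getD i 0 = l then sideValue g Q i else 0 := by
  induction Q with
  | nil => simp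
  | cons p Q ih =>
    obtain ⟨w, q⟩ := p
    simp only [List.map_cons, List.sum_cons, List.flatten_cons, List.length_append,
      Finset.sum_range_add, ih]
    congr 1
    · have : ∀ i ∈ Finset.range w.length,
          (if (w ++ (Q.map Prod.fst).flatten).getD i 0 = l then sideValue g ((w, q) :: Q) i
            else 0) = if w.getD i 0 = l then q + ((w.take i).map g).sum else 0 := by
        intro i hi
        rw [Finset.mem_range] at hi
        rw [List.getD_append _ _ _ _ hi]
        simp [sideValue, hi]
      rw [Finset.sum_congr rfl this]
      clear this
      induction w generalizing q with
      | nil => simp [sideSum]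
      | cons m w ih => simp [sideSum, Finset.sum_range_succ', ih, add_assoc, add_comm]
    · refine Finset.sum_congr rfl fun i _ => ?_
      rw [List.getD_append_right _ _ _ _ (by omega)]
      simp [sideValue]

/-- The parity condition of `Jordan` on a word, in the form of the one in `euler_formula`. -/
theorem sum_node (g : ℕ → ZMod 2) (W : List (List ℕ)) (v : ℕ) (hv : v < W.length) :
    (∑ i ∈ Finset.range W.flatten.length,
      if nodeIndex W i = v then g (W.flatten.getD i 0) else 0) = (W[v].map g).sum := by
  induction W generalizing v with
  | nil => simp at hv
  | cons w W ih =>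
    simp only [List.flatten_cons, List.length_append, Finset.sum_range_add]
    have h1 : ∀ i ∈ Finset.range w.length,
        (if nodeIndex (w :: W) i = v then g ((w ++ W.flatten).getD i 0) else 0) =
          if 0 = v then g (w.getD i 0) else 0 := by
      intro i hi
      rw [Finset.mem_range] at hi
      rw [List.getD_append _ _ _ _ hi]
      simp [nodeIndex, hi]
    have h2 : ∀ i ∈ Finset.range W.flatten.length,
        (if nodeIndex (w :: W) (w.length + i) = v then
          g ((w ++ W.flatten).getD (w.length + i) 0) else 0) =
          if nodeIndex W i + 1 = v then g (W.flatten.getD i 0) else 0 := by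
      intro i _
      rw [List.getD_append_right _ _ _ _ (by omega)]
      simp [nodeIndex]
    rw [Finset.sum_congr rfl h1, Finset.sum_congr rfl h2]
    cases v with
    | zero =>
      simp only [if_true, List.getElem_cons_zero]
      rw [Finset.sum_eq_zero (s := Finset.range W.flatten.length) (fun i _ => by simp), add_zero]
      clear h1 h2 ih hv
      induction w with
      | nil => simp
      | cons m w ih =>
        simp only [List.length_cons, Finset.sum_range_succ', List.getD_cons_succ, ih,
          List.getD_cons_zero, List.map_cons, List.sum_cons, add_comm]
    | succ v => simpa using ih v (by simpa using hv)

theorem nodeIndex_lt (W : List (List ℕ)) (i : ℕ) (hi : i < W.flatten.length) :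
    nodeIndex W i < W.length := by
  induction W generalizing i with
  | nil => simp at hi
  | cons w W ih =>
    simp only [nodeIndex, List.length_cons]
    split_ifs with h
    · omega
    · have := ih (i - w.length) (by simp only [List.flatten_cons, List.length_append] at hi; omega)
      omega

theorem exists_nodeIndex (W : List (List ℕ)) (v : ℕ) (hv : v < W.length) (x : ℕ) (hx : x ∈ W[v]) :
    ∃ i < W.flatten.length, nodeIndex W i = v ∧ W.flatten.getD i 0 = x := by
  induction W generalizing v with
  | nil => simp at hv
  | cons w W ih =>
    cases v with
    | zero =>
      obtain ⟨i, hi, rfl⟩ := List.getElem_of_mem hx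
      simp only [List.getElem_cons_zero] at hi
      refine ⟨i, by simp; omega, by simp [nodeIndex, hi], ?_⟩
      rw [List.flatten_cons, List.getD_append _ _ _ _ hi]
      simp [hi]
    | succ v =>
      obtain ⟨i, hi, h1, h2⟩ := ih v (by simpa using hv) (by simpa using hx)
      refine ⟨w.length + i, by simpa using hi, by simp [nodeIndex, h1], ?_⟩
      rw [List.flatten_cons, List.getD_append_right _ _ _ _ (by omega)]
      simpa using h2

/-! ### The rotation system of a code -/

section Code

variable (D : Diagram)

theorem labels_eq : labels D = (D.map Node.labels).flatten := by
  rw [labels, List.flatMap_def]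

theorem Node.labels_length_pos (v : Node) : 0 < v.labels.length := by cases v <;> simp [Node.labels]

theorem clockwiseNext_lt (i : ℕ) (hi : i < (labels D).length) :
    clockwiseNext D i < (labels D).length := by
  induction D generalizing i with
  | nil => simp [labels] at hi
  | cons v D ih =>
    have hv := v.labels_length_pos
    simp only [labels, List.flatMap_cons, List.length_append, clockwiseNext] at hi ⊢
    split_ifs with h
    · have := Nat.mod_lt (i + (v.labels.length - 1)) hv
      omega
    · have := ih (i - v.labels.length) (by rw [labels]; omega)
      rw [labels] at this
      omega

theorem nodeIndex_clockwiseNext (i : ℕ) :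
    nodeIndex (D.map Node.labels) (clockwiseNext D i) = nodeIndex (D.map Node.labels) i := by
  induction D generalizing i with
  | nil => rfl
  | cons v D ih =>
    simp only [List.map_cons, nodeIndex, clockwiseNext]
    by_cases h : i < v.labels.length
    · rw [if_pos h, if_pos h, if_pos (Nat.mod_lt _ v.labels_length_pos)]
    · rw [if_neg h, if_neg h, if_neg (by omega), Nat.add_sub_cancel_left, ih]

theorem iterate_clockwiseNext_eq (i j : ℕ) (hi : i < (labels D).length) (hj : j < (labels D).length)
    (h : nodeIndex (D.map Node.labels) i = nodeIndex (D.map Node.labels) j) :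
    ∃ k, (clockwiseNext D)^[k] i = j := by
  induction D generalizing i j with
  | nil => simp [labels] at hi
  | cons v D ih =>
    have hv := v.labels_length_pos
    simp only [labels, List.flatMap_cons, List.length_append] at hi hj
    simp only [List.map_cons, nodeIndex] at h
    by_cases h1 : i < v.labels.length
    · have h2 : j < v.labels.length := by
        by_contra h2
        simp [h1, h2] at h
      -- At a node of degree d a clockwise step adds d - 1, that is, subtracts one modulo d.
      have key : ∀ k, (clockwiseNext (v :: D))^[k] i =
          (i + k * (v.labels.length - 1)) % v.labels.length := by
        intro k
        induction k with
        | zero => simp [Nat.mod_eq_of_lt h1]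
        | succ k ih =>
          rw [Function.iterate_succ_apply', ih, clockwiseNext, if_pos (Nat.mod_lt _ hv),
            Nat.mod_add_mod]
          congr 1; ring
      -- It takes `i - j` clockwise steps to get from `i` to `j`; the degree is added to avoid
      -- truncated subtraction.
      refine ⟨v.labels.length + i - j, ?_⟩
      rw [key]
      obtain ⟨n, hn⟩ : ∃ n, v.labels.length = n + 1 := ⟨v.labels.length - 1, by omega⟩
      rw [hn] at h1 h2 ⊢
      obtain ⟨d, hd⟩ : ∃ d, n + 1 + i - j = d ∧ n + 1 + i = d + j := ⟨n + 1 + i - j, rfl, by omega⟩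
      rw [hd.1, Nat.add_sub_cancel]
      have h3 : i + d * n + (n + 1) = j + d * (n + 1) := by rw [mul_add]; omega
      have : (i + d * n + (n + 1)) % (n + 1) = j % (n + 1) := by rw [h3]; simp
      rwa [Nat.add_mod_right, Nat.mod_eq_of_lt h2] at this
    · have h2 : ¬ j < v.labels.length := by
        intro h2
        simp [h1, h2] at h
      obtain ⟨k, hk⟩ := ih (i - v.labels.length) (j - v.labels.length) (by rw [labels]; omega)
        (by rw [labels]; omega) (by simpa [h1, h2] using h)
      have key : ∀ k, (clockwiseNext (v :: D))^[k] i =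
          v.labels.length + (clockwiseNext D)^[k] (i - v.labels.length) := by
        intro k
        induction k with
        | zero => simp; omega
        | succ k ih =>
          rw [Function.iterate_succ_apply', ih, clockwiseNext, if_neg (by omega),
            Function.iterate_succ_apply', Nat.add_sub_cancel_left]
      exact ⟨k, by rw [key, hk]; omega⟩

/-- No inverse is needed: some iterate of `clockwiseNext` leads from any half-arc of a node to any
other, so the map is onto the finite set of half-arcs, and hence injective. -/
theorem clockwiseNext_injective (i j : ℕ) (hi : i < (labels D).length)
    (hj : j < (labels D).length) (h : clockwiseNext D i = clockwiseNext D j) : i = j := by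
  have hn : nodeIndex (D.map Node.labels) i = nodeIndex (D.map Node.labels) j := by
    rw [← nodeIndex_clockwiseNext, h, nodeIndex_clockwiseNext]
  have surj : Set.SurjOn (clockwiseNext D) (Finset.range (labels D).length : Set ℕ)
      (Finset.range (labels D).length) := by
    intro j hj
    simp only [Finset.coe_range, Set.mem_Iio] at hj
    have hj' := clockwiseNext_lt D j hj
    obtain ⟨k, hk⟩ := iterate_clockwiseNext_eq D _ j hj' hj (nodeIndex_clockwiseNext D j)
    refine ⟨(clockwiseNext D)^[k] j, ?_, ?_⟩
    · simp only [Finset.coe_range, Set.mem_Iio]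
      clear hk
      induction k with
      | zero => exact hj
      | succ k ih => rw [Function.iterate_succ_apply']; exact clockwiseNext_lt D _ ih
    · rw [← Function.iterate_succ_apply' (clockwiseNext D), Function.iterate_succ_apply, hk]
  have hmaps : Set.MapsTo (clockwiseNext D) (Finset.range (labels D).length : Set ℕ)
      (Finset.range (labels D).length : Set ℕ) := fun i hi => by
    simpa using clockwiseNext_lt D i (by simpa using hi)
  exact Finset.injOn_of_surjOn_of_card_le _ hmaps surj le_rfl (by simpa using hi)
    (by simpa using hj) h

/-- Passing a half-arc adds its value of `g`. From the first half-arc of a node the clockwise step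
wraps around to the last one, and there the evenness of `g` at the node closes the circuit. -/
theorem sideValue_clockwiseNext (g : ℕ → ZMod 2) (D : Diagram) (Q : List (List ℕ × ZMod 2))
    (hQ : Q.map Prod.fst = D.map Node.labels)
    (heven : ∀ w ∈ D.map Node.labels, (w.map g).sum = 0) (i : ℕ) (hi : i < (labels D).length) :
    sideValue g Q (clockwiseNext D i) + g ((labels D).getD (clockwiseNext D i) 0) =
      sideValue g Q i := by
  induction D generalizing i Q with
  | nil => simp [labels] at hi
  | cons v D ih =>
    have hv := v.labels_length_pos
    obtain _ | ⟨⟨w, q⟩, Q⟩ := Q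
    · simp at hQ
    simp only [List.map_cons, List.cons.injEq] at hQ
    obtain ⟨rfl, hQ⟩ := hQ
    simp only [labels, List.flatMap_cons, List.length_append, clockwiseNext] at hi ⊢
    by_cases h1 : i < v.labels.length
    · have h2 := Nat.mod_lt (i + (v.labels.length - 1)) hv
      simp only [h1, if_true, sideValue, h2]
      rw [List.getD_append _ _ _ _ h2]
      have hs : ∀ j, (hj : j < v.labels.length) → ((v.labels.take j).map g).sum +
          g (v.labels.getD j 0) = ((v.labels.take (j + 1)).map g).sum := by
        intro j hj
        rw [List.take_add_one]
        simp [hj]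
      cases i with
      | zero =>
        have : (0 + (v.labels.length - 1)) % v.labels.length = v.labels.length - 1 :=
          by rw [zero_add]; exact Nat.mod_eq_of_lt (by omega)
        rw [this, add_assoc, hs _ (by omega), Nat.sub_add_cancel hv, List.take_length,
          heven _ (by simp)]
        simp
      | succ i =>
        have : (i + 1 + (v.labels.length - 1)) % v.labels.length = i := by
          have : i + 1 + (v.labels.length - 1) = i + v.labels.length := by omega
          rw [this, Nat.add_mod_right, Nat.mod_eq_of_lt (by omega)]
        rw [this, add_assoc, hs _ (by omega)]
    · have := ih Q hQ (fun w hw => heven w (by rw [List.map_cons]; exact .tail _ hw))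
        (i - v.labels.length) (by rw [labels]; omega)
      simp only [h1, if_false, sideValue]
      rw [if_neg (by omega), List.getD_append_right _ _ _ _ (by omega), Nat.add_sub_cancel_left]
      exact this

/-- The surface of the code has genus zero if the Jordan curve theorem holds on it. -/
theorem planar_of_jordan (h0 : D ≠ []) (twice : ∀ l ∈ labels D, (labels D).count l = 2)
    (conn : ∀ l ∈ labels D, ∀ m ∈ labels D,
      Relation.EqvGen (fun x y => ∃ v ∈ D, (x, y) ∈ v.links) l m)
    (jordan : Jordan (D.map Node.labels)) :
    2 * (D.length + faceCount D) = (labels D).length + 4 := by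
  set L := labels D with hL
  set W := D.map Node.labels with hW
  have hLW : L = W.flatten := labels_eq D
  have mem : ∀ i : Fin L.length, L.getD i 0 ∈ L := fun i => by simp
  -- Since every label occurs twice, each half-arc has exactly one companion; `s` becomes the
  -- involution `σ` without fixed points.
  have hsecond : ∀ i : Fin L.length, ∃ j : Fin L.length, j ≠ i ∧
      ∀ k : Fin L.length, L.getD k 0 = L.getD i 0 ↔ k = i ∨ k = j := by
    intro i
    have h := twice _ (mem i)
    rw [count_eq_sum, ← Fin.sum_univ_eq_sum_range
      (fun k => if L.getD k 0 = L.getD i 0 then 1 else 0), ← Finset.card_filter,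
      Finset.card_eq_two] at h
    obtain ⟨x, y, hxy, hs⟩ := h
    have key : ∀ k : Fin L.length, L.getD k 0 = L.getD i 0 ↔ k = x ∨ k = y := fun k => by
      rw [← Finset.mem_singleton (a := y), ← Finset.mem_insert, ← hs]; simp
    rcases (key i).1 rfl with rfl | rfl
    · exact ⟨y, hxy.symm, key⟩
    · exact ⟨x, hxy, fun k => (key k).trans or_comm⟩
  choose s hsne hs using hsecond
  have hss : ∀ i, s (s i) = i := fun i => by
    have h1 := (hs i (s i)).2 (Or.inr rfl)
    have h2 := (hs (s i) i).1 h1.symm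
    rcases h2 with h2 | h2
    · exact absurd h2.symm (hsne i)
    · exact h2.symm
  -- The search in `partner` can only find the companion, and it does not fall back on its default
  -- value.
  have hpartner : ∀ i : Fin L.length, partner D i = s i := by
    intro i
    have hp : ∀ j : Fin L.length, ((j : ℕ) != (i : ℕ) && L[(j : ℕ)]? == L[(i : ℕ)]?) = true ↔
        j = s i := by
      intro j
      have h1 := hs i j
      simp only [List.getD_eq_getElem?_getD, Fin.is_lt, List.getElem?_eq_getElem,
        Option.getD_some] at h1
      simp only [Fin.is_lt, List.getElem?_eq_getElem, Bool.and_eq_true, bne_iff_ne, ne_eq,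
        beq_iff_eq, Option.some.injEq, h1, Fin.val_inj]
      have := hsne i
      constructor
      · rintro ⟨h2, h3 | h3⟩
        · exact absurd h3 h2
        · exact h3
      · rintro rfl; exact ⟨this, .inr rfl⟩
    simp only [partner]
    rw [← hL]
    cases hf : (List.range L.length).find? fun j => j != (i : ℕ) && L[j]? == L[(i : ℕ)]? with
    | none =>
      rw [List.find?_eq_none] at hf
      exact absurd ((hp (s i)).2 rfl) (hf (s i) (by simp))
    | some j =>
      have hj := List.mem_range.1 (List.mem_of_find?_eq_some hf)
      have h1 := List.find?_some hf
      have := (hp ⟨j, hj⟩).1 h1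
      rw [← this]; rfl
  let σ : Equiv.Perm (Fin L.length) := ⟨s, s, hss, hss⟩
  let cwf : Fin L.length → Fin L.length := fun i => ⟨clockwiseNext D i, clockwiseNext_lt D i i.2⟩
  let cw : Equiv.Perm (Fin L.length) := Equiv.ofBijective cwf <|
    Finite.injective_iff_bijective.1 fun i j h => Fin.ext <|
      clockwiseNext_injective D i j i.2 j.2 (congrArg Fin.val h)
  have hcwv : ∀ i, ((cw i : Fin L.length) : ℕ) = clockwiseNext D i := fun i => rfl
  have hφ : ∀ i : Fin L.length, faceNext D i = (cw * σ) i := fun i => by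
    rw [faceNext, hpartner]; rfl
  -- `faceCount` counts the half-arcs that are least in their cycle, as does `finrank_invariants`.
  have hface : faceCount D = Module.finrank (ZMod 2) (invariants (cw * σ)) := by
    rw [finrank_invariants, Finset.card_filter]
    simp only [faceCount]
    rw [countP_range]
    simp only [List.length_map, List.length_range]
    rw [Finset.sum_range]
    change (∑ i : Fin L.length, if (List.iterate
      (fun j => ((List.range L.length).map (faceNext D)).getD j 0) i L.length).all
      (fun j => decide ((i : ℕ) ≤ j)) = true then 1 else 0) = _
    refine Finset.sum_congr rfl fun i _ => ?_
    have hit : ∀ k, (fun j => ((List.range L.length).map (faceNext D)).getD j 0)^[k] (i : ℕ) =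
        (((cw * σ) ^ k) i : Fin L.length) := by
      intro k
      induction k with
      | zero => rfl
      | succ k ih =>
        rw [Function.iterate_succ_apply', ih, pow_succ', Equiv.Perm.mul_apply, ← hφ]
        simp
    refine if_congr ((List.all_eq_true.trans (forall_congr' fun j => imp_congr List.mem_iterate
      decide_eq_true_iff)).trans ⟨fun h k hk => ?_, ?_⟩) rfl rfl
    · have := h _ ⟨k, hk, rfl⟩
      rw [hit] at this
      exact this
    · rintro h _ ⟨k, hk, rfl⟩
      rw [hit]
      exact h k hk
  let A := {l // l ∈ L.toFinset}
  let arc : Fin L.length → A := fun i => ⟨L.getD i 0, by simp⟩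
  have hWL : W.length = D.length := by simp [hW]
  let node : Fin L.length → Fin W.length := fun i => ⟨nodeIndex W i, nodeIndex_lt W i (hLW ▸ i.2)⟩
  have hnode : ∀ v : Fin W.length, ∀ x ∈ D[v].labels, ∃ i, node i = v ∧ L.getD i 0 = x := by
    intro v x hx
    obtain ⟨i, hi, h1, h2⟩ := exists_nodeIndex W v v.2 x (by simpa [hW] using hx)
    exact ⟨⟨i, hLW ▸ hi⟩, Fin.ext h1, by
      rw [← h2]; exact congrArg (fun l : List ℕ => l.getD i 0) hLW⟩
  have hsurj : Function.Surjective node := fun v => by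
    obtain ⟨x, hx⟩ := List.exists_mem_of_length_pos (D[v]).labels_length_pos
    obtain ⟨i, hi, -⟩ := hnode v x hx
    exact ⟨i, hi⟩
  have : Nonempty (Fin W.length) :=
    ⟨⟨0, by rw [hWL]; exact List.length_pos_iff.2 h0⟩⟩
  have harc : ∀ i j, arc j = arc i ↔ j = i ∨ j = σ i := fun i j => by
    exact Subtype.ext_iff.trans (hs i j)
  have hlinks : ∀ v : Node, ∀ p ∈ v.links, p.1 ∈ v.labels ∧ p.2 ∈ v.labels := by
    rintro (_ | _ | _) p hp <;> simp only [Node.links, List.mem_cons, List.not_mem_nil,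
      or_false] at hp <;> rcases hp with rfl | rfl <;> simp [Node.labels]
  have main := euler_formula σ cw node arc hsne hss harc (fun ⟨l, hl⟩ => by
      rw [List.mem_toFinset] at hl
      obtain ⟨i, hi, rfl⟩ := List.getElem_of_mem hl
      exact ⟨⟨i, hi⟩, Subtype.ext (List.getD_eq_getElem _ _ hi)⟩)
    (fun i j => by
      constructor
      · intro h
        obtain ⟨k, hk⟩ := iterate_clockwiseNext_eq D i j i.2 j.2 (congrArg Fin.val h)
        refine ⟨k, Fin.ext ?_⟩
        rw [← hk]
        simp only [zpow_natCast]
        clear hk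
        induction k with
        | zero => rfl
        | succ k ih => rw [pow_succ', Equiv.Perm.mul_apply, Function.iterate_succ_apply', ← ih]; rfl
      · intro h
        obtain ⟨k, -, rfl⟩ := h.exists_pow_eq'
        clear h
        induction k with
        | zero => rfl
        | succ k ih =>
          rw [ih, pow_succ', Equiv.Perm.mul_apply]
          exact Fin.ext (nodeIndex_clockwiseNext D _).symm) hsurj
    (fun h hh v w => by
      -- The hypothesis on connectedness is about arcs, whereas `h` is a function on nodes. The
      -- condition that `h` takes the value `c` at all ends of an arc depends on its label alone and
      -- passes along links.
      have key : ∀ l m, Relation.EqvGen (fun x y => ∃ v ∈ D, (x, y) ∈ v.links) l m → ∀ c,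
          ((∀ i, L.getD i.1 0 = l → h (node i) = c) ↔
            ∀ i, L.getD i.1 0 = m → h (node i) = c) := by
        intro l m hlm c
        have hloc : ∀ v : Fin W.length, ∀ x ∈ D[v].labels,
            (∀ i, L.getD i.1 0 = x → h (node i) = c) ↔ h v = c := by
          intro v x hx
          obtain ⟨i, rfl, rfl⟩ := hnode v x hx
          refine ⟨fun h => h i rfl, fun hc j hj => ?_⟩
          rcases (hs i j).1 hj with rfl | rfl
          · exact hc
          · rw [← hc]; exact hh i
        induction hlm with
        | rel x y hxy =>
          obtain ⟨u, hu, hxy⟩ := hxy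
          obtain ⟨v, hv, rfl⟩ := List.getElem_of_mem hu
          have := hlinks _ _ hxy
          rw [hloc ⟨v, hWL ▸ hv⟩ x this.1, hloc ⟨v, hWL ▸ hv⟩ y this.2]
        | refl => rfl
        | symm _ _ _ ih => exact ih.symm
        | trans _ _ _ _ _ ih1 ih2 => exact ih1.trans ih2
      obtain ⟨i, rfl⟩ := hsurj v
      obtain ⟨j, rfl⟩ := hsurj w
      refine ((key _ _ (conn _ (mem j) _ (mem i)) (h (node j))).1 (fun k hk => ?_) i rfl)
      rcases (hs j k).1 hk with rfl | rfl
      · rfl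
      · exact hh j)
    (fun g hg => by
      -- `Jordan` wants a function on all labels; those that do not occur get the value zero.
      let g' : ℕ → ZMod 2 := fun l => if hl : l ∈ L.toFinset then g ⟨l, hl⟩ else 0
      have hg' : ∀ i : Fin L.length, g' (L.getD i 0) = g (arc i) := fun i =>
        dif_pos (by simp)
      have heven : ∀ w ∈ W, (w.map g').sum = 0 := by
        intro w hw
        obtain ⟨v, hv, rfl⟩ := List.getElem_of_mem hw
        refine Eq.trans ?_ (hg ⟨v, hv⟩)
        rw [← sum_node g' W v hv, ← hLW, ← Fin.sum_univ_eq_sum_range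
          (fun i => if nodeIndex W i = v then g' (L.getD i 0) else 0)]
        refine Finset.sum_congr rfl fun i _ => ?_
        rw [hg']
        exact if_congr (Fin.ext_iff (a := node i) (b := ⟨v, hv⟩)).symm rfl rfl
      obtain ⟨Q, hQ, hsum⟩ := jordan g' heven
      have hsides : ∀ i : Fin L.length, sideValue g' Q i + sideValue g' Q (s i) =
          g' (L.getD i 0) := by
        intro i
        rw [← hsum _ (hLW ▸ mem i), sum_sideSum, hQ, ← hLW,
          ← Fin.sum_univ_eq_sum_range
            (fun k => if L.getD k 0 = L.getD i 0 then sideValue g' Q k else 0)]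
        have := sum_arc hsne harc (fun i => sideValue g' Q i) i
        rw [← show s i = σ i from rfl] at this
        rw [← this]
        exact Finset.sum_congr rfl fun k _ => if_congr Subtype.ext_iff rfl rfl
      have flip : ∀ a b c : ZMod 2, a + b = c → a + c = b := by decide
      -- `sideValue` belongs to the corner before the half-arc `i`. Adding the value of `g'` gives
      -- the corner after it in counterclockwise order, which lies in the face to the left of `i`,
      -- the one that `faceNext` follows.
      refine ⟨fun i => sideValue g' Q i + g' (L.getD i 0), fun i => ?_, fun i => ?_⟩
      · refine (sideValue_clockwiseNext g' D Q hQ heven _ (σ i).2).trans ?_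
        exact (flip _ _ _ (hsides i)).symm
      · have h1 := flip _ _ _ (hsides i)
        have h2 := hsides (s i)
        rw [hss] at h2
        have h3 := flip _ _ _ h2
        have h4 := hsides i
        change (sideValue g' Q i + g' (L.getD i 0)) +
          (sideValue g' Q (s i) + g' (L.getD (s i) 0)) = g (arc i)
        rw [h1, h3, ← hg', ← h4, add_comm])
  rw [← hface, Fintype.card_fin, Fintype.card_coe] at main
  have hcard : L.length = 2 * L.toFinset.card := by
    rw [← List.sum_toFinset_count_eq_length, Finset.sum_congr rfl fun l hl =>
      twice l (List.mem_toFinset.1 hl), Finset.sum_const, smul_eq_mul, mul_comm]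
  omega

end Code

/-! ### Words -/

theorem zmod_two_add_add_cancel (a b : ZMod 2) : a + b + b = a := by
  revert a b; decide

theorem sideSum_append (g : ℕ → ZMod 2) (l : ℕ) (u v : List ℕ) (q : ZMod 2) :
    sideSum g l (u ++ v) q = sideSum g l u q + sideSum g l v (q + (u.map g).sum) := by
  induction u generalizing q with
  | nil => simp [sideSum]
  | cons m u ih => simp [sideSum, ih, add_assoc]

theorem sideSum_congr {g g' : ℕ → ZMod 2} {w : List ℕ} (h : ∀ m ∈ w, g m = g' m) (l : ℕ)
    (q : ZMod 2) : sideSum g l w q = sideSum g' l w q := by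
  induction w generalizing q with
  | nil => rfl
  | cons m w ih =>
    simp only [List.mem_cons, forall_eq_or_imp] at h
    rw [sideSum, sideSum, ih h.2, h.1]

theorem sideSum_of_notMem (g : ℕ → ZMod 2) {l : ℕ} {w : List ℕ} (h : l ∉ w) (q : ZMod 2) :
    sideSum g l w q = 0 := by
  induction w generalizing q with
  | nil => rfl
  | cons m w ih =>
    simp only [List.mem_cons, not_or] at h
    rw [sideSum, ih h.2, if_neg (Ne.symm h.1), add_zero]

theorem sum_sideSum_congr {g g' : ℕ → ZMod 2} {Q : List (List ℕ × ZMod 2)}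
    (h : ∀ m ∈ (Q.map Prod.fst).flatten, g m = g' m) (l : ℕ) :
    (Q.map fun p => sideSum g l p.1 p.2).sum = (Q.map fun p => sideSum g' l p.1 p.2).sum := by
  congr 1
  refine List.map_congr_left fun p hp => sideSum_congr (fun m hm => h m ?_) _ _
  exact List.mem_flatten.2 ⟨_, List.mem_map_of_mem hp, hm⟩

theorem sum_sideSum_of_notMem (g : ℕ → ZMod 2) {l : ℕ} {Q : List (List ℕ × ZMod 2)}
    (h : l ∉ (Q.map Prod.fst).flatten) : (Q.map fun p => sideSum g l p.1 p.2).sum = 0 := by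
  refine List.sum_eq_zero fun x hx => ?_
  obtain ⟨p, hp, rfl⟩ := List.mem_map.1 hx
  exact sideSum_of_notMem g (fun hm => h (List.mem_flatten.2 ⟨_, List.mem_map_of_mem hp, hm⟩)) _

/-- Serves to carry the corner values along when the nodes are reordered. -/
theorem exists_perm_of_map_perm {α β : Type*} {f : α → β} {W W' : List β} (h : W.Perm W') :
    ∀ Q : List α, Q.map f = W → ∃ Q' : List α, Q.Perm Q' ∧ Q'.map f = W' := by
  induction h with
  | nil => exact fun Q hQ => ⟨Q, .refl _, hQ⟩
  | cons x _ ih =>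
    intro Q hQ
    obtain ⟨p, Q, rfl, rfl, hQ₁⟩ := List.map_eq_cons_iff.1 hQ
    obtain ⟨Q', h1, h2⟩ := ih Q hQ₁
    exact ⟨p :: Q', h1.cons _, by simp [h2]⟩
  | swap x y l =>
    intro Q hQ
    obtain ⟨p, Q, rfl, rfl, hQ₁⟩ := List.map_eq_cons_iff.1 hQ
    obtain ⟨p', Q, rfl, rfl, hQ₂⟩ := List.map_eq_cons_iff.1 hQ₁
    exact ⟨p' :: p :: Q, .swap _ _ _, by simp [hQ₂]⟩
  | trans _ _ ih1 ih2 =>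
    intro Q hQ
    obtain ⟨Q', h1, h2⟩ := ih1 Q hQ
    obtain ⟨Q'', h3, h4⟩ := ih2 Q' h2
    exact ⟨Q'', h1.trans h3, h4⟩

/-! ### Operations on cyclic words that preserve the Jordan property -/

namespace Jordan

theorem perm {W W' : List (List ℕ)} (h : W.Perm W') (hW : Jordan W) : Jordan W' := by
  intro g hg
  obtain ⟨Q, hQ, hs⟩ := hW g fun w hw => hg w (h.mem_iff.1 hw)
  obtain ⟨Q', h1, h2⟩ := exists_perm_of_map_perm h Q hQ
  refine ⟨Q', h2, fun l hl => ?_⟩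
  rw [← (h1.map _).sum_eq]
  exact hs l (h.flatten.mem_iff.2 hl)

theorem nil : Jordan [] := fun _ _ => ⟨[], rfl, by simp⟩

theorem nil_cons {W : List (List ℕ)} (h : Jordan W) : Jordan ([] :: W) := by
  intro g hg
  obtain ⟨Q, rfl, hs⟩ := h g fun w hw => hg w (.tail _ hw)
  exact ⟨([], 0) :: Q, rfl, fun l hl => by simpa [sideSum] using hs l (by simpa using hl)⟩

/-- Reading a word from another place shifts the initial corner value by the sum over `u`; the total
sum is zero, so the values after the turn are consistent. -/
theorem rotate {u v : List ℕ} {W : List (List ℕ)} (h : Jordan ((u ++ v) :: W)) :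
    Jordan ((v ++ u) :: W) := by
  intro g hg
  have hvu := hg _ List.mem_cons_self
  have huv : ((u ++ v).map g).sum = 0 := by
    rw [← hvu]; simp [add_comm]
  obtain ⟨Q, hQ, hs⟩ := h g (by
    intro w hw
    rcases List.mem_cons.1 hw with rfl | hw
    · exact huv
    · exact hg _ (.tail _ hw))
  obtain ⟨⟨w, q⟩, Q, rfl, rfl, rfl⟩ := List.map_eq_cons_iff.1 hQ
  refine ⟨(v ++ u, q + (u.map g).sum) :: Q, rfl, fun l hl => ?_⟩
  rw [← hs l (by simp only [List.flatten_cons, List.mem_append] at hl ⊢; tauto)]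
  simp only [List.map_cons, List.sum_cons, sideSum_append, add_left_inj]
  have : q + (u.map g).sum + (v.map g).sum = q := by
    rw [add_assoc, ← List.sum_append, ← List.map_append, huv, add_zero]
  rw [this, add_comm]

/-- A loop with neighbouring ends does not affect parity, and passing it twice restores the running
value. So the corner values for the larger word can be kept. -/
theorem of_cancel {l : ℕ} {v : List ℕ} {W : List (List ℕ)} (hl : l ∉ v ++ W.flatten)
    (h : Jordan ((l :: l :: v) :: W)) : Jordan (v :: W) := by
  intro g hg
  obtain ⟨Q, hQ, hs⟩ := h g (by
    intro w hw
    rcases List.mem_cons.1 hw with rfl | hw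
    · have := hg v List.mem_cons_self
      simp only [List.map_cons, List.sum_cons, this, add_zero]
      exact CharTwo.add_self_eq_zero (g l)
    · exact hg _ (.tail _ hw))
  obtain ⟨⟨w, q⟩, Q, rfl, rfl, rfl⟩ := List.map_eq_cons_iff.1 hQ
  refine ⟨(v, q) :: Q, rfl, fun m hm => ?_⟩
  have hne : l ≠ m := by rintro rfl; exact hl (by simpa using hm)
  rw [← hs m (by simp only [List.flatten_cons, List.cons_append]; exact .tail _ (.tail _ hm))]
  simp [sideSum, hne, zmod_two_add_add_cancel]

/-- The two half-arcs of the loop have the values `q` and `q + g l`, with sum `g l` whatever `g l`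
is. -/
theorem cancel {l : ℕ} {v : List ℕ} {W : List (List ℕ)} (hl : l ∉ v ++ W.flatten)
    (h : Jordan (v :: W)) : Jordan ((l :: l :: v) :: W) := by
  intro g hg
  obtain ⟨Q, hQ, hs⟩ := h g (by
    intro w hw
    rcases List.mem_cons.1 hw with rfl | hw
    · have := hg (l :: l :: w) List.mem_cons_self
      simp only [List.map_cons, List.sum_cons, ← add_assoc, CharTwo.add_self_eq_zero,
        zero_add] at this
      exact this
    · exact hg _ (.tail _ hw))
  obtain ⟨⟨w, q⟩, Q, rfl, rfl, rfl⟩ := List.map_eq_cons_iff.1 hQ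
  refine ⟨(l :: l :: w, q) :: Q, rfl, fun m hm => ?_⟩
  simp only [List.mem_append, not_or] at hl
  by_cases hne : l = m
  · subst hne
    simp only [List.map_cons, List.sum_cons, sideSum, if_true, sideSum_of_notMem g hl.1,
      sum_sideSum_of_notMem g hl.2, add_zero, ← add_assoc, CharTwo.add_self_eq_zero, zero_add]
  · rw [← hs m (by
      simp only [List.flatten_cons, List.cons_append, List.mem_cons] at hm ⊢
      rcases hm with rfl | rfl | hm <;> first | exact absurd rfl hne | exact hm)]
    simp [sideSum, hne, zmod_two_add_add_cancel]

/-- Parity at the first node determines how `g` extends to the arc `l`, and evenness of `u ++ v`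
makes the same value right at the second. The boundary condition at `l` then says that the corners
of the two nodes fit together on both sides of `l`. -/
theorem of_contract {l : ℕ} {u v : List ℕ} {W : List (List ℕ)} (hl : l ∉ u ++ v ++ W.flatten)
    (h : Jordan ((l :: u) :: (l :: v) :: W)) : Jordan ((u ++ v) :: W) := by
  intro g hg
  simp only [List.mem_append, not_or] at hl
  obtain ⟨⟨hlu, hlv⟩, hlW⟩ := hl
  have huv := hg _ List.mem_cons_self
  rw [List.map_append, List.sum_append] at huv
  have huv' : (v.map g).sum = (u.map g).sum := (CharTwo.add_eq_zero.1 huv).symm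
  let g' := Function.update g l (u.map g).sum
  have hg' : ∀ m, l ≠ m → g m = g' m := fun m hm => (Function.update_of_ne hm.symm _ _).symm
  have hgl : g' l = (u.map g).sum := Function.update_self ..
  have hu : ∀ m ∈ u, g m = g' m := fun m hm => hg' m (by rintro rfl; exact hlu hm)
  have hv : ∀ m ∈ v, g m = g' m := fun m hm => hg' m (by rintro rfl; exact hlv hm)
  have hW : ∀ m ∈ W.flatten, g m = g' m := fun m hm => hg' m (by rintro rfl; exact hlW hm)
  obtain ⟨Q, hQ, hs⟩ := h g' (by
    intro w hw
    rcases List.mem_cons.1 hw with rfl | hw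
    · rw [List.map_cons, List.sum_cons, hgl, ← List.map_congr_left hu]
      exact CharTwo.add_self_eq_zero _
    rcases List.mem_cons.1 hw with rfl | hw
    · rw [List.map_cons, List.sum_cons, hgl, ← List.map_congr_left hv, huv']
      exact CharTwo.add_self_eq_zero _
    · rw [← List.map_congr_left fun m hm => hW m (List.mem_flatten.2 ⟨w, hw, hm⟩)]
      exact hg _ (.tail _ hw))
  obtain ⟨⟨w, q⟩, Q, rfl, rfl, hQ₁⟩ := List.map_eq_cons_iff.1 hQ
  obtain ⟨⟨w', q'⟩, Q, rfl, rfl, rfl⟩ := List.map_eq_cons_iff.1 hQ₁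
  have hq := hs l (by simp)
  simp only [List.map_cons, List.sum_cons, sideSum, if_true, sideSum_of_notMem _ hlu,
    sideSum_of_notMem _ hlv, sum_sideSum_of_notMem _ hlW, add_zero] at hq
  -- The first corner of the merged node is the one that follows `l` at the first node.
  refine ⟨(u ++ v, q + g' l) :: Q, rfl, fun m hm => ?_⟩
  have hne : l ≠ m := by
    rintro rfl
    simp only [List.flatten_cons, List.mem_append] at hm
    tauto
  rw [hg' m hne, ← hs m (by
    simp only [List.flatten_cons, List.mem_append, List.mem_cons] at hm ⊢; tauto)]
  simp only [List.map_cons, List.sum_cons, sideSum, hne, if_false, zero_add, sideSum_append,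
    sideSum_congr hu, sideSum_congr hv, sum_sideSum_congr hW]
  have : q + g' l + (u.map g).sum = q' + g' l := by
    rw [← hgl, ← hq]
    generalize (q : ZMod 2) = a
    generalize (q' : ZMod 2) = b
    revert a b; decide
  rw [this, add_assoc]

/-- Parity gives `g l` as the sum over `u` and as the sum over `v`, so the merged word is even. The
corners on the two sides of `l` receive values that differ by `g l`. -/
theorem contract {l : ℕ} {u v : List ℕ} {W : List (List ℕ)} (hl : l ∉ u ++ v ++ W.flatten)
    (h : Jordan ((u ++ v) :: W)) : Jordan ((l :: u) :: (l :: v) :: W) := by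
  intro g hg
  simp only [List.mem_append, not_or] at hl
  obtain ⟨⟨hlu, hlv⟩, hlW⟩ := hl
  have hu : g l = (u.map g).sum := CharTwo.add_eq_zero.1 (hg (l :: u) List.mem_cons_self)
  have hv : g l = (v.map g).sum :=
    CharTwo.add_eq_zero.1 (hg (l :: v) (.tail _ List.mem_cons_self))
  obtain ⟨Q, hQ, hs⟩ := h g (by
    intro w hw
    rcases List.mem_cons.1 hw with rfl | hw
    · rw [List.map_append, List.sum_append]
      refine CharTwo.add_eq_zero.2 (hu.symm.trans hv)
    · exact hg _ (.tail _ (.tail _ hw)))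
  obtain ⟨⟨w, q⟩, Q, rfl, rfl, rfl⟩ := List.map_eq_cons_iff.1 hQ
  refine ⟨(l :: u, q + g l) :: (l :: v, q) :: Q, rfl, fun m hm => ?_⟩
  by_cases hne : l = m
  · subst hne
    simp only [List.map_cons, List.sum_cons, sideSum, if_true, sideSum_of_notMem _ hlu,
      sideSum_of_notMem _ hlv, sum_sideSum_of_notMem _ hlW, add_zero]
    rw [add_right_comm, CharTwo.add_self_eq_zero, zero_add]
  · rw [← hs m (by
      simp only [List.flatten_cons, List.mem_append, List.mem_cons] at hm ⊢
      have := Ne.symm hne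
      tauto)]
    simp only [List.map_cons, List.sum_cons, sideSum, hne, if_false, zero_add, sideSum_append,
      zmod_two_add_add_cancel, hu]
    rw [add_assoc]

/-- If both parts are even, so is the whole, and both parts start with the same corner value because
the sum over `u` vanishes. The converse fails: `[1, 2]` and `[1, 2]` would merge into the word `[1,
2, 1, 2]` of a torus. -/
theorem split {u v : List ℕ} {W : List (List ℕ)} (h : Jordan ((u ++ v) :: W)) :
    Jordan (u :: v :: W) := by
  intro g hg
  have hu := hg u List.mem_cons_self
  have hv := hg v (.tail _ List.mem_cons_self)
  obtain ⟨Q, hQ, hs⟩ := h g (by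
    intro w hw
    rcases List.mem_cons.1 hw with rfl | hw
    · rw [List.map_append, List.sum_append, hu, hv, add_zero]
    · exact hg _ (.tail _ (.tail _ hw)))
  obtain ⟨⟨w, q⟩, Q, rfl, rfl, rfl⟩ := List.map_eq_cons_iff.1 hQ
  refine ⟨(u, q) :: (v, q) :: Q, rfl, fun m hm => ?_⟩
  rw [← hs m (by simpa [List.append_assoc] using hm)]
  simp [sideSum_append, hu, add_assoc]

end Jordan

/-! ### Reidemeister moves -/

theorem Jordan.rotate₂ {u v w : List ℕ} {W : List (List ℕ)} (h : Jordan (w :: (u ++ v) :: W)) :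
    Jordan (w :: (v ++ u) :: W) :=
  .perm (.swap _ _ _) (.rotate (.perm (.swap _ _ _) h))

/-- The strands and the vertices respect a partition of the arcs into two classes. -/
def Node.Respects (p : ℕ → Prop) : Node → Prop
  | X a b c d => (p a ↔ p c) ∧ (p b ↔ p d)
  | V a b c => (p a ↔ p b) ∧ (p b ↔ p c)
  | P a b => p a ↔ p b

theorem Node.respects_iff (p : ℕ → Prop) (v : Node) :
    v.Respects p ↔ ∀ e ∈ v.links, (p e.1 ↔ p e.2) := by
  cases v <;> simp [Respects, links]

theorem Node.respects_congr {p q : ℕ → Prop} {v : Node} (h : ∀ l ∈ v.labels, (p l ↔ q l)) :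
    v.Respects p ↔ v.Respects q := by
  cases v <;> simp only [labels, List.mem_cons, List.not_mem_nil, or_false, forall_eq_or_imp,
    forall_eq] at h <;> simp [Respects, h]

theorem Node.coloured_congr {p q : ℕ → Fin 3} {v : Node} (h : ∀ l ∈ v.labels, p l = q l) :
    v.Coloured p ↔ v.Coloured q := by
  cases v <;> simp only [labels, List.mem_cons, List.not_mem_nil, or_false, forall_eq_or_imp,
    forall_eq] at h <;> simp [Coloured, h]

/-- A variant of `IsThetaDiagram` that does not depend on the order of the half-arcs. -/
structure Theta (D : Diagram) : Prop where
  twice : ∀ l ∈ labels D, (labels D).count l = 2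
  vertices : D.countP Node.isVertex = 2
  connected : ∀ p : ℕ → Prop, (∀ v ∈ D, v.Respects p) → ∀ l ∈ labels D, ∀ m ∈ labels D, p l → p m
  coloured : ∃ c : ℕ → Fin 3, ∀ v ∈ D, v.Coloured c
  jordan : Jordan (D.map Node.labels)

theorem Theta.isThetaDiagram {D : Diagram} (h : Theta D) : IsThetaDiagram D := by
  have conn : ∀ l ∈ labels D, ∀ m ∈ labels D,
      Relation.EqvGen (fun x y => ∃ v ∈ D, (x, y) ∈ v.links) l m := by
    intro l hl m hm
    -- The class of arcs connected with `l` is respected by every node and contains `l`, so it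
    -- contains all arcs.
    refine h.connected (Relation.EqvGen _ l) (fun v hv => (v.respects_iff _).2 fun e he => ?_)
      l hl m hm (.refl _)
    have : Relation.EqvGen (fun x y => ∃ v ∈ D, (x, y) ∈ v.links) e.1 e.2 := .rel _ _ ⟨v, hv, he⟩
    exact ⟨fun h => h.trans _ _ _ this, fun h => h.trans _ _ _ (this.symm _ _)⟩
  refine ⟨h.twice, h.vertices, conn, h.coloured, planar_of_jordan D ?_ h.twice conn h.jordan⟩
  rintro rfl
  simpa using h.vertices

/-- Both occurrences of an inner arc are used up by the local picture. From this come all statements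
that inner labels differ from the others. -/
theorem Theta.fresh {L C : Diagram} (h : Theta (L ++ C)) {l : ℕ} {A : List ℕ}
    (hA : (labels L).Perm (l :: l :: A)) : l ∉ A ∧ l ∉ labels C := by
  have hp : (labels (L ++ C)).Perm (l :: l :: (A ++ labels C)) := by
    rw [labels, List.flatMap_append]
    exact hA.append_right _
  have h2 := h.twice l (hp.mem_iff.2 List.mem_cons_self)
  rw [hp.count_eq] at h2
  simpa [List.count_eq_zero] using h2

/-- The invariants in `Theta` are preserved if a local picture with the inner arcs among `I` is
replaced by another one. -/
theorem Theta.replace {L R C : Diagram} (I : List ℕ) (h : Theta (L ++ C))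
    (fresh : ∀ l ∈ I, l ∉ labels C)
    (count : ∀ l, (labels R).count l = (labels L).count l ∨
      l ∈ I ∧ ((labels R).count l = 0 ∨ (labels R).count l = 2))
    (vertices : R.countP Node.isVertex = L.countP Node.isVertex)
    (connected : ∀ q : ℕ → Prop, (∀ v ∈ R, v.Respects q) →
      (∃ p : ℕ → Prop, (∀ l, l ∉ I → (p l ↔ q l)) ∧ ∀ v ∈ L, v.Respects p) ∧
      ∀ l ∈ I, l ∈ labels R → ∃ m ∈ labels L, m ∉ I ∧ (q l ↔ q m))
    (coloured : ∀ c : ℕ → Fin 3, (∀ v ∈ L, v.Coloured c) →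
      ∃ d : ℕ → Fin 3, (∀ l, l ∉ I → d l = c l) ∧ ∀ v ∈ R, v.Coloured d)
    (jordan : Jordan (L.map Node.labels ++ C.map Node.labels) →
      Jordan (R.map Node.labels ++ C.map Node.labels)) : Theta (R ++ C) := by
  have lab : ∀ A : Diagram, labels (A ++ C) = labels A ++ labels C := fun A =>
    List.flatMap_append
  have notI : ∀ v ∈ C, ∀ l ∈ v.labels, l ∉ I := fun v hv l hl hI =>
    fresh l hI (List.mem_flatMap.2 ⟨v, hv, hl⟩)
  have mem : ∀ l ∈ labels R, l ∉ I → l ∈ labels L := by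
    intro l hl hI
    rcases count l with h1 | h1
    · exact List.count_pos_iff.1 (h1 ▸ List.count_pos_iff.2 hl)
    · exact absurd h1.1 hI
  refine ⟨fun l hl => ?_, ?_, fun q hq => ?_, ?_, ?_⟩
  · have h1 := h.twice l
    rw [lab, List.mem_append] at hl
    rw [lab, List.mem_append, List.count_append] at h1
    rw [lab, List.count_append]
    rcases count l with h2 | ⟨hI, h2⟩
    · rw [h2]
      refine h1 (hl.imp_left fun hl => ?_)
      exact List.count_pos_iff.1 (h2 ▸ List.count_pos_iff.2 hl)
    · have h3 := List.count_eq_zero.2 (fresh l hI)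
      have h4 := List.count_pos_iff.2 (hl.resolve_right (fresh l hI))
      omega
  · rw [List.countP_append, vertices, ← List.countP_append, h.vertices]
  · simp only [List.forall_mem_append] at hq
    obtain ⟨⟨p, hp, hpL⟩, hI⟩ := connected q hq.1
    -- Inner arcs may change their class when the picture is replaced, so they are compared through
    -- outer arcs, on which `p` and `q` agree.
    have key : ∀ l ∈ labels (R ++ C), ∃ m ∈ labels (L ++ C), (q l ↔ p m) := by
      intro l hl
      rw [lab, List.mem_append] at hl
      simp only [lab, List.mem_append]
      by_cases hlI : l ∈ I
      · obtain ⟨m, hm, hmI, e⟩ := hI l hlI (hl.resolve_right (fresh l hlI))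
        exact ⟨m, .inl hm, e.trans (hp m hmI).symm⟩
      · exact ⟨l, hl.imp_left fun h => mem l h hlI, (hp l hlI).symm⟩
    intro l hl m hm
    obtain ⟨l', hl', e⟩ := key l hl
    obtain ⟨m', hm', e'⟩ := key m hm
    rw [e, e']
    refine h.connected p (List.forall_mem_append.2 ⟨hpL, fun v hv => ?_⟩) l' hl' m' hm'
    exact (Node.respects_congr fun l hl => hp l (notI v hv l hl)).2 (hq.2 v hv)
  · obtain ⟨c, hc⟩ := h.coloured
    rw [List.forall_mem_append] at hc
    obtain ⟨d, hd, hdR⟩ := coloured c hc.1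
    refine ⟨d, List.forall_mem_append.2 ⟨hdR, fun v hv => ?_⟩⟩
    exact (Node.coloured_congr fun l hl => hd l (notI v hv l hl)).2 (hc.2 v hv)
  · rw [List.map_append]
    exact jordan (List.map_append (f := Node.labels) ▸ h.jordan)

/-! ### Invariance under the local moves -/

open Node

/-- Either triangle shrinks to a single node with the cyclic word `b m t b' m' t'`: two sides are
contracted, and the third becomes a loop and is cancelled. The labels of the sides are used again:
`x`, `y`, `z` lie on the bottom, middle and top strand before and after, which explains the classes
and colours chosen for them. -/
theorem Theta.III {C : Diagram} {b b' m m' t t' x y z : ℕ}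
    (h : Theta ([X b m x y, X x t b' z, X y z m' t'] ++ C)) :
    Theta ([X b z x t', X x y b' m', X m t y z] ++ C) := by
  obtain ⟨fx, hx⟩ := h.fresh (l := x) (A := [b, m, y, t, b', z, y, z, m', t'])
    (List.perm_iff_count.2 fun k => by simp [labels, Node.labels, List.count_cons]; omega)
  obtain ⟨fy, hy⟩ := h.fresh (l := y) (A := [b, m, x, x, t, b', z, z, m', t'])
    (List.perm_iff_count.2 fun k => by simp [labels, Node.labels, List.count_cons]; omega)
  obtain ⟨fz, hz⟩ := h.fresh (l := z) (A := [b, m, x, y, x, t, b', y, m', t'])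
    (List.perm_iff_count.2 fun k => by simp [labels, Node.labels, List.count_cons]; omega)
  simp only [List.mem_cons, List.not_mem_nil, or_false, not_or, ← ne_eq] at fx fy fz
  refine h.replace [x, y, z] (by simp [hx, hy, hz]) (fun k => ?_) rfl (fun q hq => ⟨?_, ?_⟩)
    (fun κ hκ => ?_) fun jo => ?_
  · left; simp [labels, Node.labels, List.count_cons]; omega
  · refine ⟨fun l => if l = x then q b else if l = y then q m else if l = z then q t else q l, ?_,
      ?_⟩
    · simp +contextual
    · simp only [List.forall_mem_cons, Respects] at hq
      simp [Respects, Ne.symm, *]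
  · simp only [List.forall_mem_cons, Respects] at hq
    simp [labels, Node.labels]
    grind
  · refine ⟨fun l => if l = x then κ b else if l = y then κ m else if l = z then κ t else κ l, ?_,
      ?_⟩
    · simp +contextual
    · simp only [List.forall_mem_cons, Coloured] at hκ
      simp [Coloured, Ne.symm, *]
  · simp only [List.map_cons, Node.labels, List.map_nil, List.cons_append, List.nil_append] at jo ⊢
    rw [labels_eq] at hx hy hz
    have := (jo.rotate (u := [b, m]) (v := [x, y])).of_contract (by simp; grind)
    have := this.of_contract (l := y) (u := [b, m, t, b', z]) (by simp; grind)
    have := (this.rotate (u := [b, m, t, b']) (v := [z, z, m', t'])).of_cancel (by simp; grind)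
    -- The new triangle is shrunk in the same way, read backwards.
    refine .rotate (u := [x, t']) (v := [b, z]) (.contract (by simp; grind) ?_)
    refine .rotate (u := [y, b', m']) (v := [t', b, z]) (.rotate₂ (u := [y, z]) (v := [m, t]) ?_)
    refine .contract (by simp; grind) (.rotate (u := [z, z, m, t]) (v := [b', m', t', b])
      (.cancel (by simp; grind) ?_))
    exact this.rotate (u := [m', t', b]) (v := [m, t, b'])

theorem Theta.III' {C : Diagram} {b b' m m' t t' x y z : ℕ}
    (h : Theta ([X b y x m, X x z b' t, X y t' m' z] ++ C)) :
    Theta ([X b t' x z, X x m' b' y, X m z y t] ++ C) := by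
  obtain ⟨fx, hx⟩ := h.fresh (l := x) (A := [b, y, m, z, b', t, y, t', m', z])
    (List.perm_iff_count.2 fun k => by simp [labels, Node.labels, List.count_cons]; omega)
  obtain ⟨fy, hy⟩ := h.fresh (l := y) (A := [b, x, m, x, z, b', t, t', m', z])
    (List.perm_iff_count.2 fun k => by simp [labels, Node.labels, List.count_cons]; omega)
  obtain ⟨fz, hz⟩ := h.fresh (l := z) (A := [b, y, x, m, x, b', t, y, t', m'])
    (List.perm_iff_count.2 fun k => by simp [labels, Node.labels, List.count_cons]; omega)
  simp only [List.mem_cons, List.not_mem_nil, or_false, not_or, ← ne_eq] at fx fy fz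
  refine h.replace [x, y, z] (by simp [hx, hy, hz]) (fun k => ?_) rfl (fun q hq => ⟨?_, ?_⟩)
    (fun κ hκ => ?_) fun jo => ?_
  · left; simp [labels, Node.labels, List.count_cons]; omega
  · refine ⟨fun l => if l = x then q b else if l = y then q m else if l = z then q t else q l, ?_,
      ?_⟩
    · simp +contextual
    · simp only [List.forall_mem_cons, Respects] at hq
      simp [Respects, Ne.symm, *]
  · simp only [List.forall_mem_cons, Respects] at hq
    simp [labels, Node.labels]
    grind
  · refine ⟨fun l => if l = x then κ b else if l = y then κ m else if l = z then κ t else κ l, ?_,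
      ?_⟩
    · simp +contextual
    · simp only [List.forall_mem_cons, Coloured] at hκ
      simp [Coloured, Ne.symm, *]
      grind
  · simp only [List.map_cons, Node.labels, List.map_nil, List.cons_append, List.nil_append] at jo ⊢
    rw [labels_eq] at hx hy hz
    have := (jo.rotate (u := [b, y]) (v := [x, m])).of_contract (by simp; grind)
    have := (this.rotate (u := [m, b]) (v := [y, z, b', t])).of_contract (u := [z, b', t, m, b])
        (by simp; grind)
    have := (this.rotate (u := [z, b', t, m, b, t', m']) (v := [z])).of_cancel (by simp; grind)
    refine .rotate (u := [x, z]) (v := [b, t']) (.contract (by simp; grind) ?_)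
    refine .rotate (u := [y]) (v := [z, b, t', m', b']) (.rotate₂ (u := [y, t]) (v := [m, z]) ?_)
    refine .contract (by simp; grind) ?_
    refine .rotate (u := [z]) (v := [z, b, t', m', b', t, m]) (.cancel (by simp; grind) ?_)
    exact this.rotate (u := [b', t, m]) (v := [b, t', m'])

/-- The triangle at the vertex and the picture after the move both contract to the cyclic word `b c
s a s'`. The label `y` is used again for an arc of another edge: it lies on the edge of `b` before
and on that of `a` afterwards, hence `q b` in the partition and `κ a` in the colouring. -/
theorem Theta.IVover_symm {C : Diagram} {a b c s s' y z w : ℕ}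
    (h : Theta ([V a y z, X y s' b w, X z w c s] ++ C)) :
    Theta ([V y b c, X y s a s'] ++ C) := by
  obtain ⟨fy, hy⟩ := h.fresh (l := y) (A := [a, z, s', b, w, z, w, c, s])
    (List.perm_iff_count.2 fun k => by simp [labels, Node.labels, List.count_cons]; omega)
  obtain ⟨fz, hz⟩ := h.fresh (l := z) (A := [a, y, y, s', b, w, w, c, s])
    (List.perm_iff_count.2 fun k => by simp [labels, Node.labels, List.count_cons]; omega)
  obtain ⟨fw, hw⟩ := h.fresh (l := w) (A := [a, y, z, y, s', b, z, c, s])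
    (List.perm_iff_count.2 fun k => by simp [labels, Node.labels, List.count_cons]; omega)
  simp only [List.mem_cons, List.not_mem_nil, or_false, not_or, ← ne_eq] at fy fz fw
  refine h.replace [y, z, w] (by simp [hy, hz, hw]) (fun k => ?_) rfl (fun q hq => ⟨?_, ?_⟩)
    (fun κ hκ => ?_) fun jo => ?_
  · simp only [labels, Node.labels, List.flatMap_cons, List.flatMap_nil, List.cons_append,
      List.nil_append, List.append_nil, List.count_cons, List.count_nil, List.mem_cons, beq_iff_eq]
    grind
  · refine ⟨fun l => if l = y then q b else if l = z then q c else if l = w then q s else q l, ?_,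
      ?_⟩
    · simp +contextual
    · simp only [List.forall_mem_cons, Respects] at hq
      simp [Respects, Ne.symm, *]
      grind
  · simp only [List.forall_mem_cons, Respects] at hq
    simp [labels, Node.labels]
    grind
  · refine ⟨fun l => if l = y then κ a else κ l, ?_, ?_⟩
    · simp +contextual
    · simp only [List.forall_mem_cons, Coloured] at hκ
      simp [Coloured, Ne.symm, *]
      grind
  · simp only [List.map_cons, Node.labels, List.map_nil, List.cons_append, List.nil_append] at jo ⊢
    rw [labels_eq] at hy hz hw
    have := (jo.rotate (u := [a]) (v := [y, z])).of_contract (by simp; grind)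
    have := this.of_contract (l := z) (u := [a, s', b, w]) (by simp; grind)
    have := (this.rotate (u := [a, s', b]) (v := [w, w, c, s])).of_cancel (by simp; grind)
    exact .contract (by simp; grind) (this.rotate (u := [c, s, a, s']) (v := [b]))

theorem Theta.IVbehind_symm {C : Diagram} {a b c s s' y z w : ℕ}
    (h : Theta ([V a y z, X s' b w y, X w c s z] ++ C)) :
    Theta ([V y b c, X s a s' y] ++ C) := by
  obtain ⟨fy, hy⟩ := h.fresh (l := y) (A := [a, z, s', b, w, w, c, s, z])
    (List.perm_iff_count.2 fun k => by simp [labels, Node.labels, List.count_cons]; omega)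
  obtain ⟨fz, hz⟩ := h.fresh (l := z) (A := [a, y, s', b, w, y, w, c, s])
    (List.perm_iff_count.2 fun k => by simp [labels, Node.labels, List.count_cons]; omega)
  obtain ⟨fw, hw⟩ := h.fresh (l := w) (A := [a, y, z, s', b, y, c, s, z])
    (List.perm_iff_count.2 fun k => by simp [labels, Node.labels, List.count_cons]; omega)
  simp only [List.mem_cons, List.not_mem_nil, or_false, not_or, ← ne_eq] at fy fz fw
  refine h.replace [y, z, w] (by simp [hy, hz, hw]) (fun k => ?_) rfl (fun q hq => ⟨?_, ?_⟩)
    (fun κ hκ => ?_) fun jo => ?_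
  · simp only [labels, Node.labels, List.flatMap_cons, List.flatMap_nil, List.cons_append,
      List.nil_append, List.append_nil, List.count_cons, List.count_nil, List.mem_cons, beq_iff_eq]
    grind
  · refine ⟨fun l => if l = y then q b else if l = z then q c else if l = w then q s else q l, ?_,
      ?_⟩
    · simp +contextual
    · simp only [List.forall_mem_cons, Respects] at hq
      simp [Respects, Ne.symm, *]
  · simp only [List.forall_mem_cons, Respects] at hq
    simp [labels, Node.labels]
    grind
  · refine ⟨fun l => if l = y then κ a else κ l, ?_, ?_⟩
    · simp +contextual
    · simp only [List.forall_mem_cons, Coloured] at hκ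
      simp [Coloured, Ne.symm, *]
  · simp only [List.map_cons, Node.labels, List.map_nil, List.cons_append, List.nil_append] at jo ⊢
    rw [labels_eq] at hy hz hw
    have := (jo.rotate (u := [a]) (v := [y, z])).rotate₂ (u := [s', b, w]) (v := [y])
    have := this.of_contract (by simp; grind)
    have := this.rotate₂ (u := [w, c, s]) (v := [z])
    have := this.of_contract (l := z) (u := [a, s', b, w]) (by simp; grind)
    have := (this.rotate (u := [a, s', b]) (v := [w, w, c, s])).of_cancel (by simp; grind)
    refine .rotate₂ (u := [y]) (v := [s, a, s']) (.contract (by simp; grind) ?_)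
    exact this.rotate (u := [c, s, a, s']) (v := [b])

/-- Move IV is the only one that the recorded sequences use to add a crossing. It creates the arcs
`z` and `w`, so their freshness has to be assumed. -/
theorem Theta.IVover {C : Diagram} {a b c s s' x z w : ℕ}
    (fz : z ∉ [x, b, c, s, a, s', w]) (hz : z ∉ labels C)
    (fw : w ∉ [x, b, c, s, a, s', z]) (hw : w ∉ labels C)
    (h : Theta ([V x b c, X x s a s'] ++ C)) :
    Theta ([V a x z, X x s' b w, X z w c s] ++ C) := by
  obtain ⟨fx, hx⟩ := h.fresh (l := x) (A := [b, c, s, a, s'])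
    (List.perm_iff_count.2 fun k => by simp [labels, Node.labels, List.count_cons]; omega)
  simp only [List.mem_cons, List.not_mem_nil, or_false, not_or, ← ne_eq] at fx fz fw
  refine h.replace [x, z, w] (by simp [hx, hz, hw]) (fun k => ?_) rfl (fun q hq => ⟨?_, ?_⟩)
    (fun κ hκ => ?_) fun jo => ?_
  · simp only [labels, Node.labels, List.flatMap_cons, List.flatMap_nil, List.cons_append,
      List.nil_append, List.append_nil, List.count_cons, List.count_nil, List.mem_cons, beq_iff_eq]
    grind
  · refine ⟨fun l => if l = x then q a else q l, ?_, ?_⟩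
    · simp +contextual
    · simp only [List.forall_mem_cons, Respects] at hq
      simp [Respects, Ne.symm, *]
      grind
  · simp only [List.forall_mem_cons, Respects] at hq
    simp [labels, Node.labels]
    grind
  · refine ⟨fun l => if l = x then κ b else if l = z then κ c else if l = w then κ s else κ l, ?_,
      ?_⟩
    · simp +contextual
    · simp only [List.forall_mem_cons, Coloured] at hκ
      simp [Coloured, Ne.symm, *]
      grind
  · simp only [List.map_cons, Node.labels, List.map_nil, List.cons_append, List.nil_append] at jo ⊢
    rw [labels_eq] at hx hz hw
    have := jo.of_contract (u := [b, c]) (by simp; grind)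
    refine .rotate (u := [x, z]) (v := [a]) (.contract (by simp; grind) ?_)
    refine .contract (u := [a, s', b, w]) (by simp; grind) ?_
    refine .rotate (u := [w, w, c, s]) (v := [a, s', b]) (.cancel (by simp; grind) ?_)
    exact this.rotate (u := [b]) (v := [c, s, a, s'])

theorem Theta.IVbehind {C : Diagram} {a b c s s' x z w : ℕ}
    (fz : z ∉ [x, b, c, s, a, s', w]) (hz : z ∉ labels C)
    (fw : w ∉ [x, b, c, s, a, s', z]) (hw : w ∉ labels C)
    (h : Theta ([V x b c, X s a s' x] ++ C)) :
    Theta ([V a x z, X s' b w x, X w c s z] ++ C) := by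
  obtain ⟨fx, hx⟩ := h.fresh (l := x) (A := [b, c, s, a, s'])
    (List.perm_iff_count.2 fun k => by simp [labels, Node.labels, List.count_cons]; omega)
  simp only [List.mem_cons, List.not_mem_nil, or_false, not_or, ← ne_eq] at fx fz fw
  refine h.replace [x, z, w] (by simp [hx, hz, hw]) (fun k => ?_) rfl (fun q hq => ⟨?_, ?_⟩)
    (fun κ hκ => ?_) fun jo => ?_
  · simp only [labels, Node.labels, List.flatMap_cons, List.flatMap_nil, List.cons_append,
      List.nil_append, List.append_nil, List.count_cons, List.count_nil, List.mem_cons, beq_iff_eq]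
    grind
  · refine ⟨fun l => if l = x then q a else q l, ?_, ?_⟩
    · simp +contextual
    · simp only [List.forall_mem_cons, Respects] at hq
      simp [Respects, Ne.symm, *]
  · simp only [List.forall_mem_cons, Respects] at hq
    simp [labels, Node.labels]
    grind
  · refine ⟨fun l => if l = x then κ b else if l = z then κ c else if l = w then κ s else κ l, ?_,
      ?_⟩
    · simp +contextual
    · simp only [List.forall_mem_cons, Coloured] at hκ
      simp [Coloured, Ne.symm, *]
  · simp only [List.map_cons, Node.labels, List.map_nil, List.cons_append, List.nil_append] at jo ⊢
    rw [labels_eq] at hx hz hw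
    have := (jo.rotate₂ (u := [s, a, s']) (v := [x])).of_contract (u := [b, c]) (by simp; grind)
    refine .rotate (u := [x, z]) (v := [a]) (.rotate₂ (u := [x]) (v := [s', b, w]) ?_)
    refine .contract (by simp; grind) (.rotate₂ (u := [z]) (v := [w, c, s]) ?_)
    refine .contract (u := [a, s', b, w]) (by simp; grind) ?_
    refine .rotate (u := [w, w, c, s]) (v := [a, s', b]) (.cancel (by simp; grind) ?_)
    exact this.rotate (u := [b]) (v := [c, s, a, s'])

/-- The arc `y` continues to `b` and `x` to `c`. Contracting `y` leaves `x` as a loop that cancels,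
and the word `a b c` of the plain vertex remains. -/
theorem Theta.V_symm {C : Diagram} {a b c x y : ℕ}
    (h : Theta ([V a x y, X y x b c] ++ C)) :
    Theta ([V a b c] ++ C) := by
  obtain ⟨fx, hx⟩ := h.fresh (l := x) (A := [a, y, y, b, c])
    (List.perm_iff_count.2 fun k => by simp [labels, Node.labels, List.count_cons]; omega)
  obtain ⟨fy, hy⟩ := h.fresh (l := y) (A := [a, x, x, b, c])
    (List.perm_iff_count.2 fun k => by simp [labels, Node.labels, List.count_cons]; omega)
  simp only [List.mem_cons, List.not_mem_nil, or_false, not_or, ← ne_eq] at fx fy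
  refine h.replace [x, y] (by simp [hx, hy]) (fun k => ?_) rfl (fun q hq => ⟨?_, ?_⟩)
    (fun κ hκ => ?_) fun jo => ?_
  · simp only [labels, Node.labels, List.flatMap_cons, List.flatMap_nil, List.cons_append,
      List.nil_append, List.append_nil, List.count_cons, List.count_nil, List.mem_cons, beq_iff_eq]
    grind
  · refine ⟨fun l => if l = x then q c else if l = y then q b else q l, ?_, ?_⟩
    · simp +contextual
    · simp only [List.forall_mem_cons, Respects] at hq
      simp [Respects, Ne.symm, *]
  · simp only [List.forall_mem_cons, Respects] at hq
    simp [labels, Node.labels]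
    grind
  · refine ⟨fun l => κ l, ?_, ?_⟩
    · simp +contextual
    · simp only [List.forall_mem_cons, Coloured] at hκ
      simp [Coloured, *]
      grind
  · simp only [List.map_cons, Node.labels, List.map_nil, List.cons_append, List.nil_append] at jo ⊢
    rw [labels_eq] at hx hy
    have := (jo.rotate (u := [a, x]) (v := [y])).of_contract (by simp; grind)
    have := (this.rotate (u := [a]) (v := [x, x, b, c])).of_cancel (by simp; grind)
    exact this.rotate (u := [b, c]) (v := [a])

theorem Theta.V'_symm {C : Diagram} {a b c x y : ℕ}
    (h : Theta ([V a x y, X x b c y] ++ C)) :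
    Theta ([V a b c] ++ C) := by
  obtain ⟨fx, hx⟩ := h.fresh (l := x) (A := [a, y, b, c, y])
    (List.perm_iff_count.2 fun k => by simp [labels, Node.labels, List.count_cons]; omega)
  obtain ⟨fy, hy⟩ := h.fresh (l := y) (A := [a, x, x, b, c])
    (List.perm_iff_count.2 fun k => by simp [labels, Node.labels, List.count_cons]; omega)
  simp only [List.mem_cons, List.not_mem_nil, or_false, not_or, ← ne_eq] at fx fy
  refine h.replace [x, y] (by simp [hx, hy]) (fun k => ?_) rfl (fun q hq => ⟨?_, ?_⟩)
    (fun κ hκ => ?_) fun jo => ?_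
  · simp only [labels, Node.labels, List.flatMap_cons, List.flatMap_nil, List.cons_append,
      List.nil_append, List.append_nil, List.count_cons, List.count_nil, List.mem_cons, beq_iff_eq]
    grind
  · refine ⟨fun l => if l = x then q c else if l = y then q b else q l, ?_, ?_⟩
    · simp +contextual
    · simp only [List.forall_mem_cons, Respects] at hq
      simp [Respects, Ne.symm, *]
  · simp only [List.forall_mem_cons, Respects] at hq
    simp [labels, Node.labels]
    grind
  · refine ⟨fun l => κ l, ?_, ?_⟩
    · simp +contextual
    · simp only [List.forall_mem_cons, Coloured] at hκ
      simp [Coloured, Ne.symm, *]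
      grind
  · simp only [List.map_cons, Node.labels, List.map_nil, List.cons_append, List.nil_append] at jo ⊢
    rw [labels_eq] at hx hy
    have := (jo.rotate (u := [a, x]) (v := [y])).rotate₂ (u := [x, b, c]) (v := [y])
    have := this.of_contract (by simp; grind)
    have := (this.rotate (u := [a]) (v := [x, x, b, c])).of_cancel (by simp; grind)
    exact this.rotate (u := [b, c]) (v := [a])

/-- The kink is a loop with neighbouring ends. A marked point stays behind, so that the outer arcs
keep their labels and the replacement is local; fusing the two arcs is a separate step. -/
theorem Theta.I {C : Diagram} {a b x : ℕ}
    (h : Theta ([X x x a b] ++ C)) :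
    Theta ([P a b] ++ C) := by
  obtain ⟨fx, hx⟩ := h.fresh (l := x) (A := [a, b])
    (List.perm_iff_count.2 fun k => by simp [labels, Node.labels, List.count_cons])
  simp only [List.mem_cons, List.not_mem_nil, or_false, not_or, ← ne_eq] at fx
  refine h.replace [x] (by simp [hx]) (fun k => ?_) rfl (fun q hq => ⟨?_, ?_⟩)
    (fun κ hκ => ?_) fun jo => ?_
  · simp only [labels, Node.labels, List.flatMap_cons, List.flatMap_nil,
      List.append_nil, List.count_cons, List.count_nil, List.mem_cons, beq_iff_eq]
    grind
  · refine ⟨fun l => if l = x then q a else q l, ?_, ?_⟩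
    · simp +contextual
    · simp only [List.forall_mem_cons, Respects] at hq
      simp [Respects, Ne.symm, *]
  · simp only [List.forall_mem_cons, Respects] at hq
    simp [labels, Node.labels]
    grind
  · refine ⟨fun l => κ l, ?_, ?_⟩
    · simp +contextual
    · simp only [List.forall_mem_cons, Coloured] at hκ
      simp [Coloured, *]
      grind
  · simp only [List.map_cons, Node.labels, List.map_nil, List.cons_append, List.nil_append] at jo ⊢
    rw [labels_eq] at hx
    exact jo.of_cancel (by simp; grind)

theorem Theta.I' {C : Diagram} {a b x : ℕ}
    (h : Theta ([X a x x b] ++ C)) :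
    Theta ([P a b] ++ C) := by
  obtain ⟨fx, hx⟩ := h.fresh (l := x) (A := [a, b])
    (List.perm_iff_count.2 fun k => by simp [labels, Node.labels, List.count_cons]; omega)
  simp only [List.mem_cons, List.not_mem_nil, or_false, not_or, ← ne_eq] at fx
  refine h.replace [x] (by simp [hx]) (fun k => ?_) rfl (fun q hq => ⟨?_, ?_⟩)
    (fun κ hκ => ?_) fun jo => ?_
  · simp only [labels, Node.labels, List.flatMap_cons, List.flatMap_nil,
      List.append_nil, List.count_cons, List.count_nil, List.mem_cons, beq_iff_eq]
    grind
  · refine ⟨fun l => if l = x then q a else q l, ?_, ?_⟩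
    · simp +contextual
    · simp only [List.forall_mem_cons, Respects] at hq
      simp [Respects, Ne.symm, *]
  · simp only [List.forall_mem_cons, Respects] at hq
    simp [labels, Node.labels]
    grind
  · refine ⟨fun l => κ l, ?_, ?_⟩
    · simp +contextual
    · simp only [List.forall_mem_cons, Coloured] at hκ
      simp [Coloured, *]
  · simp only [List.map_cons, Node.labels, List.map_nil, List.cons_append, List.nil_append] at jo ⊢
    rw [labels_eq] at hx
    exact ((jo.rotate (u := [a]) (v := [x, x, b])).of_cancel (by simp; grind)).rotate (u := [b])
      (v := [a])

/-- Contracting one side of the bigon and cancelling the other merges the two strands in one node.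
Pulling them apart is a splitting of this node. -/
theorem Theta.II {C : Diagram} {a b c d x y : ℕ}
    (h : Theta ([X a c y x, X y d b x] ++ C)) :
    Theta ([P a b, P c d] ++ C) := by
  obtain ⟨fx, hx⟩ := h.fresh (l := x) (A := [a, c, y, y, d, b])
    (List.perm_iff_count.2 fun k => by simp [labels, Node.labels, List.count_cons]; omega)
  obtain ⟨fy, hy⟩ := h.fresh (l := y) (A := [a, c, x, d, b, x])
    (List.perm_iff_count.2 fun k => by simp [labels, Node.labels, List.count_cons]; omega)
  simp only [List.mem_cons, List.not_mem_nil, or_false, not_or, ← ne_eq] at fx fy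
  refine h.replace [x, y] (by simp [hx, hy]) (fun k => ?_) rfl (fun q hq => ⟨?_, ?_⟩)
    (fun κ hκ => ?_) fun jo => ?_
  · simp only [labels, Node.labels, List.flatMap_cons, List.flatMap_nil, List.cons_append,
      List.nil_append, List.append_nil, List.count_cons, List.count_nil, List.mem_cons, beq_iff_eq]
    grind
  · refine ⟨fun l => if l = x then q c else if l = y then q a else q l, ?_, ?_⟩
    · simp +contextual
    · simp only [List.forall_mem_cons, Respects] at hq
      simp [Respects, Ne.symm, *]
  · simp only [List.forall_mem_cons, Respects] at hq
    simp [labels, Node.labels]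
    grind
  · refine ⟨fun l => κ l, ?_, ?_⟩
    · simp +contextual
    · simp only [List.forall_mem_cons, Coloured] at hκ
      simp [Coloured, *]
  · simp only [List.map_cons, Node.labels, List.map_nil, List.cons_append, List.nil_append] at jo ⊢
    rw [labels_eq] at hx hy
    have := (jo.rotate (u := [a, c]) (v := [y, x])).of_contract (by simp; grind)
    have := (this.rotate (u := [x, a, c, d, b]) (v := [x])).of_cancel (by simp; grind)
    have := (this.rotate (u := [a, c, d]) (v := [b])).split (u := [b, a]) (v := [c, d])
    exact this.rotate (u := [b]) (v := [a])

theorem Theta.turnX {C : Diagram} {a b c d : ℕ}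
    (h : Theta ([X a b c d] ++ C)) :
    Theta ([X c d a b] ++ C) := by
  refine h.replace [] (by simp) (fun k => ?_) rfl (fun q hq => ⟨?_, ?_⟩) (fun κ hκ => ?_) fun jo =>
      ?_
  · left; simp [labels, Node.labels, List.count_cons]; omega
  · refine ⟨fun l => q l, ?_, ?_⟩
    · simp +contextual
    · simp only [List.forall_mem_cons, Respects] at hq
      simp [Respects, *]
  · simp only [List.forall_mem_cons, Respects] at hq
    simp [labels, Node.labels]
  · refine ⟨fun l => κ l, ?_, ?_⟩
    · simp +contextual
    · simp only [List.forall_mem_cons, Coloured] at hκ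
      simp [Coloured, *]
  · simp only [List.map_cons, Node.labels, List.map_nil, List.cons_append, List.nil_append] at jo ⊢
    exact jo.rotate (u := [a, b]) (v := [c, d])

theorem Theta.turnV {C : Diagram} {a b c : ℕ}
    (h : Theta ([V a b c] ++ C)) :
    Theta ([V b c a] ++ C) := by
  refine h.replace [] (by simp) (fun k => ?_) rfl (fun q hq => ⟨?_, ?_⟩) (fun κ hκ => ?_) fun jo =>
      ?_
  · left; simp [labels, Node.labels, List.count_cons]; omega
  · refine ⟨fun l => q l, ?_, ?_⟩
    · simp +contextual
    · simp only [List.forall_mem_cons, Respects] at hq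
      simp [Respects, *]
  · simp only [List.forall_mem_cons, Respects] at hq
    simp [labels, Node.labels]
  · refine ⟨fun l => κ l, ?_, ?_⟩
    · simp +contextual
    · simp only [List.forall_mem_cons, Coloured] at hκ
      simp [Coloured, Ne.symm, *]
  · simp only [List.map_cons, Node.labels, List.map_nil, List.cons_append, List.nil_append] at jo ⊢
    exact jo.rotate (u := [a]) (v := [b, c])

/-! ### Marked points -/

theorem Theta.perm {D E : Diagram} (hp : D.Perm E) (h : Theta D) : Theta E := by
  have hl : (labels D).Perm (labels E) := hp.flatMap_right _
  refine ⟨fun l hm => ?_, ?_, fun p hv l hl' m hm => ?_, ?_, .perm (hp.map _) h.jordan⟩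
  · rw [← hl.count_eq]; exact h.twice l (hl.mem_iff.2 hm)
  · rw [← hp.countP_eq]; exact h.vertices
  · exact h.connected p (fun v h => hv v (hp.mem_iff.1 h)) l (hl.mem_iff.2 hl') m (hl.mem_iff.2 hm)
  · obtain ⟨c, hc⟩ := h.coloured
    exact ⟨c, fun v h => hc v (hp.mem_iff.2 h)⟩

/-- The arc `b` gets the label `a`. -/
def fuse (a b l : ℕ) : ℕ := if l = b then a else l

theorem count_map_fuse {a b : ℕ} (hab : a ≠ b) (k : ℕ) (L : List ℕ) :
    (L.map (fuse a b)).count k =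
      if k = a then L.count a + L.count b else if k = b then 0 else L.count k := by
  induction L with
  | nil => simp
  | cons l L ih =>
    rw [List.map_cons, List.count_cons, ih]
    simp only [List.count_cons, fuse, beq_iff_eq]
    grind

/-- A half-arc labelled `a` after the fusion was labelled `a` or `b` before. -/
theorem sideSum_map_fuse {a b : ℕ} (hab : a ≠ b) (g : ℕ → ZMod 2) {k : ℕ} (hk : k ≠ b)
    (w : List ℕ) (q : ZMod 2) :
    sideSum g k (w.map (fuse a b)) q = sideSum (g ∘ fuse a b) k w q +
      if k = a then sideSum (g ∘ fuse a b) b w q else 0 := by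
  induction w generalizing q with
  | nil => simp [sideSum]
  | cons l w ih =>
    simp only [List.map_cons, sideSum, ih, Function.comp]
    by_cases h1 : k = a
    · subst h1
      by_cases h2 : l = b
      · subst h2; simp [fuse, hk.symm, add_left_comm]
      · simp [fuse, h2, add_assoc]
    · by_cases h2 : l = b
      · subst h2; simp [fuse, h1, Ne.symm h1, hk.symm]
      · simp [fuse, h1, h2]

/-- Let A and B be the contributions of the other nodes to the conditions at `a` and `b`. With the
corner value q of the marked point, A + q = g a and B + q + g a = g a. Adding these gives A + B = g
a, the condition for the fused arc. -/
theorem Jordan.fuse {a b : ℕ} {W : List (List ℕ)} (hab : a ≠ b) (h : Jordan ([a, b] :: W)) :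
    Jordan (W.map (List.map (fuse a b))) := by
  intro g hg
  obtain ⟨Q, hQ, hs⟩ := h (g ∘ ThetaCurve.fuse a b) (by
    intro w hw
    rcases List.mem_cons.1 hw with rfl | hw
    · simp [ThetaCurve.fuse, hab, CharTwo.add_self_eq_zero]
    · rw [← List.map_map]
      exact hg _ (List.mem_map_of_mem hw))
  obtain ⟨⟨w, q⟩, Q, rfl, rfl, rfl⟩ := List.map_eq_cons_iff.1 hQ
  refine ⟨Q.map fun p => (p.1.map (ThetaCurve.fuse a b), p.2), by simp [Function.comp_def],
    fun k hk => ?_⟩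
  have hkb : k ≠ b := by
    rintro rfl
    rw [← List.map_flatten, ← List.count_pos_iff, count_map_fuse hab] at hk
    simp [Ne.symm hab] at hk
  have hsum : ((Q.map fun p => (p.1.map (ThetaCurve.fuse a b), p.2)).map
      fun p => sideSum g k p.1 p.2).sum =
      (Q.map fun p => sideSum (g ∘ ThetaCurve.fuse a b) k p.1 p.2).sum +
      if k = a then (Q.map fun p => sideSum (g ∘ ThetaCurve.fuse a b) b p.1 p.2).sum else 0 := by
    rw [List.map_map]
    have : ∀ p : List ℕ × ZMod 2, ((fun p => sideSum g k p.1 p.2) ∘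
        fun p : List ℕ × ZMod 2 => (p.1.map (ThetaCurve.fuse a b), p.2)) p = _ :=
      fun p => sideSum_map_fuse hab g hkb p.1 p.2
    rw [funext this, List.sum_map_add]
    split_ifs <;> simp
  rw [hsum]
  by_cases hka : k = a
  · subst hka
    have h1 := hs k (by simp)
    have h2 := hs b (by simp)
    simp only [List.map_cons, List.sum_cons, sideSum, hab, Ne.symm hab, if_true, if_false,
      Function.comp, ThetaCurve.fuse, add_zero, zero_add] at h1 h2 ⊢
    revert h1 h2
    generalize List.sum (α := ZMod 2) _ = x
    generalize List.sum (α := ZMod 2) _ = y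
    generalize g k = z
    generalize q = q'
    revert q' x y z
    decide
  · rw [if_neg hka, add_zero]
    have h1 := hs k (by
      rw [← List.map_flatten] at hk
      obtain ⟨l, hl, rfl⟩ := List.mem_map.1 hk
      have : ThetaCurve.fuse a b l = l := by
        rw [ThetaCurve.fuse]; split_ifs with h
        · simp [ThetaCurve.fuse, h] at hka
        · rfl
      rw [this, List.flatten_cons]
      exact List.mem_append_right _ hl)
    simpa [sideSum, Ne.symm hka, Ne.symm hkb, ThetaCurve.fuse, hkb] using h1

theorem Node.labels_map (f : ℕ → ℕ) (v : Node) : (v.map f).labels = v.labels.map f := by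
  cases v <;> rfl

theorem labels_map (f : ℕ → ℕ) (D : Diagram) : labels (D.map (Node.map f)) = (labels D).map f := by
  simp only [labels, List.flatMap_map, Node.labels_map, List.map_flatMap]

theorem Theta.erase {C : Diagram} {a b : ℕ} (hab : a ≠ b) (h : Theta (P a b :: C)) :
    Theta (C.map (Node.map (fuse a b))) := by
  have hlab : labels (P a b :: C) = a :: b :: labels C := rfl
  refine ⟨fun k hk => ?_, ?_, fun p hv l hl m hm => ?_, ?_, ?_⟩
  -- Each of `a` and `b` occurs once at the marked point and so once elsewhere; after the fusion `a`
  -- occurs twice and `b` no longer.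
  · have ha := h.twice a (by simp [hlab])
    have hb := h.twice b (by simp [hlab])
    rw [labels_map] at hk ⊢
    rw [← List.count_pos_iff] at hk
    rw [count_map_fuse hab] at hk ⊢
    have hk' : k ∈ labels C → (labels (P a b :: C)).count k = 2 := fun hk => h.twice k (by
      simp [hlab, hk])
    rw [← List.count_pos_iff] at hk'
    simp only [hlab, List.count_cons, beq_iff_eq] at ha hb hk'
    grind
  · rw [List.countP_map]
    have := h.vertices
    rw [List.countP_cons_of_neg (by simp [isVertex])] at this
    rw [← this]
    refine List.countP_congr fun v _ => ?_
    cases v <;> simp [isVertex, Node.map]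
  · have hr : ∀ v : Node, (v.map (fuse a b)).Respects p ↔ v.Respects (p ∘ fuse a b) := by
      rintro (_ | _ | _) <;> rfl
    rw [labels_map] at hl hm
    obtain ⟨l, hl', rfl⟩ := List.mem_map.1 hl
    obtain ⟨m, hm', rfl⟩ := List.mem_map.1 hm
    refine h.connected (p ∘ fuse a b) (fun v hm => ?_) l (by simp [hlab, hl']) m
      (by simp [hlab, hm'])
    rcases List.mem_cons.1 hm with rfl | hm
    · simp [Respects, fuse, hab]
    · exact (hr v).1 (hv _ (List.mem_map_of_mem hm))
  · obtain ⟨c, hc⟩ := h.coloured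
    have hcab : c a = c b := hc _ List.mem_cons_self
    have hcf : c ∘ fuse a b = c := by
      ext l; simp only [Function.comp, fuse]; split_ifs with h
      · rw [h, hcab]
      · rfl
    refine ⟨c, fun v hv => ?_⟩
    obtain ⟨v, hv', rfl⟩ := List.mem_map.1 hv
    have : v.Coloured (c ∘ fuse a b) := by rw [hcf]; exact hc v (.tail _ hv')
    cases v <;> exact this
  · have := Jordan.fuse hab h.jordan
    simp only [List.map_map] at this ⊢
    convert this using 2
    ext v : 1
    exact Node.labels_map _ v

/-- If `D` is a diagram of a θ-curve, so is `E`, and they are related by Reidemeister moves. -/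
def Leads (D E : Diagram) : Prop := Theta D → Theta E ∧ ReidemeisterEquiv D E

/-! ### Moves between diagrams of θ-curves -/

namespace Leads

theorem refl (D : Diagram) : Leads D D := fun h => ⟨h, .refl _⟩

theorem trans {D E F : Diagram} (h : Leads D E) (h' : Leads E F) : Leads D F := fun hD =>
  ⟨(h' (h hD).1).1, .trans _ _ _ (h hD).2 (h' (h hD).1).2⟩

theorem of_step {D E : Diagram} (hs : Step D E) (h : Theta D → Theta E) : Leads D E := fun hD =>
  ⟨h hD, .rel _ _ ⟨hD.isThetaDiagram, (h hD).isThetaDiagram, hs⟩⟩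

/-- `Move` states moves IV and V in the direction that adds a crossing, while the simplification
mostly goes the other way. -/
theorem of_step_symm {D E : Diagram} (hs : Step E D) (h : Theta D → Theta E) : Leads D E :=
  fun hD => ⟨h hD, .symm _ _ (.rel _ _ ⟨(h hD).isThetaDiagram, hD.isThetaDiagram, hs⟩)⟩

theorem perm {D E : Diagram} (h : D.Perm E) : Leads D E := of_step (.reorder h) (.perm h)

theorem erase {C : Diagram} {a b : ℕ} (hab : a ≠ b) :
    Leads (P a b :: C) (C.map (Node.map (fuse a b))) := of_step (.erase C a b hab) (.erase hab)

variable {C : Diagram}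

theorem turnX (a b c d : ℕ) : Leads (X a b c d :: C) (X c d a b :: C) :=
  of_step (.move C (.turnX a b c d)) .turnX

theorem turnV (a b c : ℕ) : Leads (V a b c :: C) (V b c a :: C) :=
  of_step (.move C (.turnV a b c)) .turnV

theorem I (a b x : ℕ) : Leads (X x x a b :: C) (P a b :: C) := of_step (.move C (.I a b x)) .I

theorem I' (a b x : ℕ) : Leads (X a x x b :: C) (P a b :: C) := of_step (.move C (.I' a b x)) .I'

theorem II (a b c d x y : ℕ) : Leads (X a c y x :: X y d b x :: C) (P a b :: P c d :: C) :=
  of_step (.move C (.II a b c d x y)) .II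

theorem III (b b' m m' t t' x y z : ℕ) : Leads (X b m x y :: X x t b' z :: X y z m' t' :: C)
    (X b z x t' :: X x y b' m' :: X m t y z :: C) :=
  of_step (.move C (.III b b' m m' t t' x y z x y z)) .III

theorem III' (b b' m m' t t' x y z : ℕ) : Leads (X b y x m :: X x z b' t :: X y t' m' z :: C)
    (X b t' x z :: X x m' b' y :: X m z y t :: C) :=
  of_step (.move C (.III' b b' m m' t t' x y z x y z)) .III'

theorem V (a b c x y : ℕ) : Leads (.V a x y :: X y x b c :: C) (.V a b c :: C) :=
  of_step_symm (.move C (.V a b c x y)) .V_symm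

theorem V' (a b c x y : ℕ) : Leads (.V a x y :: X x b c y :: C) (.V a b c :: C) :=
  of_step_symm (.move C (.V' a b c x y)) .V'_symm

theorem IVover (a b c s s' y z w : ℕ) : Leads (.V a y z :: X y s' b w :: X z w c s :: C)
    (.V y b c :: X y s a s' :: C) :=
  of_step_symm (.move C (.IVover a b c s s' y y z w)) .IVover_symm

theorem IVbehind (a b c s s' y z w : ℕ) : Leads (.V a y z :: X s' b w y :: X w c s z :: C)
    (.V y b c :: X s a s' y :: C) :=
  of_step_symm (.move C (.IVbehind a b c s s' y y z w)) .IVbehind_symm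

/-- The bound `n` on all labels makes `n` and `n + 1` available for the two new arcs. -/
theorem IVover_symm (a b c s s' x n : ℕ) (hn : ∀ l ∈ labels (.V x b c :: X x s a s' :: C), l < n) :
    Leads (.V x b c :: X x s a s' :: C) (.V a x n :: X x s' b (n + 1) :: X n (n + 1) c s :: C) := by
  have h1 : ∀ k, n ≤ k → k ∉ labels (.V x b c :: X x s a s' :: C) := fun k hk hm =>
    absurd (hn k hm) (by omega)
  simp only [labels, List.flatMap_cons, Node.labels, List.mem_append, not_or, List.mem_cons,
    List.not_mem_nil, or_false] at h1
  refine of_step (.move C (.IVover a b c s s' x x n (n + 1))) (.IVover ?_ ?_ ?_ ?_) <;>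
  have h2 := h1 n le_rfl <;> have h3 := h1 (n + 1) (by omega) <;> simp [labels] <;> grind

theorem IVbehind_symm (a b c s s' x n : ℕ)
    (hn : ∀ l ∈ labels (.V x b c :: X s a s' x :: C), l < n) :
    Leads (.V x b c :: X s a s' x :: C) (.V a x n :: X s' b (n + 1) x :: X (n + 1) c s n :: C) := by
  have h1 : ∀ k, n ≤ k → k ∉ labels (.V x b c :: X s a s' x :: C) := fun k hk hm =>
    absurd (hn k hm) (by omega)
  simp only [labels, List.flatMap_cons, Node.labels, List.mem_append, not_or, List.mem_cons,
    List.not_mem_nil, or_false] at h1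
  refine of_step (.move C (.IVbehind a b c s s' x x n (n + 1))) (.IVbehind ?_ ?_ ?_ ?_) <;>
  have h2 := h1 n le_rfl <;> have h3 := h1 (n + 1) (by omega) <;> simp [labels] <;> grind

end Leads

/-! ### Recognising diagrams -/

theorem beq_iff {a b : ℕ} : a.beq b = true ↔ a = b := by rw [Nat.beq_eq]

theorem beq_false_iff {a b : ℕ} : a.beq b = false ↔ a ≠ b := by
  rw [← Bool.not_eq_true, beq_iff]

/-- As far as the spatial graph is concerned, a crossing is a pair of marked points, one on each
strand. So `joined` can treat crossings by erasing marked points. -/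
theorem labels_perm_cons_P {a b c d : ℕ} {C : Diagram} :
    (labels (X a b c d :: C)).Perm (labels (P a c :: P b d :: C)) :=
  .cons a (.swap c b _)

/-- The strands are shortened until only the vertices are left: tests whether the three edges at
one vertex are the three edges at the other vertex. The first argument bounds the number of
steps. -/
def joined : ℕ → Diagram → Bool
  | n + 1, X a b c d :: C => !a.beq c && joined n (.P (fuse a c b) (fuse a c d) ::
      C.map (Node.map (fuse a c)))
  | n + 1, P a b :: C => !a.beq b && joined n (C.map (Node.map (fuse a b)))
  | _ + 1, [V a b c, V d e f] => !a.beq b && !b.beq c && !c.beq a && !d.beq e && !e.beq f &&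
      !f.beq d && [d, e, f].all fun l => l.beq a || l.beq b || l.beq c
  | _, _ => false

/-- The conditions in `Theta` that concern the spatial graph. -/
structure Joined (D : Diagram) : Prop where
  connected : ∀ p : ℕ → Prop, (∀ v ∈ D, v.Respects p) → ∀ l ∈ labels D, ∀ m ∈ labels D, p l → p m
  coloured : ∃ c : ℕ → Fin 3, ∀ v ∈ D, v.Coloured c

theorem twice_erase {C : Diagram} {a b : ℕ} (hab : a ≠ b)
    (h : ∀ l, (labels (P a b :: C)).count l = 0 ∨ (labels (P a b :: C)).count l = 2) (l : ℕ) :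
    (labels (C.map (Node.map (fuse a b)))).count l = 0 ∨
      (labels (C.map (Node.map (fuse a b)))).count l = 2 := by
  have hlab : labels (P a b :: C) = a :: b :: labels C := rfl
  have ha := h a
  have hb := h b
  have hl := h l
  rw [labels_map, count_map_fuse hab]
  simp only [hlab, List.count_cons, beq_iff_eq] at ha hb hl
  grind

/-- Connectedness and a colouring are pulled back along `fuse a b`: a partition respected by the
marked point does not distinguish `a` from `b`. -/
theorem Joined.of_erase {C : Diagram} {a b : ℕ} (hab : a ≠ b)
    (h2 : ∀ l, (labels (P a b :: C)).count l = 0 ∨ (labels (P a b :: C)).count l = 2)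
    (h : Joined (C.map (Node.map (fuse a b)))) : Joined (P a b :: C) := by
  have hlab : labels (P a b :: C) = a :: b :: labels C := rfl
  -- The fused arc must still be present, as the arcs `a` and `b` are represented by it; a double
  -- occurrence of `a` with only one at the marked point ensures this.
  have ha : a ∈ labels C := by
    have := h2 a
    rw [hlab, List.count_cons_self, List.count_cons_of_ne (Ne.symm hab)] at this
    exact List.count_pos_iff.1 (by omega)
  constructor
  · intro p hp
    simp only [List.forall_mem_cons] at hp
    obtain ⟨hpab, hp⟩ := hp
    replace hpab : p a ↔ p b := hpab
    have hf : ∀ l, p (fuse a b l) ↔ p l := fun l => by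
      rw [fuse]; split_ifs with h
      · rw [h, hpab]
      · rfl
    have key : ∀ l ∈ labels (P a b :: C), ∃ m ∈ labels (C.map (Node.map (fuse a b))),
        (p l ↔ p m) := by
      intro l hl
      rw [hlab, List.mem_cons, List.mem_cons] at hl
      rw [labels_map]
      rcases hl with rfl | rfl | hl
      · exact ⟨_, List.mem_map_of_mem ha, (hf _).symm⟩
      · exact ⟨_, List.mem_map_of_mem ha, hpab.symm.trans (hf _).symm⟩
      · exact ⟨_, List.mem_map_of_mem hl, (hf _).symm⟩
    intro l hl m hm
    obtain ⟨l', hl', e⟩ := key l hl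
    obtain ⟨m', hm', e'⟩ := key m hm
    rw [e, e']
    refine h.connected p (fun v hv => ?_) l' hl' m' hm'
    obtain ⟨v, hv', rfl⟩ := List.mem_map.1 hv
    have := (v.respects_congr (p := p) (q := p ∘ fuse a b) fun l _ => (hf l).symm).1 (hp v hv')
    cases v <;> exact this
  · obtain ⟨c, hc⟩ := h.coloured
    refine ⟨c ∘ fuse a b, List.forall_mem_cons.2 ⟨?_, fun v hv => ?_⟩⟩
    · simp [Coloured, fuse, hab]
    · have := hc _ (List.mem_map_of_mem hv)
      cases v <;> exact this

/-- In the end two vertices with the same three distinct arcs are left, where any three colours will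
do; these extend backwards along the strands. An arc that would be fused with itself is a closed
component, which the test rejects. -/
theorem joined_sound (n : ℕ) (D : Diagram)
    (h2 : ∀ l, (labels D).count l = 0 ∨ (labels D).count l = 2) (h : joined n D = true) :
    Joined D := by
  induction n generalizing D with
  | zero => simp [joined] at h
  | succ n ih =>
    unfold joined at h
    split at h
    · rename_i n' a b c d C heq
      obtain rfl : n = n' := by simpa using heq
      simp only [Bool.and_eq_true, Bool.not_eq_true', beq_false_iff] at h
      have h2' : ∀ l, (labels (P a c :: P b d :: C)).count l = 0 ∨
          (labels (P a c :: P b d :: C)).count l = 2 := fun l => by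
        rw [← labels_perm_cons_P.count_eq]; exact h2 l
      have := Joined.of_erase h.1 h2' (ih _ (twice_erase h.1 h2') h.2)
      constructor
      · intro p hp l hl m hm
        refine this.connected p ?_ l (labels_perm_cons_P.mem_iff.1 hl) m
          (labels_perm_cons_P.mem_iff.1 hm)
        simpa [Respects, and_assoc] using hp
      · obtain ⟨κ, hκ⟩ := this.coloured
        exact ⟨κ, by simpa [Coloured, and_assoc] using hκ⟩
    · rename_i n' a b C heq
      obtain rfl : n = n' := by simpa using heq
      simp only [Bool.and_eq_true, Bool.not_eq_true', beq_false_iff] at h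
      exact Joined.of_erase h.1 h2 (ih _ (twice_erase h.1 h2) h.2)
    · rename_i a b c d e f heq
      simp only [Bool.and_eq_true, Bool.not_eq_true', beq_false_iff, List.all_eq_true,
        List.mem_cons, List.not_mem_nil, or_false, forall_eq_or_imp, forall_eq, Bool.or_eq_true,
        beq_iff] at h
      obtain ⟨⟨⟨⟨⟨⟨hab, hbc⟩, hca⟩, hde⟩, hef⟩, hfd⟩, hd, he, hf⟩ := h
      constructor
      · intro p hp
        simp only [List.forall_mem_cons, Respects] at hp
        obtain ⟨⟨h1, h2⟩, ⟨h3, h4⟩, -⟩ := hp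
        have hd' : p d ↔ p a := by rcases hd with (rfl | rfl) | rfl <;> simp [h1, h2]
        have key : ∀ l ∈ labels [V a b c, V d e f], p l ↔ p a := by
          simp [labels, Node.labels, ← h1, ← h2, ← h3, ← h4, hd']
        exact fun l hl m hm h => (key m hm).2 ((key l hl).1 h)
      · refine ⟨fun l => if l = a then 0 else if l = b then 1 else 2, ?_⟩
        simp only [List.forall_mem_cons, Coloured, List.not_mem_nil, false_imp_iff, implies_true,
          and_true]
        have := hab.symm
        have := hbc.symm
        have := hca.symm
        rcases hd with (rfl | rfl) | rfl <;> rcases he with (rfl | rfl) | rfl <;>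
          rcases hf with (rfl | rfl) | rfl <;> first | contradiction | simp [*]
    · cases h

/-- The other arcs at the first node of the arc `l`, and the other nodes. -/
def unplug (l : ℕ) : List (List ℕ) → Option (List ℕ × List (List ℕ))
  | [] => none
  | w :: W =>
    match cut [] w with
    | some v => some (v, W)
    | none => (unplug l W).map fun p => (p.1, w :: p.2)
where
  /-- The arcs that follow `l` in the word `u.reverse ++ w`, in cyclic order. -/
  cut (u : List ℕ) : List ℕ → Option (List ℕ)
    | [] => none
    | m :: w => bif l.beq m then some (w ++ u.reverse) else cut (m :: u) w

/-- All nodes are joined to the first one by contracting arcs. Then the Jordan curve theorem holds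
if the arcs that are left can be cancelled. -/
def collapses : ℕ → List ℕ → List ℕ → List (List ℕ) → Bool
  | 0, _, _, _ => false
  | _ + 1, st, [], W => st.isEmpty && W.isEmpty
  | n + 1, [], l :: w, W =>
    match unplug l W with
    | some (v, W) => collapses n [] (v ++ w) W
    | none => collapses n [l] w W
  | n + 1, m :: st, l :: w, W =>
    bif l.beq m then collapses n st w W else
    match unplug l W with
    | some (v, W) => collapses n (m :: st) (v ++ w) W
    | none => collapses n (l :: m :: st) w W

/-! ### Soundness of the planarity test -/

theorem cut_sound (l : ℕ) (u w v : List ℕ) (h : unplug.cut l u w = some v) :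
    ∃ a b, u.reverse ++ w = a ++ l :: b ∧ v = b ++ a := by
  induction w generalizing u with
  | nil => simp [unplug.cut] at h
  | cons m w ih =>
    rw [unplug.cut] at h
    cases hm : l.beq m with
    | true =>
      rw [beq_iff] at hm
      subst hm
      simp only [Nat.beq_refl, cond_true, Option.some.injEq] at h
      exact ⟨_, _, rfl, h.symm⟩
    | false =>
      rw [hm, cond_false] at h
      obtain ⟨a, b, h1, h2⟩ := ih _ h
      exact ⟨a, b, by simpa using h1, h2⟩

theorem unplug_sound (l : ℕ) (W : List (List ℕ)) (v : List ℕ) (W' : List (List ℕ))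
    (h : unplug l W = some (v, W')) :
    ∃ a b, W.Perm ((a ++ l :: b) :: W') ∧ v = b ++ a := by
  induction W generalizing W' with
  | nil => simp [unplug] at h
  | cons w W ih =>
    rw [unplug] at h
    split at h
    · rename_i v' hv
      simp only [Option.some.injEq, Prod.mk.injEq] at h
      obtain ⟨rfl, rfl⟩ := h
      obtain ⟨a, b, h1, h2⟩ := cut_sound _ _ _ _ hv
      exact ⟨a, b, by rw [← h1]; rfl, h2⟩
    · obtain ⟨⟨v', W''⟩, h1, h2⟩ := Option.map_eq_some_iff.1 h
      simp only [Prod.mk.injEq] at h2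
      obtain ⟨rfl, rfl⟩ := h2
      obtain ⟨a, b, h3, h4⟩ := ih _ h1
      exact ⟨a, b, (h3.cons w).trans (.swap _ _ _), h4⟩

/-- The word of the merged node is `st.reverse ++ w`: the stack holds the letters already read, the
last one on top. Absorbing another node is `Jordan.contract`, meeting the letter on top of the stack
is `Jordan.cancel`, and pushing a letter leaves the word unchanged. The bound on the counts provides
the freshness needed for both rules. -/
theorem collapses_sound (n : ℕ) (st w : List ℕ) (W : List (List ℕ))
    (h2 : ∀ l, (st ++ w ++ W.flatten).count l ≤ 2) (h : collapses n st w W = true) :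
    Jordan ((st.reverse ++ w) :: W) := by
  induction n generalizing st w W with
  | zero => simp [collapses] at h
  | succ n ih =>
    have contract : ∀ st W l w v W', w = l :: v → unplug l W = some W' →
        (∀ l', (st ++ w ++ W.flatten).count l' ≤ 2) →
        collapses n st (W'.1 ++ v) W'.2 = true → Jordan ((st.reverse ++ w) :: W) := by
      rintro st W l _ v ⟨u, W'⟩ rfl h1 h2 h3
      obtain ⟨a, b, hp, rfl⟩ := unplug_sound _ _ _ _ h1
      have hcount : ∀ l', (st ++ l :: v ++ W.flatten).count l' =
          (st ++ l :: v ++ ((a ++ l :: b) ++ W'.flatten)).count l' := fun l' =>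
        (hp.flatten.append_left _).count_eq l'
      have hl : l ∉ st ∧ l ∉ v ∧ l ∉ a ∧ l ∉ b ∧ l ∉ W'.flatten := by
        have := h2 l
        rw [hcount] at this
        simp only [List.count_append, List.count_cons_self] at this
        refine ⟨?_, ?_, ?_, ?_, ?_⟩ <;> rw [← List.count_eq_zero] <;> omega
      have := ih st (b ++ a ++ v) W' (fun l' => by
        refine le_trans ?_ ((hcount l').symm.trans_le (h2 l'))
        simp only [List.count_append, List.count_cons]
        omega) h3
      -- Both words are rotated so that they begin with `l`, as `contract` requires.
      refine .perm (.cons _ hp.symm) (.rotate (u := l :: v) ?_)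
      refine .rotate₂ (u := l :: b) (v := a) (.contract (u := v ++ st.reverse) ?_ ?_)
      · simp [hl]
      · have h4 : Jordan ((v ++ (st.reverse ++ (b ++ a))) :: W') :=
          .rotate (by simpa using this)
        simpa using h4
    rcases w with _ | ⟨l, w⟩
    · simp only [collapses, Bool.and_eq_true, List.isEmpty_iff] at h
      obtain ⟨rfl, rfl⟩ := h
      exact .nil_cons .nil
    rcases st with _ | ⟨m, st⟩
    · simp only [collapses] at h
      split at h
      · rename_i v W' h1
        exact contract _ _ l _ w (v, W') rfl h1 h2 h
      · simpa using ih [l] w W (by simpa using h2) h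
    · simp only [collapses] at h
      cases hm : l.beq m with
      | true =>
        rw [hm, cond_true] at h
        rw [beq_iff] at hm
        subst hm
        have hl : l ∉ st ∧ l ∉ w ∧ l ∉ W.flatten := by
          have := h2 l
          simp only [List.count_append, List.count_cons_self] at this
          refine ⟨?_, ?_, ?_⟩ <;> rw [← List.count_eq_zero] <;> omega
        have := ih st w W (fun l' => by
          refine le_trans ?_ (h2 l')
          simp only [List.count_append, List.count_cons]
          omega) h
        have := this.rotate.cancel (l := l) (by simp [hl])
        have := this.rotate (u := l :: l :: w)
        rw [List.reverse_cons, List.append_assoc]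
        exact this
      | false =>
        rw [hm, cond_false] at h
        split at h
        · rename_i v W' h1
          exact contract _ _ l _ w (v, W') rfl h1 h2 h
        · have := ih (l :: m :: st) w W (fun l' => by
            refine le_trans (le_of_eq ?_) (h2 l')
            simp only [List.count_append, List.count_cons]
            omega) h
          simpa using this

/-- The number of occurrences of `l`. -/
def occurrences (l : ℕ) : List ℕ → ℕ
  | [] => 0
  | m :: L => bif l.beq m then (occurrences l L).succ else occurrences l L

theorem occurrences_eq (l : ℕ) (L : List ℕ) : occurrences l L = L.count l := by
  induction L with
  | nil => rfl
  | cons m L ih =>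
    rw [occurrences, List.count_cons, ih]
    cases h : l.beq m with
    | true => rw [beq_iff] at h; simp [h]
    | false => rw [beq_false_iff] at h; simp [Ne.symm h]

/-- Tests whether `D` is a diagram of a θ-curve. -/
def isTheta (D : Diagram) : Bool :=
  ((labels D).all fun l => (occurrences l (labels D)).beq 2) &&
    (D.countP Node.isVertex).beq 2 && joined (labels D).length D &&
    match D with
    | [] => false
    | v :: C => collapses (labels D).length.succ [] v.labels (C.map Node.labels)

theorem isTheta_sound {D : Diagram} (h : isTheta D = true) : Theta D := by
  simp only [isTheta, Bool.and_eq_true, beq_iff, List.all_eq_true, occurrences_eq] at h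
  obtain ⟨⟨⟨h1, h2⟩, h3⟩, h4⟩ := h
  have h1' : ∀ l, (labels D).count l = 0 ∨ (labels D).count l = 2 := fun l => by
    by_cases hl : l ∈ labels D
    · exact .inr (h1 l hl)
    · exact .inl (List.count_eq_zero.2 hl)
  have hj := joined_sound _ _ h1' h3
  refine ⟨h1, h2, hj.connected, hj.coloured, ?_⟩
  cases D with
  | nil => cases h4
  | cons v C =>
    refine collapses_sound _ [] _ _ (fun l => ?_) h4
    change (v.labels ++ (C.map Node.labels).flatten).count l ≤ 2
    rw [← List.flatten_cons, ← List.map_cons, ← labels_eq]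
    rcases h1' l with h | h <;> omega

/-! ### Crossing changes -/

/-- A crossing change turns the word of the node by one place and leaves the two strands as they
are, so no condition notices it. -/
theorem Theta.change {v : Node} {C : Diagram} (h : Theta (v :: C)) : Theta (v.change :: C) := by
  rcases v with ⟨a, b, c, d⟩ | _ | _
  · refine Theta.replace (L := [X a b c d]) (R := [X b c d a]) [] h (by simp) (fun l => ?_) rfl
      (fun q hq => ⟨⟨q, fun _ _ => .rfl, ?_⟩, by simp⟩) (fun κ hκ => ⟨κ, fun _ _ => rfl, ?_⟩)
      fun h => ?_
    · exact .inl (List.Perm.count_eq (List.perm_append_comm (l₁ := [b, c, d]) (l₂ := [a])) l)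
    · simpa [Respects, and_comm, iff_comm] using hq
    · simpa [Coloured, and_comm, eq_comm] using hκ
    · exact .rotate (u := [a]) (v := [b, c, d]) h
  · exact h
  · exact h

theorem theta_changeCrossings {S : List ℕ} {D : Diagram} (h : Theta D) :
    Theta (changeCrossings S D) := by
  -- The nodes already treated are collected in `A`, and `f` is arbitrary because its index shifts
  -- as the list gets shorter.
  have key : ∀ (C A : Diagram) (f : ℕ → Node → Node), (∀ i v, f i v = v.change ∨ f i v = v) →
      Theta (A ++ C) → Theta (A ++ C.mapIdx f) := by
    intro C
    induction C with
    | nil => exact fun A f _ h => h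
    | cons v C ih =>
      intro A f hf h
      have : Theta (f 0 v :: (A ++ C)) := by
        rcases hf 0 v with e | e <;> rw [e]
        · exact (h.perm List.perm_middle).change
        · exact h.perm List.perm_middle
      have := ih (A ++ [f 0 v]) (fun i => f (i + 1)) (fun i => hf (i + 1))
        (by simpa using this.perm List.perm_middle.symm)
      rw [List.mapIdx_cons]
      simpa using this
  exact key D [] _ (fun i v => by split_ifs <;> simp) h

/-! ### Simplifying diagrams -/

/-- The node with the given number comes to the front; nodes are numbered from one. -/
def pull : ℕ → Diagram → Diagram
  | n + 2, v :: D =>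
    match pull (n + 1) D with
    | w :: E => w :: v :: E
    | [] => [v]
  | _, D => D

theorem pull_perm (n : ℕ) (D : Diagram) : D.Perm (pull n D) := by
  induction n generalizing D with
  | zero => rfl
  | succ n ih =>
    rcases n with _ | n
    · rfl
    · cases D with
      | nil => rfl
      | cons v D =>
        have := ih D
        rw [pull]
        split
        · rename_i w E h
          rw [h] at this
          exact (this.cons v).trans (.swap _ _ _)
        · rename_i h
          rw [h] at this
          exact this.cons v

/-- The ways to write down a node. -/
def Node.turns : Node → List Node
  | X a b c d => [X a b c d, X c d a b]
  | V a b c => [V a b c, V b c a, V c a b]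
  | P a b => [P a b]

/-- The ways to write down the first nodes. -/
def turned : ℕ → Diagram → List Diagram
  | n + 1, v :: C => v.turns.flatMap fun w => (turned n C).map (w :: ·)
  | _, C => [C]

theorem leads_turns {v w : Node} (h : w ∈ v.turns) (C : Diagram) : Leads (v :: C) (w :: C) := by
  rcases v with ⟨a, b, c, d⟩ | ⟨a, b, c⟩ | ⟨a, b⟩ <;>
    simp only [Node.turns, List.mem_cons, List.not_mem_nil, or_false] at h
  · rcases h with rfl | rfl
    · exact .refl _
    · exact .turnX _ _ _ _
  · rcases h with rfl | rfl | rfl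
    · exact .refl _
    · exact .turnV _ _ _
    · exact (Leads.turnV _ _ _).trans (.turnV _ _ _)
  · subst h
    exact .refl _

theorem leads_turned {n : ℕ} {C E : Diagram} (h : E ∈ turned n C) : Leads C E := by
  -- Moves act on the front of the list; the nodes already turned are kept in `A` and are passed by
  -- reordering.
  have key : ∀ (n : ℕ) (A C E : Diagram), E ∈ turned n C → Leads (A ++ C) (A ++ E) := by
    intro n
    induction n with
    | zero =>
      intro A C E h
      obtain rfl : E = C := by simpa [turned] using h
      exact .refl _
    | succ n ih =>
      intro A C E h
      rcases C with _ | ⟨v, C⟩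
      · obtain rfl : E = [] := by simpa [turned] using h
        exact .refl _
      · simp only [turned, List.mem_flatMap, List.mem_map] at h
        obtain ⟨w, hw, E, hE, rfl⟩ := h
        have := ih (A ++ [w]) C E hE
        rw [List.append_assoc, List.append_assoc] at this
        exact (Leads.perm List.perm_middle).trans <| (leads_turns hw _).trans <|
          (Leads.perm List.perm_middle.symm).trans this
  exact key n [] C E h

/-- A marked point is erased. -/
def strip (a b : ℕ) (C : Diagram) : Option Diagram :=
  bif a.beq b then none else some (C.map (Node.map (fuse a b)))

/-- Move I at the first node. -/
def removeKink : Diagram → Option Diagram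
  | X x y a b :: C => bif x.beq y then strip a b C else bif y.beq a then strip x b C else none
  | _ => none

/-- Move II or move V at the first two nodes. -/
def removeBigon : Diagram → Option Diagram
  | X a c y x :: X y' d b x' :: C =>
    bif y.beq y' && x.beq x' then
      bif a.beq b then none else strip (fuse a b c) (fuse a b d) (C.map (Node.map (fuse a b)))
    else none
  | V a x y :: X p q r s :: C =>
    bif p.beq y && q.beq x then some (V a r s :: C)
    else bif p.beq x && s.beq y then some (V a q r :: C) else none
  | _ => none

/-- Move III, or move IV removing a crossing, at the first three nodes. -/
def passTriangle : Diagram → Option Diagram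
  | V a y z :: X p q r s :: X t u v w :: C =>
    bif p.beq y && t.beq z && u.beq s then some (V y r v :: X y w a q :: C)
    else bif s.beq y && t.beq r && w.beq z then some (V y q u :: X v a p y :: C) else none
  | X b m x y :: X p q r s :: X t u v w :: C =>
    bif p.beq x && t.beq y && u.beq s then some (X b s x w :: X x y r v :: X m q y s :: C)
    else bif p.beq x && t.beq m && w.beq q then some (X b u x q :: X x v r m :: X y q m s :: C)
    else none
  | _ => none

/-- Move IV adding a crossing, at the first two nodes; the labels are less than `n`. -/
def passVertex (n : ℕ) : Diagram → Option Diagram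
  | V x b c :: X p q r s :: C =>
    bif p.beq x then some (V r x n :: X x s b n.succ :: X n n.succ c q :: C)
    else bif s.beq x then some (V q x n :: X r b n.succ x :: X n.succ c p n :: C) else none
  | _ => none

/-! ### The operations on codes are Reidemeister moves -/

theorem leads_strip {a b : ℕ} {C E : Diagram} (h : strip a b C = some E) :
    Leads (P a b :: C) E := by
  rw [strip] at h
  cases hab : a.beq b <;> rw [hab] at h
  · obtain rfl := Option.some.inj h
    exact .erase (beq_false_iff.1 hab)
  · cases h

theorem leads_removeKink {D E : Diagram} (h : removeKink D = some E) : Leads D E := by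
  unfold removeKink at h
  split at h
  · rename_i x y a b C
    simp only [Bool.cond_eq_ite, beq_iff] at h
    split_ifs at h with h1 h2
    · subst h1
      exact (Leads.I a b x).trans (leads_strip h)
    · subst h2
      exact (Leads.I' x b y).trans (leads_strip h)
  · cases h

theorem leads_removeBigon {D E : Diagram} (h : removeBigon D = some E) : Leads D E := by
  unfold removeBigon at h
  split at h
  · rename_i a c y x y' d b x' C
    simp only [Bool.cond_eq_ite, beq_iff, Bool.and_eq_true] at h
    split_ifs at h with h1 h2
    obtain ⟨rfl, rfl⟩ := h1
    -- The two marked points left by move II are erased in turn; the first erasure may rename the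
    -- arcs at the second one.
    exact (Leads.II a b c d x y).trans <| (Leads.erase h2).trans (leads_strip h)
  · rename_i a x y p q r s C
    simp only [Bool.cond_eq_ite, beq_iff, Bool.and_eq_true] at h
    split_ifs at h with h1 h2
    · obtain ⟨rfl, rfl⟩ := h1
      obtain rfl := Option.some.inj h
      exact .V a r s q p
    · obtain ⟨rfl, rfl⟩ := h2
      obtain rfl := Option.some.inj h
      exact .V' a q r p s
  · cases h

theorem leads_passTriangle {D E : Diagram} (h : passTriangle D = some E) : Leads D E := by
  unfold passTriangle at h
  split at h <;> simp only [Bool.cond_eq_ite, beq_iff, Bool.and_eq_true, reduceCtorEq] at h <;>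
    split_ifs at h with h1 h2 <;> obtain rfl := Option.some.inj h
  · obtain ⟨⟨rfl, rfl⟩, rfl⟩ := h1
    exact .IVover _ _ _ _ _ _ _ _
  · obtain ⟨⟨rfl, rfl⟩, rfl⟩ := h2
    exact .IVbehind _ _ _ _ _ _ _ _
  · obtain ⟨⟨rfl, rfl⟩, rfl⟩ := h1
    exact .III _ _ _ _ _ _ _ _ _
  · obtain ⟨⟨rfl, rfl⟩, rfl⟩ := h2
    exact .III' _ _ _ _ _ _ _ _ _

theorem leads_passVertex {n : ℕ} {D E : Diagram} (hn : ∀ l ∈ labels D, l < n)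
    (h : passVertex n D = some E) : Leads D E := by
  unfold passVertex at h
  split at h
  · simp only [Bool.cond_eq_ite, beq_iff] at h
    split_ifs at h with h1 h2 <;> obtain rfl := Option.some.inj h
    · subst h1
      exact .IVover_symm _ _ _ _ _ _ _ hn
    · subst h2
      exact .IVbehind_symm _ _ _ _ _ _ _ hn
  · cases h

/-- One move. The last nonzero digits of `k` are the numbers of the nodes to which it applies; a
move that adds a crossing has the last digit zero. -/
def step (k : ℕ) (D : Diagram) : Option Diagram :=
  -- The last digit acts first, and the others count positions in the list as already reordered. A
  -- digit zero changes nothing.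
  let E := pull (k / 100) (pull (k / 10 % 10) (pull (k % 10) D))
  -- The sum of all labels is at least each of them, so its successor exceeds them all and gives
  -- fresh labels.
  bif (k % 10).beq 0 then (turned 2 E).findSome? (passVertex (labels D).sum.succ)
  else bif k.ble 9 then (turned 1 E).findSome? removeKink
  else bif k.ble 99 then (turned 2 E).findSome? removeBigon
  else (turned 3 E).findSome? passTriangle

theorem leads_findSome {f : Diagram → Option Diagram} {n : ℕ} {D E : Diagram}
    (hf : ∀ C ∈ turned n D, ∀ E, f C = some E → Leads C E)
    (h : (turned n D).findSome? f = some E) : Leads D E := by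
  obtain ⟨C, hC, h⟩ := List.exists_of_findSome?_eq_some h
  exact (leads_turned hC).trans (hf C hC E h)

theorem labels_turned {n : ℕ} {C E : Diagram} (h : E ∈ turned n C) :
    (labels E).Perm (labels C) := by
  induction n generalizing C E with
  | zero =>
    obtain rfl : E = C := by simpa [turned] using h
    rfl
  | succ n ih =>
    rcases C with _ | ⟨v, C⟩
    · obtain rfl : E = [] := by simpa [turned] using h
      rfl
    · simp only [turned, List.mem_flatMap, List.mem_map] at h
      obtain ⟨w, hw, E, hE, rfl⟩ := h
      refine .append (l₁ := w.labels) (l₂ := v.labels) ?_ (ih hE)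
      rcases v with ⟨a, b, c, d⟩ | ⟨a, b, c⟩ | ⟨a, b⟩ <;>
        simp only [Node.turns, List.mem_cons, List.not_mem_nil, or_false] at hw
      · rcases hw with rfl | rfl
        · rfl
        · exact List.perm_append_comm (l₁ := [c, d]) (l₂ := [a, b])
      · rcases hw with rfl | rfl | rfl
        · rfl
        · exact List.perm_append_comm (l₁ := [b, c]) (l₂ := [a])
        · exact List.perm_append_comm (l₁ := [c]) (l₂ := [a, b])
      · rw [hw]

theorem leads_step {k : ℕ} {D E : Diagram} (h : step k D = some E) : Leads D E := by
  have hp : D.Perm (pull (k / 100) (pull (k / 10 % 10) (pull (k % 10) D))) :=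
    ((pull_perm _ _).trans (pull_perm _ _)).trans (pull_perm _ _)
  refine (Leads.perm hp).trans ?_
  simp only [step, Bool.cond_eq_ite] at h
  split_ifs at h
  · refine leads_findSome (fun C hC E hE => leads_passVertex (fun l hl => ?_) hE) h
    have hl : l ∈ labels D :=
      (hp.flatMap_right Node.labels).mem_iff.2 ((labels_turned hC).mem_iff.1 hl)
    exact Nat.lt_succ_of_le (List.le_sum_of_mem hl)
  · exact leads_findSome (fun C _ E => leads_removeKink) h
  · exact leads_findSome (fun C _ E => leads_removeBigon) h
  · exact leads_findSome (fun C _ E => leads_passTriangle) h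

/-- Tests whether the diagram has no crossings. -/
def isTrivial (D : Diagram) : Bool :=
  (turned 2 D).any fun
    | [V a b c, V d e f] => a.beq d && b.beq f && c.beq e
    | _ => false

theorem theta_trivialTheta : Theta trivialTheta := isTheta_sound (by decide +kernel)

/-- A crossingless code is `trivialTheta` up to the names of its three arcs, the second vertex
showing them in reversed cyclic order. -/
theorem equiv_of_isTrivial {D : Diagram} (hD : Theta D) (h : isTrivial D = true) :
    ReidemeisterEquiv D trivialTheta := by
  obtain ⟨E, hE, h⟩ := List.any_eq_true.1 h
  obtain ⟨hE', hDE⟩ := leads_turned hE hD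
  refine .trans _ _ _ hDE ?_
  split at h
  · rename_i a b c d e f
    simp only [Bool.and_eq_true, beq_iff] at h
    obtain ⟨⟨rfl, rfl⟩, rfl⟩ := h
    have ha := hE'.twice a (by simp [labels, Node.labels])
    have hb := hE'.twice b (by simp [labels, Node.labels])
    simp only [labels, Node.labels, List.flatMap_cons, List.flatMap_nil, List.cons_append,
      List.nil_append, List.count_cons, beq_iff_eq, List.count_nil] at ha hb
    -- A relabelling has to be injective on all natural numbers. The labels other than 1, 2, 3 are
    -- moved beyond `a`, `b`, `c`; for the label 0 this works because at most one of `a`, `b`, `c`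
    -- is zero.
    let f : ℕ → ℕ := fun l =>
      if l = 1 then a else if l = 2 then b else if l = 3 then c else l + (a + b + c)
    have hf : f.Injective := fun l m h => by
      simp only [f] at h
      grind
    exact .symm _ _ (.rel _ _
      ⟨theta_trivialTheta.isThetaDiagram, hE'.isThetaDiagram, .relabel trivialTheta f hf⟩)
  · cases h

/-- Carries out moves, given by the digits of `k` in base 1000, and tests whether the result has no
crossings. -/
def unknots : ℕ → ℕ → Diagram → Bool
  | 0, _, _ => false
  | n + 1, k, D =>
    bif k.beq 0 then isTrivial D else
    match step (k % 1000) D with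
    | some E => unknots n (k / 1000) E
    | none => false

theorem equiv_of_unknots {n k : ℕ} {D : Diagram} (hD : Theta D) (h : unknots n k D = true) :
    ReidemeisterEquiv D trivialTheta := by
  induction n generalizing k D with
  | zero => cases h
  | succ n ih =>
    rw [unknots] at h
    cases hk : k.beq 0 <;> rw [hk] at h
    · simp only [cond_false] at h
      split at h
      · rename_i E hE
        have := leads_step hE hD
        exact .trans _ _ _ this.2 (ih this.1 h)
      · cases h
    · exact equiv_of_isTrivial hD h

/-! ### The table -/

/-- Tests what is claimed about an entry of the table. For each diagram, `K` has a list of numbers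
that describe how to unknot the diagrams obtained from it. -/
def ThetaEntry.check (t : ThetaEntry) (K : List (List ℕ)) : Bool :=
  !t.codes.isEmpty && t.codes.all₂ (fun d L =>
    isTheta (ofCode d.1) &&
    (ofCode d.1).map isCrossing = List.replicate t.crossings true ++ [false, false] &&
    !d.2.isEmpty && d.2.all₂ (fun s k =>
      (Nat.digits 10 s).Nodup && (Nat.digits 10 s).length = t.changes &&
      (Nat.digits 10 s).all (fun i => (1).ble i && i.ble t.crossings) &&
      -- Room for thirteen moves, the length of the longest recorded sequences, and for the final
      -- test.
      unknots 14 k (changeCrossings (Nat.digits 10 s) (ofCode d.1))) L) K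

/-- What is claimed about an entry of the table. -/
def ThetaEntry.Correct (t : ThetaEntry) : Prop :=
  t.codes ≠ [] ∧ ∀ d ∈ t.codes,
    IsThetaDiagram (ofCode d.1) ∧
    (ofCode d.1).map Node.isCrossing = List.replicate t.crossings true ++ [false, false] ∧
    d.2 ≠ [] ∧ ∀ s ∈ d.2,
      (Nat.digits 10 s).Nodup ∧ (Nat.digits 10 s).length = t.changes ∧
      (∀ i ∈ Nat.digits 10 s, 1 ≤ i ∧ i ≤ t.crossings) ∧
      ReidemeisterEquiv (changeCrossings (Nat.digits 10 s) (ofCode d.1)) trivialTheta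

/-- The recorded sequences serve as witnesses only, so it does not matter which one belongs to which
set of crossings. -/
theorem exists_of_all₂ {α β : Type*} {r : α → β → Bool} {A : List α} {B : List β}
    (h : A.all₂ r B = true) : ∀ a ∈ A, ∃ b ∈ B, r a b = true := by
  induction A generalizing B with
  | nil => simp
  | cons a A ih =>
    cases B with
    | nil => cases h
    | cons b B =>
      replace h : r a b = true ∧ A.all₂ r B = true := by simpa [List.all₂] using h
      simp only [List.forall_mem_cons]
      exact ⟨⟨b, by simp, h.1⟩, fun a ha => (ih h.2 a ha).imp fun _ h => ⟨.tail _ h.1, h.2⟩⟩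

theorem ThetaEntry.correct_of_check {t : ThetaEntry} {K : List (List ℕ)}
    (h : t.check K = true) : t.Correct := by
  simp only [check, Bool.and_eq_true, Bool.not_eq_true', List.isEmpty_eq_false_iff] at h
  refine ⟨h.1, fun d hd => ?_⟩
  obtain ⟨L, -, hL⟩ := exists_of_all₂ h.2 d hd
  simp only [Bool.and_eq_true, Bool.not_eq_true', List.isEmpty_eq_false_iff,
    decide_eq_true_eq] at hL
  obtain ⟨⟨⟨h1, h2⟩, h3⟩, h4⟩ := hL
  have hD := isTheta_sound h1
  refine ⟨hD.isThetaDiagram, h2, h3, fun s hs => ?_⟩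
  obtain ⟨k, -, hk⟩ := exists_of_all₂ h4 s hs
  simp only [Bool.and_eq_true, decide_eq_true_eq, List.all_eq_true, Nat.ble_eq] at hk
  obtain ⟨⟨⟨h5, h6⟩, h7⟩, h8⟩ := hk
  exact ⟨h5, h6, h7, equiv_of_unknots (theta_changeCrossings hD) h8⟩

/-- How to unknot the diagrams in `table3` after the crossing changes. -/
def unknotting3 : List (List (List ℕ)) := [
  [[22023422, 1033, 1032],
  [21031, 21032, 21023]]]

/-- Here, and for the other parts of the table, the initial codes are tested and the recorded
sequences carried out. -/
theorem table3_check : table3.all₂ ThetaEntry.check unknotting3 = true := by decide +kernel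

/-- How to unknot the diagrams in `table4` after the crossing changes. -/
def unknotting4 : List (List (List ℕ)) := [
  [[22023024522, 22023024522, 21002043, 21002044],
  [22023433001423, 22023431001434, 1001044, 1001043],
  [22031041, 1002033, 1002032, 22031024]]]

theorem table4_check : table4.all₂ ThetaEntry.check unknotting4 = true := by decide +kernel

/-- How to unknot the diagrams in `table5` after the crossing changes. -/
def unknotting5 : List (List (List ℕ)) := [
  [[22023334025622, 22022041044, 22022041043, 22023342023735]],
  [[22022032622, 22022052741],
  [22023042035, 22022041044, 22022041043, 22023042052],
  [22023334025622, 22022041043, 22022041044]],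
  [[22023423034, 22023422045, 22023423042, 22023422053, 1033034, 1033055, 1032034, 1032045, 1032054,
  1032042],
  [21021031, 21031053, 21021034, 21033031, 21021023, 21032054, 21032045, 21022023, 21033023,
  21033034]],
  [[1022025, 1021025, 22023431025, 22023422054, 1033033, 1031033, 1033032, 1031032, 22023431051]],
  [[22023024024622, 22023024024622],
  [22024025025344083610, 22024025025344083610],
  [22023041041, 22023041024]],
  [[21002002054, 21002002055],
  [21002003043, 21002003044],
  [1002002055, 1002002054],
  [1002003033, 1002003032]],
  [[22031001054, 22031001055]]]

theorem table5_check : table5.all₂ ThetaEntry.check unknotting5 = true := by decide +kernel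

/-- How to unknot the diagrams in `table6` after the crossing changes. -/
def unknotting6 : List (List (List ℕ)) := [
  [[22022022032722, 22023434001535023841, 22022042003066, 22022042003065],
  [22022023032722, 22022024062841, 21002034063452],
  [22023023352025722, 22022022051043, 22022022051044, 22023024332024865],
  [22023334025025722, 22022022051043, 22022022051044, 22032041065, 22032041066],
  [22022024051051, 22022023052062, 22022023051044, 22022023051043, 22022024051025, 22022023052036]],
  [[22023334025025722, 22022022051044, 22022022051043],
  [22024024633024722, 22024025632023841],
  [22023023334025722, 22023024342023835]],
  [[22023022032722],
  [22022022051044, 22022022051043],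
  [22023022051043, 22023022051044],
  [22024024633024722],
  [22023023334025722]],
  [[22023022051044, 22023022051043]],
  [[22023024025024722, 22023024025024722],
  [22024025026025344093710, 22024025026025344093710],
  [22023023051041, 22023023051024]],
  [[21002003003065, 21002003003066],
  [21002003004043, 21002003004044],
  [1002001003066, 1002001003065],
  [1002003002055, 1002003002054],
  [1002003003033, 1002003003032]],
  [[22023041002063, 22023041002046]],
  [[22031003001065, 22031003001066],
  [22031001004064, 22031001004056]],
  [[21031001062336445],
  [22023334051035342],
  [22024345023072843344],
  [22024343062023844546]],
  [[1001034062556],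
  [1001034062454],
  [1023001046643],
  [1023001036546],
  [21001042036455],
  [21031001063633]],
  [[21002034034362]],
  [[22031041056, 22031041066, 22031041064, 1002034033, 1002044033, 1002042033, 1002034032,
  1002044032, 1002042032, 22031024056, 22031024065, 22031024064],
  [22023024524062, 22023024522065, 22023024524036, 21002042043, 21002042044, 22023024524062,
  22023024522066, 21002043043, 21002032036, 21002043044, 21002033036, 22023024524036],
  [22023433001423036, 22023433001423046, 22023433001423062, 22023431001434036, 1001044036,
  1001043036, 22023431001434063, 1001044046, 1001043046, 22023431001434062, 1001042055, 1001042054],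
  [1002022025, 1002021025, 22031043025, 22031041054, 22031044025, 1002033033, 1002031033,
  1002033032, 1002031032, 22031043051, 22031024055, 22031044051]],
  [[22023422001063541],
  [22023422001062365]],
  [[22024025354072844546, 1023001046643],
  [22023431001421062445, 1001034063452],
  [1023001036546, 22024344032743071342],
  [22031042035342, 1001034062454],
  [22023024632036344, 21001042046441],
  [21031001063633, 21031001062336446],
  [22023023633036545, 21001042035466]],
  [[22023023642063541, 21002042045352]],
  [[22023422001036355],
  [22024344062631001635],
  [22023423001341001525001446],
  [22024344062632001466],
  [22023422001062525]]]

theorem table6_check : table6.all₂ ThetaEntry.check unknotting6 = true := by decide +kernel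

/-- How to unknot the diagrams in `table7a` after the crossing changes. -/
def unknotting7a : List (List (List ℕ)) := [
  [[22023022022032822, 22032003052037566],
  [22022022022061044, 22022022022061043, 2033335061036352],
  [22022022022061043, 22022022022061044, 21002003052036352]],
  [[22022022022061044, 22022022022061043, 21002003052036352]],
  [[22023334025026025822, 22023022022061044, 22023022022061043],
  [22024025024733024822, 22024025025732023941],
  [22023023023334025822, 22023024025342023935]],
  [[22022041052035342, 22023333025634072454],
  [22023342023642062525, 22023334023734063354]],
  [[22023334025622067, 22023334025622077, 22023334025622075, 22022041045044, 22022041055044,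
  22022041053044, 22022041045043, 22022041055043, 22022041053043, 22023342023735067,
  22023342023735076, 22023342023735075],
  [22023332023622046, 22023342024622067, 22023332023622063, 22023342024622075, 22023333023731046,
  22022042055046, 22022042045077, 22022042054046, 22023334023741067, 22023333023731063,
  22023334023741075, 22022042053067, 22022042053076, 22022042054063]],
  [[22023022022032822, 22024025024444083081342],
  [22022024023032822, 22022024025062941],
  [22023334025026025822, 22023022022061043, 22023022022061044],
  [22023023352026025822, 22023022022061044, 22023022022061043],
  [22022024024061051, 22022022023061043, 22022022023061044, 22022024024061025]],
  [[22022042003005077, 22022042003005076],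
  [22022042004003066, 22022042004003065],
  [22032041005076, 22032041005077],
  [22032003041075, 22032003041067],
  [22031002055076, 22031002055077],
  [22022023051002065, 22022023051002066]],
  [[22022052622053, 22022052622045, 22022032622076, 22022032622067, 22022042731053, 22022042731045,
  22022052741076, 22022052741067],
  [22023334025622067, 22023334025622077, 22023334025622075, 22022041045043, 22022041055043,
  22022041053043, 22022041045044, 22022041055044, 22022041053044],
  [22022041035053341, 22023342024622077, 22023342024622076, 23023035733024822, 22022035342024822,
  22022042053077, 22022042053076, 22022042045077, 22022042045076],
  [22022041023024, 22022041031024, 22023042053024, 22022043034035, 22022041031035, 22022043042035,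
  22022043042046, 22022042054046, 22022041031041, 22023042053041, 22022043042052, 22022042054063]],
  [[22023022023032822],
  [22022022022061043, 22022022022061044],
  [22022022023062036, 22022022023062062]],
  [[22023334022026366822, 22032024005076, 22032024005077, 22023333022061044, 22031003054044,
  22031003055044, 22023333022061043, 22031003054043, 22031003055043],
  [22032003024075, 22023334022026366822, 22032003024067, 22031003053044, 22023333022061044,
  22031003045044, 22031003053043, 22023333022061043, 22031003045043],
  [22023422004003076, 22023422004003077, 22024345062342024822, 22024353032733024822, 1033004003076,
  1033004003077, 22024343062334023941, 22024344032732023941, 1032004003076, 1032004003077],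
  [22023422003005075, 22023422003005067, 22022042622046, 1002001034075, 22022042622063,
  1002001034067, 22022052731046, 1002001042075, 22022052731063, 1002001042067],
  [22023422004005073, 22023422004005047, 1033004005073, 22022032622066, 22022032622065,
  1033004005047, 1032004005073, 22022052741066, 22022052741065, 1032004005047]],
  [[22022024022032822, 22022022052003066, 22022022052003065],
  [22023022023032822, 22023023332061063452],
  [22023434001433026025822, 22022022051004044, 22022022051004043],
  [22023023352026025822, 22023022022061043, 22023022022061044],
  [22022023022061043, 22022023022061044, 22022042041075, 22022042041067],
  [22024024633026024822, 22023441001535071074, 22023441001535071057],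
  [22023024023334025822, 22023024024333023954],
  [22023023334026025822, 22023042041075, 22023042041067],
  [22022024024061051, 22022022023061044, 22022022023061043, 22022024024061025]],
  [[22023023022061044, 22023023022061043]],
  [[22023333023061035342, 22023333022026356845454],
  [22022042633062525, 22022035734063354],
  [22024353032734023853525, 22024344032742023935354]],
  [[22024024633026024822],
  [22023023334026025822],
  [22022022023062062, 22022022023062036]],
  [[22023024342061062361, 22023342024073073, 22023024024622054, 22023024024622055,
  22023342024073047, 22032001035073, 22023024024622054, 22023024024622055, 22032001035047,
  22032001052073, 22032001052047],
  [22023024342073047, 22023024023742037355, 22023024342073073, 22031003035036, 22023024344061036,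
  22023024344061036, 22031003052036, 22023024342073047, 22031003052047, 22023024023633046524,
  22023024344061062, 22023024344061062, 22023024342073073, 22031003052062],
  [22023043031024, 22023043023024, 22022042054024, 22022042055024, 22023043031041,
  22023024333032822, 2034343075076, 2034343075077, 22023043023041, 22022042054041, 22022042055041],
  [22023052622063, 2032333032822, 22023052622046, 22023032622077, 22023052743063, 22023052743046,
  22023035745077],
  [22023332023622024, 22022042055024, 22022042054024, 22023332023622041, 2034343075077,
  2034343075076, 22022042055041, 22022042054041],
  [22023023434073653822, 22003042032822, 22003034032822, 22023343023032822, 23024062744025833,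
  22023052352025833, 22002034072924, 22023023434047664924, 22023033366027957],
  [22024024363032867822, 22023024335072077, 22023024335072076, 22023332022061043, 22031003055043,
  22031003054043, 22023332022061044, 22031003055044, 22031003054044, 22023024335072077,
  22023024335072076],
  [22024345032027875822, 22024345032027875822, 22023333022061043, 22031003054043, 22031003055043,
  22023333022061044, 22031003054044, 22031003055044, 22023342023071072465],
  [22022042024067, 22022042024075, 22022041045044, 22022041055044, 22022041053044, 22022041045043,
  22022041055043, 22022041053043],
  [22023342024062024, 22031001045024, 22031001053024, 22023342024062041, 22023344024075067,
  22023344024075075, 22031001045041, 22031001053041]],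
  [[22022032622057, 22022032622067, 22022032622074, 22022052741057, 22022052741075, 22022052741074],
  [22023042035075, 22023042035076, 22023042035067, 22022041053044, 22022041054044, 22022041045044,
  22022041053043, 22022041054043, 22022041045043, 22023042052075, 22023042052077, 22023042052067],
  [22023332023622063, 22023342024622075, 22023332023622046, 22023342024622067, 22022042054063,
  22022042053076, 22022042053067, 22022042054046, 22022042045077, 22022042055046],
  [22023042053024, 22023042054024, 22023042045024, 22022042045075, 22022042045076, 22022042045067,
  22023042053041, 22023042054041, 22023042045041, 22022042053075, 22022042053077, 22022042053067],
  [22023041052043, 22023041052044, 22023334025625072, 22023334025622077, 22022041054043,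
  22023041032037, 22022041054044, 22023041033037, 22023334025625037]],
  [[22023342024062024, 22031001045024, 22031001053024, 22023342024062041, 22023344024075067,
  22023344024075075, 22031001045041, 22031001053041],
  [22023334062003076, 22023334062003077, 22023332051001054, 22023332051001055, 21002001054054,
  21002001055054, 21002001054055, 21002001055055],
  [22023332061003073, 22023332061003047, 21002002053065, 21002002053066, 22023333051002065,
  22023333051002066, 21002002054047, 21002002055047],
  [22023041033037, 22023041032037, 22022041055044, 22023041052044, 22022041055043, 22023041052043],
  [22023332051005044, 22023332051005043, 21002002044044, 21002002043044, 21002002044043,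
  21002002043043, 22023344061002066, 22023344061002065]],
  [[22031003053051, 22031003054051, 22031003041057, 22031003053025, 22031003054025, 22031003045025],
  [22031003045051, 22031003055051, 22031003053051, 1002002055032, 1002002054032, 1002002055033,
  1002002054033, 22031003045025, 22031003055025, 22031003053025],
  [22031003041055, 22031003041054, 22031003054061, 1002003033032, 1002003032032, 1002003033033,
  1002003032033, 22031003044026, 22031003043026, 22031003054026],
  [22023342022074075, 22023342022074067, 22031002054063, 22031002053067, 22031002054046,
  22031002055046],
  [22024025654622057, 22024025655622077, 22024025654622074, 22003032622057, 22002032622077,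
  22003032622074],
  [22003042032822, 22023342061004076, 22023342061004077, 21002002053076, 21002002053077,
  21002002045076, 21002002045077],
  [21001024004077, 21001024004076, 22003034032822, 22023344063004077, 22023344063004076,
  21001041004077, 21001041004076],
  [2032522005076, 2032522005077, 22031003043043, 22031003044043, 22031003055043, 22031003043044,
  22031003044044, 22031003055044],
  [2033522005077, 2033522005076, 22031003044044, 22031003043044, 22031003054044, 22031003044043,
  22031003043043, 22031003054043],
  [2003052721067, 2003052721077, 2003052721075, 22031003045043, 22031003055043, 22031003053043,
  22031003045044, 22031003055044, 22031003053044],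
  [2003035721075, 2003035721076, 2003035721067, 22031003053044, 22031003054044, 22031003045044,
  22031003053043, 22031003054043, 22031003045043],
  [2032522005065, 2032522005066, 22031003043043, 22031003044043, 22031003055043, 22031003043044,
  22031003044044, 22031003055044],
  [2033522005066, 2033522005065, 22031003044044, 22031003043044, 22031003054044, 22031003044043,
  22031003043043, 22031003054043],
  [21002002031024, 21002002023024, 22022042054024, 22022042055024, 21002002031041, 21002002023041,
  22022042054041, 22022042055041],
  [22022042044024, 22022042043024, 2034343075066, 2034343075065, 22022042044041, 22022042043041]]]

theorem table7a_check : table7a.all₂ ThetaEntry.check unknotting7a = true := by decide +kernel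

/-- How to unknot the diagrams in `table7b` after the crossing changes. -/
def unknotting7b : List (List (List ℕ)) := [
  [[22023024022032822],
  [22023022022061044, 22023022022061043],
  [22023023022061043, 22023023022061044],
  [22024025024733024822],
  [22023023023334025822]],
  [[22022022052003077, 22022022052003076],
  [22022041045044, 22022041045043],
  [22023342023342027975],
  [22022022022061044, 22022022022061043]],
  [[22022023022061044, 22022023022061043]],
  [[22024353064032822, 22023342061004075, 22023342061004067, 21002002054063, 21002002053067,
  21002002054046, 21002002055046],
  [22023342061004074, 22024355064032822, 22023342061004057, 21002003053063, 21002003053057,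
  21002003053046, 21002003045046],
  [2033522005077, 2033522005076, 22023333022061044, 22031003055044, 22031003054044,
  22023333022061043, 22031003055043, 22031003054043],
  [2033522005067, 2033522005075, 22031003045044, 22023333022061044, 22031003053044, 22031003045043,
  22023333022061043, 22031003053043],
  [22024345062342024822, 22024353032733024822, 22023422004003077, 22023422004003076, 1033004003077,
  1033004003076, 1032004003077, 1032004003076],
  [22022034622063, 22023422003005067, 22022034622046, 22023422003005075, 1002001034067,
  1002001034075, 1002001042067, 1002001042075],
  [22024353062062024, 22032003055024, 22032003054024, 2032522005077, 2032522005076,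
  22024353062062041, 22032003055041, 22032003054041],
  [22032003044024, 22032003043024, 22024353062062024, 2032522005066, 2032522005065, 22032003044041,
  22032003043041, 22024353062062041],
  [22023422004005047, 22022033622065, 22022033622066, 22023422004005073, 1033004005047,
  1033004005073, 1032004005047, 1032004005073],
  [1002041005037, 1002041005072, 22031003032037, 22031003033037, 1002024005037, 22024354063061043,
  22031003052043, 22024354063061044, 22031003052044, 1002024005072],
  [1002001051077, 1002001051076, 22024345063061043, 22024345063061044, 22031002055043,
  22031002054043, 22031002055044, 22031002054044, 1002001025077, 1002001025076]],
  [[22022041031024, 22022041023024, 22023042045024, 22022041031041, 21001003054063, 21001003053067,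
  22022041023041, 22023042045041, 21001003054046, 21001003055046],
  [2002052622047, 2002032622077, 2002052622073, 22031001043047, 22031001044047, 22031001055054,
  22031001053054, 22031001055055, 22031001053055],
  [2002033624035, 2002033624052, 2002033622065, 22032002053035, 22032002045035, 22032002053052,
  22032003054065, 22032002042057, 22032003054057],
  [1002002031024, 22023423052024, 1002002023024, 22023422054024, 22023423035024, 1002002031041,
  22023423052041, 1002002023041, 22023422054041, 22023423031047],
  [1002041005072, 1002041005037, 22031003052044, 22031003052043, 1002024005072, 22024354063061044,
  22031003033037, 22024354063061043, 22031003032037, 1002024005037],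
  [1002001051076, 1002001051077, 22024345063061044, 22024345063061043, 22031002054044,
  22031002055044, 22031002054043, 22031002055043, 1002001025076, 1002001025077]],
  [[1002002031024, 1002002023024, 22023052622047, 1002002031041, 22023032622077, 22023052622073,
  22023052743047, 1002002023041, 22023035745077, 22023052743073]],
  [[22023422033034, 22023423035056, 22023422032034, 22023423055034, 22023423053034, 22023422032045,
  22023422045067, 22023422043045, 22023422054045, 22023422032042, 22023423055042, 22023423053042,
  22023422043053, 22023422054053, 22023423052064, 1033044045, 1033045034, 1033033034, 1032033034,
  1032035056, 1033055077, 1033054056, 1033032034, 1032032034, 1032053034, 1033045042, 1033032045,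
  1032032045, 1032054067, 1032054076, 1032043045, 1033032042, 1032032042, 1032053042, 1032043053],
  [21031032042, 21031042031, 21031021031, 21032021031, 21023021031, 21031032034, 21031053075,
  21031043056, 21031055053, 21031021034, 21032021034, 21023021034, 21032034031, 21033055031,
  21023034031, 21031042023, 21031021023, 21032021023, 21023021023, 21032043045, 21032054076,
  21032054067, 21032032045, 21021025045, 21033045042, 21031022023, 21032022023, 21023022023,
  21032034023, 21033055023, 21023034023, 21032033034, 21023033034, 21033045034, 21033025045]],
  [[1023024025, 22023433024025, 22023423043036, 1022055025, 1031024025, 22023421035025,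
  22023422043047, 1031035025, 1021054025, 22023433041025, 22023421052025, 22023423042054,
  22023422053054, 1031041025, 1033035036, 1031035036, 22023433041036, 1033055055, 1032044036,
  1022055051, 1031041036, 22023421041047, 1032044047, 1032054055, 1031041047, 1021054051,
  22023433041051, 22023421052051, 1032042055, 1031041051]],
  [[1022022025, 1023045033, 1021022025, 1032022025, 1022021025, 1023045032, 1021021025, 1032021025,
  22023422055056, 22023431055025, 22023431044025, 22023422054067, 22023422054076, 22023431043025,
  1021034033, 1033055033, 1032034033, 1021031033, 1032031033, 1032042033, 1021034032, 1033055032,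
  1032034032, 1021031032, 1032031032, 1032042032, 22023431055051, 22023431041056, 22023431051075,
  22023431043051]],
  [[22023024025025024822, 22023024025025024822],
  [22022022022022022023893931931831634810, 22022022022051001092339339338456810],
  [22023024023061041, 22023024023061024]],
  [[21002003002004076, 21002003002004077],
  [21002003004003065, 21002003004003066],
  [21002003004004043, 21002003004004044],
  [1002003002004077, 1002003002004076],
  [1002003004002055, 1002003004002054],
  [1002003004003033, 1002003004003032]],
  [[22023041002002076, 22023041002002077],
  [22023041002005073, 22023041002005047]],
  [[22023023051002063, 22023023051002046]],
  [[22031001004004076, 22031001004004077],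
  [22031001004005064, 22031001004005056]],
  [[21002002054064, 21002002054076, 21002002054067, 21002002054056, 21002002055077, 21002002055056],
  [21002003053063, 21002003043076, 21002003053057, 21002003053046, 21002003044077, 21002003045046],
  [1002002055056, 1002002055077, 1002002054056, 1002002054067, 1002002054076, 1002002054064],
  [1002003035036, 1002003033077, 1002003052036, 1002003052047, 1002003032076, 1002003052062]],
  [[22023024024721034, 22024025024343042230082822, 22023024024721042, 22023024024721034,
  22024025024343042230082822, 22023024024721042],
  [22023024024624035, 22023024024624052, 22023024024622065, 22023024024622066, 22023024024624035,
  22023024024624052],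
  [22023042021031, 22024025025344043230032343042920333810, 22023042021034, 22023042021023,
  22024025025344043230032343042920333810, 22023042022023],
  [22024025024363082610031, 22024025024344083610063, 22024025024363082610031,
  22024025024363082610023, 22024025024344083610046, 22024025024363082610023],
  [22023041041074, 22023041053041, 22023041045041, 22023041053024, 22023041045024, 22023041024057]],
  [[22023024024631025, 22023024024631025, 22023024024622054, 22023024024622055, 22023024024631051,
  22023024024631051]],
  [[22031001054064, 22031001054076, 22031001054067, 22031001054056, 22031001055077,
  22031001055056]],
  [[1001001035335324033, 1001001035335324032, 1001001045531421033, 1001001045531421032],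
  [1002002022025, 1002002021025, 1002002031033, 1002002031032]]]

theorem table7b_check : table7b.all₂ ThetaEntry.check unknotting7b = true := by decide +kernel

/-- How to unknot the diagrams in `table7c` after the crossing changes. -/
def unknotting7c : List (List (List ℕ)) := [
  [[22024025024443082931, 22024025025444082822, 22024025025444082822, 22024025025444082822,
  22024025025444082822, 22024025024443082931, 21002002054067, 21002002054077, 21002002054075,
  21002002055067, 21002002055076, 21002002055075],
  [22024025024345082931, 22024025025353082822, 22024025025353082822, 22024025025353082822,
  22024025025353082822, 22024025024345082931, 21002002054057, 21002002055057, 21002002054076,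
  21002002055077, 21002002054074, 21002002055074],
  [22023043031035, 22024025026455082822, 22023043031052, 22023043023035, 22024025026455082822,
  21002003053046, 21002003043077, 21002003045046, 22023043023052, 21002003053063, 21002003044076,
  21002003045063],
  [22024025025344083610035, 22024025025353082822, 22024025025353082822, 22024025025353082822,
  22024025025353082822, 21002003053057, 22024025025344083610052, 21002003043077, 21002003053074,
  21002003045057, 21002003044076, 21002003045074],
  [22023024023621031, 22024025026027348093750001337337546, 22023024023621031, 22023024023621023,
  22023423001332001047731643, 22023024023621023, 1002002055075, 1002002055076, 1002002055067,
  1002002054075, 1002002054077, 1002002054067],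
  [22023024024631041, 22023024024622054, 22023024024631041, 1002003035073, 22023024024631024,
  22023024024622055, 1002003033076, 1002003035047, 1002003052073, 1002003032077, 22023024024631024,
  1002003052047]],
  [[22023024024624062, 22023024024731073, 22023024024731074, 22023024024622065, 22023024024624036,
  22023024024731047, 22023024024624062, 22023024024622066, 22023024024731073, 22023024024731057,
  22023024024731047, 22023024024624036],
  [22024025025344083610036, 22024025025344083610046, 22023041041057, 22023041041067,
  22024025025344083610062, 22023041041074, 22024025025344083610036, 22024025025344083610063,
  22024025025344083610062, 22023041024057, 22023041024075, 22023041024074],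
  [22023041043025, 22023041041054, 22023041044025, 22023041052037, 22023041035037, 22023041052073,
  22023041035047, 22023041052072, 22023041043051, 22023041024055, 22023041044051, 22023041035072]],
  [[22032001041025, 22032001024025, 22032001041051, 22023342025026366822, 22031002053057,
  22023334024026377944, 22031002053074, 22031002045057, 22032001024051, 22031002045074]],
  [[21002003051037, 21002003051072, 21002003025037, 21002003043055, 21002003043054, 21002003044055,
  21002003044054, 21002003025072]],
  [[1001001052335323033, 1001001052335323032, 1001001053531321033, 1001001053531321032,
  22031001054067, 22031001054077, 22031001054075, 22031001055067, 22031001055076, 22031001055075],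
  [1002002041033, 1002002041032, 1002002024033, 1002002024032, 22031001054057, 22031001055057,
  22031001054075, 22031001055067, 22031001054074, 22031001055074]],
  [[22023024024622067, 22023024024622077, 22023024024622075, 22023024024622067, 22023024024622077,
  22023024024622075],
  [22023024024622057, 22023024024622067, 22023024024622074, 22023024024622057, 22023024024622067,
  22023024024622074],
  [22023024023622046, 22023024024622066, 22023024023622063, 22023024023622046, 22023024024622066,
  22023024023622063],
  [22024025025344083610075, 22024025025344083610076, 22024025025344083610067,
  22024025025344083610075, 22024025025344083610076, 22024025025344083610067],
  [22024025025344083610074, 22024025025344083610075, 22024025025344083610057,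
  22024025025344083610074, 22024025025344083610075, 22024025025344083610057],
  [22023041053041, 22023041054041, 22023041045041, 22023041053024, 22023041054024, 22023041045024],
  [22023043031041, 22023043031035, 22023041045041, 22023043031024, 22023043023024, 22023041045024]],
  [[22023422004004077, 22023422004004076, 1033004004077, 1033004004076, 1032004004077,
  1032004004076],
  [22023422004005066, 22023422004005065, 1033004005066, 1033004005065, 1032004005066,
  1032004005065],
  [22023422004005056, 22023422004005064, 1033004005056, 1033004005064, 1032004005056,
  1032004005064],
  [22023422003003077, 22023422003003076, 1002002055035, 1002002054035, 1002002055052,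
  1002002054052],
  [22023422003005046, 22023422003005063, 1002003034035, 1002003042035, 1002003042046,
  1002003042052],
  [22023422003005057, 22023422003005074, 1002001045035, 1002001053035, 1002001042057,
  1002001053052],
  [21002002054031, 21002002055031, 21032004004076, 21032004004077, 21002002054023, 21002002055023],
  [21002003043031, 21002003044031, 21032004005065, 21032004005066, 21002003043023, 21002003044023],
  [21001001054041, 21001001055041, 21001001054024, 21001001055024, 21002002054055, 21002002055055],
  [21001003052041, 21001003031047, 21001003052024, 21002003053055, 21001003035024, 21002003044047]],
  [[21002003053043, 21002003054043, 21002003045043, 21002003053044, 21002003054044, 21002003045044],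
  [21002002053065, 21002002053066, 21002002054065, 21002002054066, 21002002054047, 21002002055047],
  [1002001045044, 1002001055044, 1002001053044, 1002001045043, 1002001055043, 1002001053043],
  [1002003045033, 1002003055033, 1002003053033, 1002003045032, 1002003055032, 1002003053032],
  [1002003035033, 1002003045033, 1002003052033, 1002003035032, 1002003045032, 1002003052032],
  [21002003042043, 21002003042044, 21002003043043, 21002003032036, 21002003043044, 21002003033036],
  [1002002055036, 1002002054036, 1002002055046, 1002002054046, 1002002052067, 1002002054062],
  [1002001044037, 1002001043037, 1002001044047, 1002001043047, 1002001052055, 1002001052054],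
  [1002003022025, 1002003021025, 1002003033033, 1002003031033, 1002003033032, 1002003031032]],
  [[2032335026026822, 22023024024622055, 22023024024622054, 22023024024622055, 22023024024622054]],
  [[22031001053054, 22031001053055, 22031001054054, 22031001043047, 22031001054055, 22031001044047],
  [22031002052051, 22031003054051, 22031002041047, 22031002052025, 22031003054025, 22031002035025]],
  [[22031003053051, 22031003054051, 22031003041057, 22031003053025, 22031003054025,
  22031003045025]],
  [[22023422004004077, 22023422004004076, 1002002055033, 1002002054033, 1002002055032,
  1002002054032],
  [22023422004005066, 22023422004005065, 1002001044033, 1002001043033, 1002001044032,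
  1002001043032],
  [22023422004005055, 22023422004005054, 1002003033033, 1002003032033, 1002003033032,
  1002003032032]]]

theorem table7c_check : table7c.all₂ ThetaEntry.check unknotting7c = true := by decide +kernel

/-- How to unknot the diagrams in `table7d` after the crossing changes. -/
def unknotting7d : List (List (List ℕ)) := [
  [[22023423001341001035337636445],
  [22024343052364085093931653910],
  [22023423001341001521072337445],
  [22024025632061035342],
  [22023425001644032843081342],
  [22023024334061035342],
  [22024024443023082943344],
  [22024025346023082943344],
  [22023435001645032353094041653910],
  [22024025343072023944547],
  [22024025445072023944547]],
  [[21002001052037566],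
  [21002001052037677],
  [21002041001072667],
  [21002041001073755],
  [21002041001072646],
  [21002041001073653],
  [1001001035072667],
  [1001024001047754],
  [1002001034072567],
  [1002001034072465],
  [1002023001047635],
  [1002023001037466]],
  [[1001045533071053472],
  [21002003034034362]],
  [[22023024521001072446],
  [22023024522001062365],
  [22023024623001072446],
  [22023024631001062365]],
  [[22023024342061046362]],
  [[2042332025025822, 22024024633073074, 22024024633073057, 22024024633073074, 22024024633073057,
  22031001054065, 22031001054066, 22031001054057, 22031001055057]],
  [[22023024521001073652],
  [22023024521001072465],
  [22023452001645072823001743],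
  [22023452001645072833001547],
  [22023431001424001037466],
  [22031021001047754],
  [22031001052047551],
  [22023431001331001351001635001633],
  [22023431001424001073733],
  [22023024521001047635],
  [22023024521001037466],
  [22031041001062525]],
  [[22023422004004076, 22023422004004077, 1001001045433033, 1001001035444033, 1002002054033,
  1002002055033, 1001001045433032, 1001001035444032, 1002002054032, 1002002055032],
  [22023422004005065, 22023422004005066, 1002003035033, 1002003043033, 1002003044033, 1002003052033,
  1002003035032, 1002003043032, 1002003044032, 1002003052032],
  [21031004002077, 21031004002076, 1001053533071043, 1001053533071044, 1001052445071043,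
  21002002055043, 21002002054043, 1001052445071044, 21002002055044, 21002002054044],
  [21001003041067, 21001003041075, 21002003042043, 21002003042044, 21002003045043, 21002003032036,
  21002003053043, 21002003045044, 21002003033036, 21002003053044],
  [21031004005037, 21031004005072, 21002003032037, 21002003033037, 21002003043043, 21002003044043,
  21002003052043, 21002003043044, 21002003044044, 21002003052044],
  [22023423002002076, 22023423002002077, 1001044322001055, 1001044322001054, 1001034333001055,
  1001034333001054, 1001001054055, 1001001055055, 1001001054054, 1001001055054],
  [22023423002005062, 22023423002005036, 1002001042055, 1002001042054, 1002001044047, 1002001043047,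
  1002001044036, 1002001053055, 1002001043036, 1002001053054],
  [1001002041033, 1001002041032, 22023431003004061, 1002003033033, 1002003032033, 1001002022026,
  1002003033032, 1002003032032, 1001002021026, 22023431003004026],
  [1001034324005033, 1001034324005032, 1001044421005033, 1001001043033, 1001001044033,
  1001044421005032, 1001001043032, 1001001044032, 22023431003001065, 22023431003001066]],
  [[22031003045051, 22031003055051, 22031003053051, 1002002055033, 1002002054033, 1002002055032,
  1002002054032, 22031003045025, 22031003055025, 22031003053025],
  [22031003041055, 22031003041054, 22031003054061, 1002003033033, 1002003032033, 1002003033032,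
  1002003032032, 22031003044026, 22031003043026, 22031003054026]],
  [[22024355025062375096001948653910, 21002041001072667],
  [22024025025354082944546, 21002001052037564],
  [22024024026373082640001361001737445, 21002041001073755],
  [22024025024353082620062445, 21002001052037677],
  [22024025344032843081342, 21002041001073653],
  [22024024463032843081342, 21002001052047574],
  [21002041001072646, 22023434001535061035342],
  [22023041052035342, 21002001052037675],
  [22023425001646023082943344, 1001024001047754],
  [22023024024732036344, 1001001035073563],
  [22024025344032353094041653910, 1002023001037466],
  [22023423001341001035337637446, 1002001035062462],
  [1002023001047635, 22023452001645072023944545],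
  [22023024023733037547, 1002001034072465]],
  [[22024024024373082640001336526001446, 22023024631001037355],
  [22024025344072731001635, 22024025343072833001547],
  [22024024026373082640001631625001446, 22023024631001047551],
  [22023342025026374953355, 22024025453072732001466],
  [22024025445072833001547, 22024025344072732001466],
  [22023024631001062525, 22023024521001072447],
  [22023024522001062525, 22023024521001073733]],
  [[22031002052046362, 22032003052036574]],
  [[1001053433061045352],
  [21002003052034362]],
  [[22023024023633062525, 22023024023742073541]],
  [[22023041052051, 21002003044051, 21002003043051, 22023041041047, 21001003035073, 21001003035047,
  22023041052025, 21001003052073, 21002003044025, 21002003043025, 22023041035025, 21001003052047]],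
  [[22031001052047551],
  [22031021001073764],
  [22023024521001037466],
  [22023024521001047772],
  [22023431001424001073733],
  [22023024521001047635],
  [22023024521001072476],
  [22023431001424001035477],
  [22031041001062525],
  [22031001052062365]]]

theorem table7d_check : table7d.all₂ ThetaEntry.check unknotting7d = true := by decide +kernel

theorem forall_of_all₂_check {T : List ThetaEntry} {K : List (List (List ℕ))}
    (h : T.all₂ ThetaEntry.check K = true) : ∀ t ∈ T, t.Correct := fun t ht =>
  have ⟨_, _, h⟩ := exists_of_all₂ h t ht
  ThetaEntry.correct_of_check h

theorem correct_of_mem_table : ∀ t ∈ table, t.Correct := by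
  simp only [table, List.forall_mem_append]
  exact ⟨⟨⟨⟨⟨⟨⟨forall_of_all₂_check table3_check, forall_of_all₂_check table4_check⟩,
    forall_of_all₂_check table5_check⟩, forall_of_all₂_check table6_check⟩,
    forall_of_all₂_check table7a_check⟩, forall_of_all₂_check table7b_check⟩,
    forall_of_all₂_check table7c_check⟩, forall_of_all₂_check table7d_check⟩

theorem map_crossings_table : table.map ThetaEntry.crossings = List.replicate 1 3 ++
    List.replicate 1 4 ++ List.replicate 7 5 ++ List.replicate 16 6 ++ List.replicate 65 7 := by
  decide +kernel

end ThetaCurve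

open ThetaCurve in
theorem proposition4p1 :
    (∀ n : ℕ, table.countP (fun t => t.crossings == n) =
      if n = 3 then 1 else if n = 4 then 1 else if n = 5 then 7 else if n = 6 then 16
      else if n = 7 then 65 else 0) ∧
    ∀ t ∈ table, t.codes ≠ [] ∧ ∀ d ∈ t.codes,
      IsThetaDiagram (ofCode d.1) ∧
      (ofCode d.1).map Node.isCrossing = List.replicate t.crossings true ++ [false, false] ∧
      d.2 ≠ [] ∧ ∀ s ∈ d.2,
        (Nat.digits 10 s).Nodup ∧ (Nat.digits 10 s).length = t.changes ∧
        (∀ i ∈ Nat.digits 10 s, 1 ≤ i ∧ i ≤ t.crossings) ∧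
        ReidemeisterEquiv (changeCrossings (Nat.digits 10 s) (ofCode d.1)) trivialTheta := by
  refine ⟨fun n => ?_, correct_of_mem_table⟩
  -- The crossing numbers form a concatenation of constant lists, which gives the counts for all `n`
  -- at once.
  have : table.countP (fun t => t.crossings == n) = (table.map ThetaEntry.crossings).count n := by
    rw [List.count_eq_countP, List.countP_map]
    rfl
  rw [this, map_crossings_table]
  simp only [List.count_append, List.count_replicate, beq_iff_eq, eq_comm (b := n)]
  split_ifs <;> omega
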